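/- **Setting.** Let $N\ge 1$, $\ell>0$ and, for $s=1,\dots,N$, let $L_s>0$, let $V_s\in L^1(0,L_s)$ be real-valued, and let $b_s,c_s,d_s\in\mathbb R$. The comb graph is a line with teeth of lengths $L_s$ attached at the points $x_s=(s-1)\ell$. In $L^2(\mathbb R)\oplus\bigoplus_s L^2(0,L_s)$ the comb Hamiltonian $H_N$ acts as $(f,u_1,\dots,u_N)\mapsto(-f'',-u_1''+V_1u_1,\dots,-u_N''+V_Nu_N)$ on those vectors for which the result is again in the Hilbert space, $u_s\in AC^2[0,L_s]$, $f$ is continuous on $\mathbb R$ and $AC^2$ on every compact interval having no $x_s$ in its interior, and $$u_s(0)=b_sf(x_s)+c_su_s'(0),\quad f'(x_s+)-f'(x_s-)=d_sf(x_s)-b_su_s'(0),\quad u_s(L_s)=0 .$$ For $k\in\mathbb C$ let $u_{L,s}$ and $u_{0,s}$ be the solutions of $-u''+V_su=k^2u$ on $[0,L_s]$ with $u_{L,s}(L_s)=0$, $u_{L,s}'(L_s)=1$ and $u_{0,s}(0)=0$, $u_{0,s}'(0)=1$. Put $\varepsilon=e^{ik\ell}$, $R_1(x,y)=\frac{i}{2k}e^{ik|x-y|}$,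 $$\beta_s=\frac{d_s}{2k}+\frac{b_s^2}{2k}\Big(\frac{u_{L,s}'}{c_su_{L,s}'-u_{L,s}}\Big)(0),\qquad D_N=\det\big(i\beta_n\varepsilon^{|s-n|}+\delta_{sn}\big)_{s,n=1}^N .$$ Call $k\neq0$ *regular* if $u_{L,s}(0)\ne0$ and $(c_su_{L,s}'-u_{L,s})(0)\neq0$ for all $s$. Let $G_0$ be the diagonal matrix kernel with entries $R_1(x,y)$ on the line and $-u_{0,s}(x_<)u_{L,s}(x_>)/W(u_{0,s},u_{L,s})$ on the teeth, where $W(u,v)=uv'-u'v$. For $n=1,\dots,N$ let $F_n$ have the line component $R_1(\cdot,x_n)$ and $F_{N+n}$ the component $u_{L,n}$ on the $n$-th tooth, all other components being zero. Let $\lambda=(\lambda_{mn})_{m,n=1}^{2N}$ be the solution of the system ($s=1,\dots,N$, $l=1,\dots,2N$) $$\sum_{n=1}^N\tfrac{ib_s}{2k}\varepsilon^{|s-n|}\lambda_{nl}+(c_su_{L,s}'-u_{L,s})(0)\,\lambda_{N+s,l}=-b_s\delta_{l,s}-\tfrac{c_s}{u_{L,s}(0)}\delta_{l,N+s},$$ $$\sum_{n=1}^N\big(\tfrac{id_s}{2k}\varepsilon^{|s-n|}+\delta_{sn}\big)\lambda_{nl}-b_su_{L,s}'(0)\,\lambda_{N+s,l}=-d_s\delta_{l,s}+\tfrac{b_s}{u_{L,s}(0)}\delta_{l,N+s},$$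 and put $G(x,y;k)=G_0(x,y;k)+\sum_{m,n=1}^{2N}\lambda_{mn}(k)F_m(x)F_n(y)$ (a matrix kernel). **Theorem. (a) General comb.** The solutions $u_{L,s},u_{0,s}$ exist and are unique on $[0,L_s]$. Every $k$ with $k^2\notin\mathbb R$ is regular, and the non-regular $k$ form a set without accumulation points in $\mathbb C$. If $\operatorname{Im}k>0$, $k$ is regular and $D_N(k)\ne0$, then the system for $\lambda$ is uniquely solvable, the resolvent at $k^2$ of the fully decoupled operator (all $b_s=c_s=d_s=0$) is the integral operator with kernel $G_0$, and $(H_N-k^2)^{-1}$ exists as a bounded operator and is the integral operator with kernel $G(\cdot,\cdot;k)$ (Krein formula). If $\operatorname{Im}k>0$ and $k$ is regular, then $k^2$ is in the resolvent set of $H_N$ if and only if $D_N(k)\neq0$; and $D_N(k)\ne0$ whenever $\operatorname{Im}k>0$ and $k^2\notin\mathbb R$. For all points $x,y$ of the graph, every entry of $G(x,y;k)$ is meromorphic in $k\in\mathbb C$. At every regular $k_0\in\mathbb C$ the following are equivalent: $D_N(k_0)=0$; the determinant of the system for $\lambda$ vanishes at $k_0$; some $\lambda_{mn}$ has a pole at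 $k_0$; the continued resolvent kernel has a pole at $k_0$ (that is, some entry of $k\mapsto G(x,y;k)$, for some $x,y$, has a pole there). **(b) Periodic comb.** Let $L_s=L$, $V_s=V$, $b_s=b$, $c_s=c$, $d_s=d$ for all $s$, so that $\beta_s=\beta$ for all $s$. Put $\zeta=\cos k\ell+\beta\sin k\ell$ and $\Delta=\varepsilon U_{N-2}(\zeta)-(1+i\beta)U_{N-1}(\zeta)$ with the Chebyshev polynomials of the second kind ($U_{-1}=0$). For every regular $k$, $$D_N=-\varepsilon^{N-1}\big(\varepsilon U_{N-2}(\zeta)-(1+i\beta)U_{N-1}(\zeta)\big).$$ The S-matrix $S(k)$ is defined by $\binom{B_+}{B_-}=S(k)\binom{A_+}{A_-}$ for the solutions of $H_N\psi=k^2\psi$ which satisfy the regularity, junction and Dirichlet conditions (but need not be square integrable) and whose line component is $A_+e^{ikx}+B_-e^{-ikx}$ for $x\le0$ and $B_+e^{ikx}+A_-e^{-ikx}$ for $x\ge(N-1)\ell$. For regular $k$ with $D_N(k)\ne0$ it exists and $$S=\begin{pmatrix}t_N&\varepsilon^{2-2N}r_N\\ r_N&t_N\end{pmatrix},\qquad r_N=\frac{i\beta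 U_{N-1}(\zeta)}{\Delta},\qquad t_N=-\frac{\varepsilon^{1-N}}{\Delta};$$ its entries are meromorphic functions of $k\in\mathbb C$. At every regular $k_0$ (in particular whenever $k_0^2\notin\mathbb R$) one has $D_N(k_0)=0$ if and only if $\Delta(k_0)=0$, if and only if the continued resolvent kernel has a pole at $k_0$, if and only if $S$ has a pole at $k_0$; thus the poles of the continued resolvent and of the S-matrix coincide, except possibly at the isolated non-regular momenta. -/

import Mathlib

open MeasureTheory Set Filter Topology

noncomputable section

namespace CombGraph

/-! ### One-dimensional preliminaries -/

/-- `u ∈ AC²[a,b]`: `u` is differentiable on `[a,b]` (one-sidedly at the endpoints) and its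
derivative is absolutely continuous on `[a,b]`. -/
def IsAC2 (u : ℝ → ℂ) (a b : ℝ) : Prop :=
  DifferentiableOn ℝ u (Icc a b) ∧ AbsolutelyContinuousOnInterval (derivWithin u (Icc a b)) a b

/-- The right derivative `u'(x+)`. -/
def rightDeriv (u : ℝ → ℂ) (x : ℝ) : ℂ := derivWithin u (Ici x) x

/-- The left derivative `u'(x-)`. -/
def leftDeriv (u : ℝ → ℂ) (x : ℝ) : ℂ := derivWithin u (Iic x) x

/-- `u` solves `-u'' + V u = z u` on a tooth of length `L`. -/
def IsToothSolution (V : ℝ → ℝ) (L : ℝ) (z : ℂ) (u : ℝ → ℂ) : Prop :=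
  IsAC2 u 0 L ∧
    ∀ᵐ x ∂(volume.restrict (Ioo 0 L)), -deriv (deriv u) x + (V x : ℂ) * u x = z * u x

/-- The solution on the tooth with `u(L) = 0`, `u'(L) = 1`, normalized Dirichlet at the outer end. -/
def IsOuterSolution (V : ℝ → ℝ) (L : ℝ) (z : ℂ) (u : ℝ → ℂ) : Prop :=
  IsToothSolution V L z u ∧ u L = 0 ∧ leftDeriv u L = 1

/-- The solution on the tooth with `u(0) = 0`, `u'(0) = 1`, normalized Dirichlet at the junction. -/
def IsInnerSolution (V : ℝ → ℝ) (L : ℝ) (z : ℂ) (u : ℝ → ℂ) : Prop :=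
  IsToothSolution V L z u ∧ u 0 = 0 ∧ rightDeriv u 0 = 1

/-- The function `u_L` (determined on `[0,L]`). -/
def outerSol (V : ℝ → ℝ) (L : ℝ) (z : ℂ) : ℝ → ℂ :=
  Classical.epsilon (IsOuterSolution V L z)

/-- The function `u_0` (determined on `[0,L]`). -/
def innerSol (V : ℝ → ℝ) (L : ℝ) (z : ℂ) : ℝ → ℂ :=
  Classical.epsilon (IsInnerSolution V L z)

/-- `β = d/(2k) + (b²/(2k)) (u_L' / (c u_L' - u_L))(0)`, with `u_L` taken at energy `k²`. -/
def effCoupling (V : ℝ → ℝ) (L b c d : ℝ) (k : ℂ) : ℂ :=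
  (d : ℂ) / (2 * k) + (b : ℂ) ^ 2 / (2 * k) *
    (rightDeriv (outerSol V L (k ^ 2)) 0 /
      ((c : ℂ) * rightDeriv (outerSol V L (k ^ 2)) 0 - outerSol V L (k ^ 2) 0))

/-- The free resolvent kernel on the line, `R₁(x,y;k²) = (i/2k) e^{ik|x-y|}`. -/
def lineKernel (k : ℂ) (x y : ℝ) : ℂ :=
  Complex.I / (2 * k) * Complex.exp (Complex.I * k * ((|x - y| : ℝ) : ℂ))

/-- The resolvent kernel `-u_0(x_<) u_L(x_>) / W(u_0,u_L)` of a tooth with Dirichlet conditions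
at both ends; the constant Wronskian is evaluated at the junction. -/
def toothKernel (V : ℝ → ℝ) (L : ℝ) (k : ℂ) (x y : ℝ) : ℂ :=
  -(innerSol V L (k ^ 2) (min x y) * outerSol V L (k ^ 2) (max x y)) /
    (innerSol V L (k ^ 2) 0 * rightDeriv (outerSol V L (k ^ 2)) 0 -
      rightDeriv (innerSol V L (k ^ 2)) 0 * outerSol V L (k ^ 2) 0)

/-- A function of the complex momentum has a pole at `k₀`. -/
def HasPoleAt (f : ℂ → ℂ) (k₀ : ℂ) : Prop :=
  MeromorphicAt f k₀ ∧ meromorphicOrderAt f k₀ < 0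

/-! ### Helper facts on `AC²` functions -/

theorem IsAC2.differentiableAt {u : ℝ → ℂ} {a b x : ℝ} (hu : IsAC2 u a b) (hx : x ∈ Ioo a b) :
    DifferentiableAt ℝ u x :=
  (hu.1 x (Ioo_subset_Icc_self hx)).differentiableAt (Icc_mem_nhds hx.1 hx.2)

theorem IsAC2.differentiableWithinAt_right {u : ℝ → ℂ} {a b : ℝ} (hu : IsAC2 u a b) (hab : a < b) :
    DifferentiableWithinAt ℝ u (Ici a) a :=
  (hu.1 a (left_mem_Icc.2 hab.le)).mono_of_mem_nhdsWithin (Icc_mem_nhdsGE hab)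

theorem IsAC2.differentiableWithinAt_left {u : ℝ → ℂ} {a b : ℝ} (hu : IsAC2 u a b) (hab : a < b) :
    DifferentiableWithinAt ℝ u (Iic b) b :=
  (hu.1 b (right_mem_Icc.2 hab.le)).mono_of_mem_nhdsWithin (Icc_mem_nhdsLE hab)

theorem absolutelyContinuous_congr {u v : ℝ → ℂ} {a b : ℝ} (hab : a ≤ b)
    (hu : AbsolutelyContinuousOnInterval u a b) (h : EqOn u v (Icc a b)) :
    AbsolutelyContinuousOnInterval v a b := by
  rw [absolutelyContinuousOnInterval_iff] at hu ⊢
  intro ε hε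
  obtain ⟨δ, hδ, H⟩ := hu ε hε
  refine ⟨δ, hδ, fun E hE hl => ?_⟩
  have := H E hE hl
  refine lt_of_le_of_lt (le_of_eq ?_) this
  refine Finset.sum_congr rfl fun i hi => ?_
  have h1 := hE.1 i hi
  rw [uIcc_of_le hab] at h1
  rw [h h1.1, h h1.2]

theorem IsAC2.add {u v : ℝ → ℂ} {a b : ℝ} (hab : a < b) (hu : IsAC2 u a b) (hv : IsAC2 v a b) :
    IsAC2 (u + v) a b := by
  refine ⟨hu.1.add hv.1, absolutelyContinuous_congr hab.le (hu.2.add hv.2) fun x hx => ?_⟩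
  exact (derivWithin_add (hu.1 x hx) (hv.1 x hx)).symm

theorem IsAC2.smul {u : ℝ → ℂ} {a b : ℝ} (hab : a < b) (r : ℂ) (hu : IsAC2 u a b) :
    IsAC2 (r • u) a b := by
  refine ⟨hu.1.const_smul r, absolutelyContinuous_congr hab.le (hu.2.const_smul r) fun x hx => ?_⟩
  exact (derivWithin_const_smul r (hu.1 x hx)).symm

theorem IsAC2.zero {a b : ℝ} (hab : a < b) : IsAC2 (0 : ℝ → ℂ) a b := by
  refine ⟨differentiableOn_const _, ?_⟩
  refine absolutelyContinuous_congr (u := fun _ => (0 : ℂ)) hab.le ?_ fun x _ => ?_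
  · exact (LipschitzWith.const (0 : ℂ)).lipschitzOnWith.absolutelyContinuousOnInterval
  · exact (congrFun (derivWithin_const (Icc a b) (0 : ℂ)) x).symm

theorem IsAC2.ae_differentiableAt_deriv {u : ℝ → ℂ} {a b : ℝ} (hu : IsAC2 u a b) :
    ∀ᵐ x, x ∈ Ioo a b → DifferentiableAt ℝ (deriv u) x ∧ ∀ᶠ y in 𝓝 x, DifferentiableAt ℝ u y := by
  filter_upwards [hu.2.boundedVariationOn.ae_differentiableAt_of_mem_uIcc] with x hx hxI
  have hn : Ioo a b ∈ 𝓝 x := Ioo_mem_nhds hxI.1 hxI.2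
  refine ⟨?_, Filter.mem_of_superset hn fun y hy => hu.differentiableAt hy⟩
  have h1 := hx (Icc_subset_uIcc (Ioo_subset_Icc_self hxI))
  refine h1.congr_of_eventuallyEq (Filter.mem_of_superset hn fun y hy => ?_)
  exact (derivWithin_of_mem_nhds (Icc_mem_nhds hy.1 hy.2)).symm

theorem IsAC2.deriv_deriv_eq_zero {u : ℝ → ℂ} {a b : ℝ} (hu : IsAC2 u a b)
    (h0 : u =ᵐ[volume.restrict (Ioo a b)] 0) :
    ∀ x ∈ Ioo a b, u x = 0 ∧ deriv (deriv u) x = 0 := by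
  have h : EqOn u 0 (Ioo a b) :=
    Measure.eqOn_open_of_ae_eq h0 isOpen_Ioo
      (hu.1.continuousOn.mono Ioo_subset_Icc_self) continuousOn_const
  have h1 : ∀ x ∈ Ioo a b, deriv u x = 0 := fun x hx => by
    have : u =ᶠ[𝓝 x] 0 := Filter.mem_of_superset (Ioo_mem_nhds hx.1 hx.2) h
    rw [this.deriv_eq]
    exact deriv_const x (0 : ℂ)
  intro x hx
  refine ⟨h hx, ?_⟩
  have : deriv u =ᶠ[𝓝 x] 0 := Filter.mem_of_superset (Ioo_mem_nhds hx.1 hx.2) h1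
  rw [this.deriv_eq]
  exact deriv_const x (0 : ℂ)

end CombGraph

/-- The data of a comb graph with `N` teeth: spacing `ℓ`, tooth lengths `L s`, real integrable
potentials `V s` on the teeth, and the real coupling constants `b s, c s, d s` of the junctions. -/
structure CombGraph (N : ℕ) where
  ℓ : ℝ
  L : Fin N → ℝ
  V : Fin N → ℝ → ℝ
  b : Fin N → ℝ
  c : Fin N → ℝ
  d : Fin N → ℝ
  ℓ_pos : 0 < ℓ
  L_pos : ∀ s, 0 < L s
  V_int : ∀ s, IntegrableOn (V s) (Ioo 0 (L s)) volume

namespace CombGraph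

variable {N : ℕ}

/-! ### The state space and the Hamiltonian

The edges of the graph are indexed by `Option (Fin N)`: `none` is the line, `some s` a tooth. -/

/-- The set of points of an edge: `ℝ` for the line, `[0, L s]` for a tooth. -/
def edge (Γ : CombGraph N) : Option (Fin N) → Set ℝ
  | none => univ
  | some s => Icc 0 (Γ.L s)

/-- Lebesgue measure on an edge. -/
def edgeMeasure (Γ : CombGraph N) : Option (Fin N) → Measure ℝ
  | none => volume
  | some s => volume.restrict (Ioo 0 (Γ.L s))

/-- The junction points `0, ℓ, …, (N-1)ℓ` on the line. -/
def node (Γ : CombGraph N) (s : Fin N) : ℝ := (s : ℕ) * Γ.ℓ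

/-- The Hilbert space `L²(ℝ) ⊕ ⨁ₛ L²(0, L s)`. -/
abbrev Space (Γ : CombGraph N) : Type :=
  PiLp 2 (fun i : Option (Fin N) => Lp ℂ 2 (Γ.edgeMeasure i))

/-- `ψ` is locally in the domain of the Hamiltonian: `AC²` regularity of the line component `f`
away from the junctions (up to them from both sides, with `f` continuous there) and of the tooth
components `u s`, the coupling conditions at the junctions, and the Dirichlet condition at the
outer ends of the teeth. -/
structure IsLocallyInDomain (Γ : CombGraph N) (ψ : Option (Fin N) → ℝ → ℂ) : Prop where
  line_reg : ∀ x y : ℝ, x < y → (∀ s, Γ.node s ∉ Ioo x y) → IsAC2 (ψ none) x y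
  tooth_reg : ∀ s, IsAC2 (ψ (some s)) 0 (Γ.L s)
  tooth_bc : ∀ s, ψ (some s) 0 =
    (Γ.b s : ℂ) * ψ none (Γ.node s) + (Γ.c s : ℂ) * rightDeriv (ψ (some s)) 0
  line_bc : ∀ s, rightDeriv (ψ none) (Γ.node s) - leftDeriv (ψ none) (Γ.node s) =
    (Γ.d s : ℂ) * ψ none (Γ.node s) - (Γ.b s : ℂ) * rightDeriv (ψ (some s)) 0
  dirichlet : ∀ s, ψ (some s) (Γ.L s) = 0

/-- The differential expression: `-f''` on the line, `-u'' + V u` on the teeth. -/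
def action (Γ : CombGraph N) (ψ : Option (Fin N) → ℝ → ℂ) : Option (Fin N) → ℝ → ℂ
  | none => fun x => -deriv (deriv (ψ none)) x
  | some s => fun x => -deriv (deriv (ψ (some s))) x + (Γ.V s x : ℂ) * ψ (some s) x

theorem node_notMem_right (Γ : CombGraph N) (n : ℤ) (s : Fin N) :
    Γ.node s ∉ Ioo (n * Γ.ℓ) ((n + 1) * Γ.ℓ) := by
  rintro ⟨h1, h2⟩
  have h3 := lt_of_mul_lt_mul_right h1 Γ.ℓ_pos.le
  have h4 := lt_of_mul_lt_mul_right h2 Γ.ℓ_pos.le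
  have h5 : n < ((s : ℕ) : ℤ) := by exact_mod_cast h3
  have h6 : ((s : ℕ) : ℤ) < n + 1 := by exact_mod_cast h4
  omega

theorem IsLocallyInDomain.cell {Γ : CombGraph N} {ψ : Option (Fin N) → ℝ → ℂ}
    (h : Γ.IsLocallyInDomain ψ) (n : ℤ) : IsAC2 (ψ none) (n * Γ.ℓ) ((n + 1) * Γ.ℓ) :=
  h.line_reg _ _ (by nlinarith [Γ.ℓ_pos]) (Γ.node_notMem_right n)

theorem ae_mem_cell (Γ : CombGraph N) :
    ∀ᵐ x : ℝ, ∃ n : ℤ, x ∈ Ioo (n * Γ.ℓ) ((n + 1) * Γ.ℓ) := by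
  have hc : (range fun n : ℤ => (n : ℝ) * Γ.ℓ).Countable := countable_range _
  filter_upwards [hc.ae_notMem volume] with x hx
  refine ⟨⌊x / Γ.ℓ⌋, lt_of_le_of_ne ?_ fun h => hx ⟨_, h⟩, ?_⟩
  · exact (le_div_iff₀ Γ.ℓ_pos).1 (Int.floor_le _)
  · exact (div_lt_iff₀ Γ.ℓ_pos).1 (Int.lt_floor_add_one _)

theorem IsLocallyInDomain.ae_differentiableAt {Γ : CombGraph N} {ψ : Option (Fin N) → ℝ → ℂ}
    (h : Γ.IsLocallyInDomain ψ) (i : Option (Fin N)) :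
    ∀ᵐ x ∂(Γ.edgeMeasure i),
      DifferentiableAt ℝ (deriv (ψ i)) x ∧ ∀ᶠ y in 𝓝 x, DifferentiableAt ℝ (ψ i) y := by
  cases i with
  | none =>
    filter_upwards [Γ.ae_mem_cell, ae_all_iff.2 fun n => (h.cell n).ae_differentiableAt_deriv]
      with x ⟨n, hn⟩ hx
    exact hx n hn
  | some s =>
    exact (ae_restrict_iff' measurableSet_Ioo).2 (h.tooth_reg s).ae_differentiableAt_deriv

theorem IsLocallyInDomain.action_eq_zero {Γ : CombGraph N} {ψ : Option (Fin N) → ℝ → ℂ}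
    (h : Γ.IsLocallyInDomain ψ) (h0 : ∀ i, ψ i =ᵐ[Γ.edgeMeasure i] 0) (i : Option (Fin N)) :
    Γ.action ψ i =ᵐ[Γ.edgeMeasure i] 0 := by
  cases i with
  | none =>
    filter_upwards [Γ.ae_mem_cell] with x ⟨n, hn⟩
    have := (h.cell n).deriv_deriv_eq_zero (ae_restrict_of_ae (h0 none)) x hn
    simp [action, this.2]
  | some s =>
    refine (ae_restrict_iff' measurableSet_Ioo).2 (Eventually.of_forall fun x hx => ?_)
    have := (h.tooth_reg s).deriv_deriv_eq_zero (h0 (some s)) x hx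
    simp [action, this.1, this.2]

theorem IsLocallyInDomain.right_node {Γ : CombGraph N} {ψ : Option (Fin N) → ℝ → ℂ}
    (h : Γ.IsLocallyInDomain ψ) (s : Fin N) :
    DifferentiableWithinAt ℝ (ψ none) (Ici (Γ.node s)) (Γ.node s) := by
  have := (h.cell (s : ℕ)).differentiableWithinAt_right (by nlinarith [Γ.ℓ_pos])
  simpa [node] using this

theorem IsLocallyInDomain.left_node {Γ : CombGraph N} {ψ : Option (Fin N) → ℝ → ℂ}
    (h : Γ.IsLocallyInDomain ψ) (s : Fin N) :
    DifferentiableWithinAt ℝ (ψ none) (Iic (Γ.node s)) (Γ.node s) := by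
  have := (h.cell ((s : ℕ) - 1)).differentiableWithinAt_left (by nlinarith [Γ.ℓ_pos])
  simpa [node] using this

theorem IsLocallyInDomain.right_tooth {Γ : CombGraph N} {ψ : Option (Fin N) → ℝ → ℂ}
    (h : Γ.IsLocallyInDomain ψ) (s : Fin N) :
    DifferentiableWithinAt ℝ (ψ (some s)) (Ici 0) 0 :=
  (h.tooth_reg s).differentiableWithinAt_right (Γ.L_pos s)

theorem IsLocallyInDomain.add {Γ : CombGraph N} {ψ φ : Option (Fin N) → ℝ → ℂ}
    (h : Γ.IsLocallyInDomain ψ) (h' : Γ.IsLocallyInDomain φ) : Γ.IsLocallyInDomain (ψ + φ) where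
  line_reg x y hxy hs := (h.line_reg x y hxy hs).add hxy (h'.line_reg x y hxy hs)
  tooth_reg s := (h.tooth_reg s).add (Γ.L_pos s) (h'.tooth_reg s)
  tooth_bc s := by
    have e : rightDeriv ((ψ + φ) (some s)) 0 = _ :=
      derivWithin_add (h.right_tooth s) (h'.right_tooth s)
    rw [e]
    simp only [Pi.add_apply, h.tooth_bc s, h'.tooth_bc s, rightDeriv]
    ring
  line_bc s := by
    have e : rightDeriv ((ψ + φ) (some s)) 0 = _ :=
      derivWithin_add (h.right_tooth s) (h'.right_tooth s)
    have e1 : rightDeriv ((ψ + φ) none) (Γ.node s) = _ :=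
      derivWithin_add (h.right_node s) (h'.right_node s)
    have e2 : leftDeriv ((ψ + φ) none) (Γ.node s) = _ :=
      derivWithin_add (h.left_node s) (h'.left_node s)
    rw [e, e1, e2]
    have a1 := h.line_bc s
    have a2 := h'.line_bc s
    simp only [Pi.add_apply, rightDeriv, leftDeriv] at a1 a2 ⊢
    linear_combination a1 + a2
  dirichlet s := by simp [h.dirichlet s, h'.dirichlet s]

theorem IsLocallyInDomain.smul {Γ : CombGraph N} {ψ : Option (Fin N) → ℝ → ℂ} (r : ℂ)
    (h : Γ.IsLocallyInDomain ψ) : Γ.IsLocallyInDomain (r • ψ) where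
  line_reg x y hxy hs := (h.line_reg x y hxy hs).smul hxy r
  tooth_reg s := (h.tooth_reg s).smul (Γ.L_pos s) r
  tooth_bc s := by
    have e : rightDeriv ((r • ψ) (some s)) 0 = _ := derivWithin_const_smul r (h.right_tooth s)
    rw [e]
    simp only [Pi.smul_apply, h.tooth_bc s, rightDeriv, smul_eq_mul]
    ring
  line_bc s := by
    have e : rightDeriv ((r • ψ) (some s)) 0 = _ := derivWithin_const_smul r (h.right_tooth s)
    have e1 : rightDeriv ((r • ψ) none) (Γ.node s) = _ := derivWithin_const_smul r (h.right_node s)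
    have e2 : leftDeriv ((r • ψ) none) (Γ.node s) = _ := derivWithin_const_smul r (h.left_node s)
    rw [e, e1, e2]
    have a1 := h.line_bc s
    simp only [Pi.smul_apply, smul_eq_mul, rightDeriv, leftDeriv] at a1 ⊢
    linear_combination r * a1
  dirichlet s := by simp [h.dirichlet s]

theorem IsLocallyInDomain.zero (Γ : CombGraph N) : Γ.IsLocallyInDomain 0 where
  line_reg x y hxy _ := IsAC2.zero hxy
  tooth_reg s := IsAC2.zero (Γ.L_pos s)
  tooth_bc s := by simp [rightDeriv]
  line_bc s := by simp [rightDeriv, leftDeriv]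
  dirichlet s := by simp

theorem IsLocallyInDomain.action_add {Γ : CombGraph N} {ψ φ : Option (Fin N) → ℝ → ℂ}
    (h : Γ.IsLocallyInDomain ψ) (h' : Γ.IsLocallyInDomain φ) (i : Option (Fin N)) :
    Γ.action (ψ + φ) i =ᵐ[Γ.edgeMeasure i] Γ.action ψ i + Γ.action φ i := by
  filter_upwards [h.ae_differentiableAt i, h'.ae_differentiableAt i] with x hx hx'
  have e : deriv ((ψ + φ) i) =ᶠ[𝓝 x] deriv (ψ i) + deriv (φ i) := by
    filter_upwards [hx.2, hx'.2] with y hy hy'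
    exact deriv_add hy hy'
  have e2 : deriv (deriv ((ψ + φ) i)) x = deriv (deriv (ψ i)) x + deriv (deriv (φ i)) x := by
    rw [e.deriv_eq]
    exact deriv_add hx.1 hx'.1
  cases i with
  | none => simp only [action, Pi.add_apply] at e2 ⊢; rw [e2]; ring
  | some s => simp only [action, Pi.add_apply] at e2 ⊢; rw [e2]; ring

theorem IsLocallyInDomain.action_smul {Γ : CombGraph N} {ψ : Option (Fin N) → ℝ → ℂ} (r : ℂ)
    (h : Γ.IsLocallyInDomain ψ) (i : Option (Fin N)) :
    Γ.action (r • ψ) i =ᵐ[Γ.edgeMeasure i] r • Γ.action ψ i := by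
  filter_upwards [h.ae_differentiableAt i] with x hx
  have e : deriv ((r • ψ) i) =ᶠ[𝓝 x] r • deriv (ψ i) := by
    filter_upwards [hx.2] with y hy
    exact deriv_const_smul r hy
  have e2 : deriv (deriv ((r • ψ) i)) x = r * deriv (deriv (ψ i)) x := by
    rw [e.deriv_eq]
    exact deriv_const_smul r hx.1
  cases i with
  | none => simp only [action, Pi.smul_apply, smul_eq_mul] at e2 ⊢; rw [e2]; ring
  | some s => simp only [action, Pi.smul_apply, smul_eq_mul] at e2 ⊢; rw [e2]; ring

/-- The graph of the comb Hamiltonian: the pairs `(Ψ, Hψ)` in `L²(Γ) × L²(Γ)` for which `Ψ` has a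
representative `ψ` satisfying the regularity, coupling and Dirichlet conditions. -/
def hamiltonianGraph (Γ : CombGraph N) : Submodule ℂ (Γ.Space × Γ.Space) where
  carrier := {p | ∃ ψ : Option (Fin N) → ℝ → ℂ, Γ.IsLocallyInDomain ψ ∧
    (∀ i, p.1 i =ᵐ[Γ.edgeMeasure i] ψ i) ∧ ∀ i, p.2 i =ᵐ[Γ.edgeMeasure i] Γ.action ψ i}
  add_mem' := by
    rintro p q ⟨ψ, h, h1, h2⟩ ⟨φ, h', h1', h2'⟩
    refine ⟨ψ + φ, h.add h', fun i => ?_, fun i => ?_⟩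
    · exact (Lp.coeFn_add (p.1 i) (q.1 i)).trans ((h1 i).add (h1' i))
    · exact (Lp.coeFn_add (p.2 i) (q.2 i)).trans
        (((h2 i).add (h2' i)).trans (h.action_add h' i).symm)
  zero_mem' := by
    refine ⟨0, IsLocallyInDomain.zero Γ, fun i => Lp.coeFn_zero _ _ _, fun i => ?_⟩
    exact (Lp.coeFn_zero _ _ _).trans
      ((IsLocallyInDomain.zero Γ).action_eq_zero (fun _ => EventuallyEq.rfl) i).symm
  smul_mem' := by
    rintro r p ⟨ψ, h, h1, h2⟩
    refine ⟨r • ψ, h.smul r, fun i => ?_, fun i => ?_⟩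
    · exact (Lp.coeFn_smul r (p.1 i)).trans ((h1 i).const_smul r)
    · exact (Lp.coeFn_smul r (p.2 i)).trans (((h2 i).const_smul r).trans (h.action_smul r i).symm)

theorem hamiltonianGraph_functional (Γ : CombGraph N) :
    ∀ p ∈ Γ.hamiltonianGraph, p.1 = 0 → p.2 = 0 := by
  rintro p ⟨ψ, h, h1, h2⟩ hp
  have h0 : ∀ i, ψ i =ᵐ[Γ.edgeMeasure i] 0 := fun i => by
    refine (h1 i).symm.trans ?_
    rw [hp]
    exact Lp.coeFn_zero _ _ _
  refine PiLp.ext fun i => ?_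
  refine Lp.ext ?_
  exact (h2 i).trans ((h.action_eq_zero h0 i).trans (Lp.coeFn_zero _ _ _).symm)

/-- The comb Hamiltonian, an unbounded operator in `L²(Γ)`. -/
def hamiltonian (Γ : CombGraph N) : Γ.Space →ₗ.[ℂ] Γ.Space :=
  Γ.hamiltonianGraph.toLinearPMap

/-- The defining graph is indeed the graph of the operator. -/
theorem hamiltonian_graph (Γ : CombGraph N) : Γ.hamiltonian.graph = Γ.hamiltonianGraph :=
  Submodule.toLinearPMap_graph_eq _ fun p hp h0 => Γ.hamiltonianGraph_functional p hp h0

/-- The bounded operator `R` is the resolvent `(H - z)⁻¹`: `R Φ = Ψ` holds iff `Ψ` lies in the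
domain of `H` and `(H - z) Ψ = Φ`. -/
def IsResolvent {E : Type*} [NormedAddCommGroup E] [NormedSpace ℂ E]
    (H : E →ₗ.[ℂ] E) (z : ℂ) (R : E →L[ℂ] E) : Prop :=
  ∀ Φ Ψ : E, R Φ = Ψ ↔ ∃ hΨ : Ψ ∈ H.domain, H ⟨Ψ, hΨ⟩ - z • Ψ = Φ

/-- `z` belongs to the resolvent set of `H`. -/
def InResolventSet {E : Type*} [NormedAddCommGroup E] [NormedSpace ℂ E]
    (H : E →ₗ.[ℂ] E) (z : ℂ) : Prop :=
  ∃ R : E →L[ℂ] E, IsResolvent H z R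

/-- `R` is the integral operator in `L²(Γ)` whose (matrix) kernel is `G i j x y`. -/
def HasKernel (Γ : CombGraph N) (R : Γ.Space →L[ℂ] Γ.Space)
    (G : Option (Fin N) → Option (Fin N) → ℝ → ℝ → ℂ) : Prop :=
  ∀ (Φ : Γ.Space) (i : Option (Fin N)), ∀ᵐ x ∂(Γ.edgeMeasure i),
    (∀ j, Integrable (fun y => G i j x y * Φ j y) (Γ.edgeMeasure j)) ∧
      R Φ i x = ∑ j, ∫ y, G i j x y * Φ j y ∂(Γ.edgeMeasure j)

/-- The fully decoupled comb, `b = c = d = 0`, with the same edges and potentials. -/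
def decoupled (Γ : CombGraph N) : CombGraph N :=
  { Γ with b := 0, c := 0, d := 0 }

/-! ### The Krein kernel -/

/-- `u_{L,s}(·)` at energy `k²`. -/
def uL (Γ : CombGraph N) (k : ℂ) (s : Fin N) : ℝ → ℂ := outerSol (Γ.V s) (Γ.L s) (k ^ 2)

/-- `u_{0,s}(·)` at energy `k²`. -/
def u0 (Γ : CombGraph N) (k : ℂ) (s : Fin N) : ℝ → ℂ := innerSol (Γ.V s) (Γ.L s) (k ^ 2)

/-- `u_{L,s}'(0)` at energy `k²`. -/
def uL' (Γ : CombGraph N) (k : ℂ) (s : Fin N) : ℂ := rightDeriv (Γ.uL k s) 0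

/-- `ε = e^{ikℓ}`. -/
def eps (Γ : CombGraph N) (k : ℂ) : ℂ := Complex.exp (Complex.I * k * Γ.ℓ)

/-- `ε^{|s-n|}`. -/
def epsPow (Γ : CombGraph N) (k : ℂ) (s n : Fin N) : ℂ :=
  Γ.eps k ^ (((s : ℕ) : ℤ) - ((n : ℕ) : ℤ)).natAbs

/-- `k ≠ 0` is regular: `k²` is neither a Dirichlet eigenvalue of a tooth nor an eigenvalue of a
decoupled tooth with the condition `u(0) = c u'(0)`. -/
def IsRegular (Γ : CombGraph N) (k : ℂ) : Prop :=
  k ≠ 0 ∧ ∀ s, Γ.uL k s 0 ≠ 0 ∧ (Γ.c s : ℂ) * Γ.uL' k s - Γ.uL k s 0 ≠ 0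

/-- The resolvent kernel of the fully decoupled comb. -/
def freeKernel (Γ : CombGraph N) (k : ℂ) (i j : Option (Fin N)) (x y : ℝ) : ℂ :=
  match i, j with
  | none, none => lineKernel k x y
  | some s, some n => if s = n then toothKernel (Γ.V s) (Γ.L s) k x y else 0
  | _, _ => 0

/-- The deficiency vectors: `F (inl n)` has the line component `R₁(·, node n)`, `F (inr n)` has
the component `u_{L,n}` on the `n`-th tooth; all other components vanish. -/
def defVector (Γ : CombGraph N) (k : ℂ) (m : Fin N ⊕ Fin N) (i : Option (Fin N)) (x : ℝ) : ℂ :=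
  match m, i with
  | Sum.inl n, none => lineKernel k x (Γ.node n)
  | Sum.inr n, some s => if s = n then Γ.uL k n x else 0
  | _, _ => 0

/-- The matrix of the linear system for the Krein coefficients. -/
def coefMatrix (Γ : CombGraph N) (k : ℂ) : Matrix (Fin N ⊕ Fin N) (Fin N ⊕ Fin N) ℂ :=
  Matrix.fromBlocks
    (Matrix.of fun s n => Complex.I * Γ.b s / (2 * k) * Γ.epsPow k s n)
    (Matrix.diagonal fun s => (Γ.c s : ℂ) * Γ.uL' k s - Γ.uL k s 0)
    (Matrix.of fun s n => Complex.I * Γ.d s / (2 * k) * Γ.epsPow k s n + if s = n then 1 else 0)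
    (Matrix.diagonal fun s => -(Γ.b s : ℂ) * Γ.uL' k s)

/-- The right-hand side of the linear system for the Krein coefficients. -/
def coefRhs (Γ : CombGraph N) (k : ℂ) : Matrix (Fin N ⊕ Fin N) (Fin N ⊕ Fin N) ℂ :=
  Matrix.fromBlocks
    (Matrix.diagonal fun s => -(Γ.b s : ℂ))
    (Matrix.diagonal fun s => -(Γ.c s : ℂ) / Γ.uL k s 0)
    (Matrix.diagonal fun s => -(Γ.d s : ℂ))
    (Matrix.diagonal fun s => (Γ.b s : ℂ) / Γ.uL k s 0)

/-- The Krein coefficients `λ_{mn}(k)`, the solution of `coefMatrix * λ = coefRhs`. -/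
def kreinCoef (Γ : CombGraph N) (k : ℂ) : Matrix (Fin N ⊕ Fin N) (Fin N ⊕ Fin N) ℂ :=
  (Γ.coefMatrix k)⁻¹ * Γ.coefRhs k

/-- The Krein kernel `G₀(x,y) + ∑_{m,n} λ_{mn} F_m(x) F_n(y)`, as a function of the momentum
`k ∈ ℂ`. -/
def kreinKernel (Γ : CombGraph N) (k : ℂ) (i j : Option (Fin N)) (x y : ℝ) : ℂ :=
  Γ.freeKernel k i j x y +
    ∑ m, ∑ n, Γ.kreinCoef k m n * Γ.defVector k m i x * Γ.defVector k n j y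

/-- The (analytically continued) resolvent kernel has a pole at the momentum `k`. -/
def ResolventPole (Γ : CombGraph N) (k : ℂ) : Prop :=
  ∃ i j, ∃ x ∈ Γ.edge i, ∃ y ∈ Γ.edge j, HasPoleAt (fun k' => Γ.kreinKernel k' i j x y) k

/-- `β_s(k)`. -/
def beta (Γ : CombGraph N) (k : ℂ) (s : Fin N) : ℂ :=
  effCoupling (Γ.V s) (Γ.L s) (Γ.b s) (Γ.c s) (Γ.d s) k

/-- `D_N(k) = det(i β_n ε^{|s-n|} + δ_{sn})`. -/
def combDet (Γ : CombGraph N) (k : ℂ) : ℂ :=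
  Matrix.det (Matrix.of fun s n : Fin N =>
    Complex.I * Γ.beta k n * Γ.epsPow k s n + if s = n then 1 else 0)

/-! ### Scattering -/

/-- `ψ` is a generalized eigenfunction at energy `k²`: it is locally in the domain and solves
`Hψ = k² ψ` (without being required to be square integrable). -/
def IsGenEigenfunction (Γ : CombGraph N) (k : ℂ) (ψ : Option (Fin N) → ℝ → ℂ) : Prop :=
  Γ.IsLocallyInDomain ψ ∧ ∀ i, ∀ᵐ x ∂(Γ.edgeMeasure i), Γ.action ψ i x = k ^ 2 * ψ i x

/-- The line component is `A₊ e^{ikx} + B₋ e^{-ikx}` to the left of the comb and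
`B₊ e^{ikx} + A₋ e^{-ikx}` to the right of it. -/
def HasAsymptotics (Γ : CombGraph N) (k : ℂ) (ψ : Option (Fin N) → ℝ → ℂ)
    (Ap Am Bp Bm : ℂ) : Prop :=
  (∀ x : ℝ, x ≤ 0 → ψ none x =
    Ap * Complex.exp (Complex.I * k * x) + Bm * Complex.exp (-(Complex.I * k * x))) ∧
  (∀ x : ℝ, ((N : ℝ) - 1) * Γ.ℓ ≤ x → ψ none x =
    Bp * Complex.exp (Complex.I * k * x) + Am * Complex.exp (-(Complex.I * k * x)))

/-- `S` is the S-matrix at momentum `k`: `(B₊, B₋) = S (A₊, A₋)` characterizes the asymptotic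
coefficients of the generalized eigenfunctions. -/
def IsScatteringMatrix (Γ : CombGraph N) (k : ℂ) (S : Matrix (Fin 2) (Fin 2) ℂ) : Prop :=
  ∀ Ap Am Bp Bm : ℂ,
    (∃ ψ, Γ.IsGenEigenfunction k ψ ∧ Γ.HasAsymptotics k ψ Ap Am Bp Bm) ↔
      ![Bp, Bm] = S.mulVec ![Ap, Am]

/-- The S-matrix of the comb. -/
def scatteringMatrix (Γ : CombGraph N) (k : ℂ) : Matrix (Fin 2) (Fin 2) ℂ :=
  Classical.epsilon (Γ.IsScatteringMatrix k)

/-- The S-matrix has a pole at the momentum `k`. -/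
def ScatteringPole (Γ : CombGraph N) (k : ℂ) : Prop :=
  ∃ p q, HasPoleAt (fun k' => Γ.scatteringMatrix k' p q) k

/-- The periodic comb: all teeth, potentials and junctions are the same. -/
def periodic (N : ℕ) (ℓ L : ℝ) (V : ℝ → ℝ) (b c d : ℝ) (hℓ : 0 < ℓ) (hL : 0 < L)
    (hV : IntegrableOn V (Ioo 0 L) volume) : CombGraph N where
  ℓ := ℓ
  L := fun _ => L
  V := fun _ => V
  b := fun _ => b
  c := fun _ => c
  d := fun _ => d
  ℓ_pos := hℓ
  L_pos := fun _ => hL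
  V_int := fun _ => hV

/-- The denominator `ε U_{N-2}(ζ) - (1 + iβ) U_{N-1}(ζ)` of the scattering amplitudes. -/
def chebDenominator (N : ℕ) (ε β ζ : ℂ) : ℂ :=
  ε * (Polynomial.Chebyshev.U ℂ ((N : ℤ) - 2)).eval ζ -
    (1 + Complex.I * β) * (Polynomial.Chebyshev.U ℂ ((N : ℤ) - 1)).eval ζ

end CombGraph

end

open scoped ENNReal NNReal

noncomputable section

namespace CombGraph

variable {N : ℕ}

/-! ### Absolutely continuous functions with a prescribed derivative -/

/-! Everything reduces to the finite matrix `combMatrix`, whose determinant is D_N. On a tooth the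
Dirichlet condition leaves only multiples of `u_L`; eliminating the multiple at the junction turns
the tooth into a point interaction f'(x_s+) - f'(x_s-) = 2kβ_s f(x_s) on the line
(`IsGenEigenfunction.tooth_eq`, `two_mul_beta`). Since R₁(·,x_s) has derivative jump -1 at x_s,
every generalized eigenfunction is a plane wave minus Σ 2kβ_n f(x_n) R₁(·,x_n)
(`IsGenEigenfunction.exists_eq_genEig`), and evaluating at the junctions says that `combMatrix` maps
the junction values to those of the plane wave. For Im k > 0 square integrability removes the plane
wave, so eigenvectors correspond to null vectors of `combMatrix` (`inResolventSet_iff`).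

For the Krein formula, the decoupled resolvent (bounded by the Schur test, computed by variation of
constants) solves the inhomogeneous equation and the deficiency vectors solve the homogeneous one.
The coupling conditions are then exactly the rows of the linear system for λ (`kreinFun_spec`).
Eliminating the tooth coefficients from that system leaves the transpose of `combMatrix`
(`coefMatrix_mulVec_eq_zero_iff`), so both determinants vanish together at regular k. Injectivity of
H_N - k² comes from the eigenfunction analysis.

For non-real energy, Lagrange's identity on the teeth gives regularity (`outerSol_ne_zero`). A flux
argument along the line gives D_N ≠ 0: Im(k²) times the flux decreases from left to right, while the
outgoing form at the two ends forces the opposite inequality (`combDet_ne_zero_of_im_ne_zero`). This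
also supplies a point where the determinants are nonzero, so the identity theorem makes the
exceptional momenta isolated.

For the poles, the system for λ is not merely singular but unsolvable where its determinant
vanishes, because a left null vector would have to annihilate the right-hand side as well, and that
makes it zero (`coefMatrix_mul_ne_coefRhs`). Hence the λ_{mn} cannot all stay finite there
(`combDet_ne_zero_of_tendsto`). Finite combinations of point evaluations dual to the deficiency
vectors (`exists_dual_functional`) recover each λ_{mn} from the kernel, so the pole is visible in
the kernel itself (`resolventPole_iff`).

In the periodic case D_N is a Toeplitz determinant satisfying the Chebyshev recurrence up to powers
of ε (`det_expToeplitz`). The S-matrix comes from powers of a unimodular transfer matrix of trace 2ζ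
(`transfer_iterate`, `scattering_amplitudes`). The numerator of t_N never vanishes, so a zero of Δ
cannot be cancelled in S (`scatteringPole_iff`). -/

theorem absolutelyContinuous_comp_lipschitz {X Y : Type*} [PseudoMetricSpace X]
    [PseudoMetricSpace Y] {F : X → Y} {K : NNReal} (hF : LipschitzWith K F) {u : ℝ → X} {a b : ℝ}
    (hu : AbsolutelyContinuousOnInterval u a b) :
    AbsolutelyContinuousOnInterval (fun x => F (u x)) a b := by
  unfold AbsolutelyContinuousOnInterval at *
  refine squeeze_zero (fun t => Finset.sum_nonneg fun i _ => dist_nonneg) (fun t => ?_)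
    (by simpa using hu.const_mul (K : ℝ))
  rw [Finset.mul_sum]
  exact Finset.sum_le_sum fun i _ => hF.dist_le_mul _ _

/-- `u` is absolutely continuous on `[a,b]` with almost everywhere derivative `h`. -/
def ACDeriv (u h : ℝ → ℂ) (a b : ℝ) : Prop :=
  AbsolutelyContinuousOnInterval u a b ∧ ∀ᵐ x, x ∈ Ioo a b → HasDerivAt u (h x) x

theorem ae_mem_uIcc_imp {a b : ℝ} (hab : a ≤ b) {p : ℝ → Prop}
    (h : ∀ᵐ x, x ∈ Ioo a b → p x) : ∀ᵐ x, x ∈ uIcc a b → p x := by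
  have ha : ∀ᵐ x : ℝ, x ≠ a := by simp [ae_iff, measure_singleton]
  have hb : ∀ᵐ x : ℝ, x ≠ b := by simp [ae_iff, measure_singleton]
  filter_upwards [h, ha, hb] with x hx h1 h2 h3
  rw [uIcc_of_le hab] at h3
  exact hx ⟨lt_of_le_of_ne h3.1 (Ne.symm h1), lt_of_le_of_ne h3.2 h2⟩

theorem ACDeriv.continuousOn {u h : ℝ → ℂ} {a b : ℝ} (hab : a ≤ b) (H : ACDeriv u h a b) :
    ContinuousOn u (Icc a b) := by
  have := H.1.continuousOn
  rwa [uIcc_of_le hab] at this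

theorem ACDeriv.congr_ae {u h g : ℝ → ℂ} {a b : ℝ} (H : ACDeriv u h a b)
    (hg : ∀ᵐ x, x ∈ Ioo a b → h x = g x) : ACDeriv u g a b := by
  refine ⟨H.1, ?_⟩
  filter_upwards [H.2, hg] with x h1 h2 hx
  rw [← h2 hx]
  exact h1 hx

theorem ACDeriv.congr {u v h : ℝ → ℂ} {a b : ℝ} (hab : a ≤ b) (H : ACDeriv u h a b)
    (huv : EqOn u v (Icc a b)) : ACDeriv v h a b := by
  refine ⟨absolutelyContinuous_congr hab H.1 huv, ?_⟩
  filter_upwards [H.2] with x h1 hx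
  refine (h1 hx).congr_of_eventuallyEq ?_
  filter_upwards [Ioo_mem_nhds hx.1 hx.2] with y hy
  exact (huv (Ioo_subset_Icc_self hy)).symm

theorem ACDeriv.mono {u h : ℝ → ℂ} {a b c d : ℝ} (H : ACDeriv u h a b) (hac : a ≤ c) (hcd : c ≤ d)
    (hdb : d ≤ b) : ACDeriv u h c d := by
  refine ⟨H.1.mono ?_, ?_⟩
  · rw [uIcc_of_le hcd, uIcc_of_le (hac.trans (hcd.trans hdb))]
    exact Icc_subset_Icc hac hdb
  · filter_upwards [H.2] with x hx hx'
    exact hx (Ioo_subset_Ioo hac hdb hx')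

theorem ACDeriv.add {u v h g : ℝ → ℂ} {a b : ℝ} (H : ACDeriv u h a b) (K : ACDeriv v g a b) :
    ACDeriv (fun x => u x + v x) (fun x => h x + g x) a b := by
  refine ⟨H.1.add K.1, ?_⟩
  filter_upwards [H.2, K.2] with x h1 h2 hx
  exact (h1 hx).add (h2 hx)

theorem ACDeriv.sub {u v h g : ℝ → ℂ} {a b : ℝ} (H : ACDeriv u h a b) (K : ACDeriv v g a b) :
    ACDeriv (fun x => u x - v x) (fun x => h x - g x) a b := by
  refine ⟨H.1.sub K.1, ?_⟩
  filter_upwards [H.2, K.2] with x h1 h2 hx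
  exact (h1 hx).sub (h2 hx)

theorem ACDeriv.mul {u v h g : ℝ → ℂ} {a b : ℝ} (H : ACDeriv u h a b) (K : ACDeriv v g a b) :
    ACDeriv (fun x => u x * v x) (fun x => h x * v x + u x * g x) a b := by
  refine ⟨H.1.smul K.1, ?_⟩
  filter_upwards [H.2, K.2] with x h1 h2 hx
  exact (h1 hx).mul (h2 hx)

theorem ACDeriv.const_mul {u h : ℝ → ℂ} {a b : ℝ} (r : ℂ) (H : ACDeriv u h a b) :
    ACDeriv (fun x => r * u x) (fun x => r * h x) a b := by
  refine ⟨H.1.const_smul r, ?_⟩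
  filter_upwards [H.2] with x h1 hx
  exact (h1 hx).const_mul r

theorem ACDeriv.clm {u h : ℝ → ℂ} {a b : ℝ} (F : ℂ →L[ℝ] ℂ) (H : ACDeriv u h a b) :
    ACDeriv (fun x => F (u x)) (fun x => F (h x)) a b := by
  refine ⟨absolutelyContinuous_comp_lipschitz F.lipschitz H.1, ?_⟩
  filter_upwards [H.2] with x h1 hx
  exact F.hasFDerivAt.comp_hasDerivAt x (h1 hx)

theorem intervalIntegrable_re {h : ℝ → ℂ} {a b : ℝ} (hh : IntervalIntegrable h volume a b) :
    IntervalIntegrable (fun x => (h x).re) volume a b :=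
  ⟨hh.1.re, hh.2.re⟩

theorem intervalIntegrable_im {h : ℝ → ℂ} {a b : ℝ} (hh : IntervalIntegrable h volume a b) :
    IntervalIntegrable (fun x => (h x).im) volume a b :=
  ⟨hh.1.im, hh.2.im⟩

theorem intervalIntegral_eq_re_im {h : ℝ → ℂ} {a b : ℝ} (hh : IntervalIntegrable h volume a b) :
    ∫ x in a..b, h x =
      ((∫ x in a..b, (h x).re : ℝ) : ℂ) + Complex.I * ((∫ x in a..b, (h x).im : ℝ) : ℂ) := by
  rw [← intervalIntegral.integral_ofReal, ← intervalIntegral.integral_ofReal,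
    ← intervalIntegral.integral_const_mul, ← intervalIntegral.integral_add]
  · congr 1
    ext x
    rw [mul_comm]
    exact (Complex.re_add_im _).symm
  · have := intervalIntegrable_re hh
    exact ⟨this.1.ofReal, this.2.ofReal⟩
  · have := intervalIntegrable_im hh
    exact (show IntervalIntegrable (fun x => (((h x).im : ℝ) : ℂ)) volume a b from
      ⟨this.1.ofReal, this.2.ofReal⟩).const_mul _

/-- The real-valued result is applied to the real and imaginary parts, which are then reassembled;
composing with a Lipschitz map preserves absolute continuity. -/
theorem absolutelyContinuous_intervalIntegral {h : ℝ → ℂ} {a b : ℝ} (hab : a ≤ b)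
    (hh : IntervalIntegrable h volume a b) :
    AbsolutelyContinuousOnInterval (fun x => ∫ t in a..x, h t) a b := by
  have h1 := (intervalIntegrable_re hh).absolutelyContinuousOnInterval_intervalIntegral
    (c := a) (by simp)
  have h2 := (intervalIntegrable_im hh).absolutelyContinuousOnInterval_intervalIntegral
    (c := a) (by simp)
  have h3 := absolutelyContinuous_comp_lipschitz Complex.ofRealCLM.lipschitz h1
  have h4 := absolutelyContinuous_comp_lipschitz Complex.ofRealCLM.lipschitz h2
  refine absolutelyContinuous_congr hab (h3.add (h4.const_smul Complex.I)) fun x hx => ?_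
  rw [intervalIntegral_eq_re_im (hh.mono_set ?_)]
  · rfl
  · rw [uIcc_of_le hx.1, uIcc_of_le hab]
    exact Icc_subset_Icc_right hx.2

theorem ACDeriv.integral {h : ℝ → ℂ} {a b : ℝ} (hab : a ≤ b)
    (hh : IntervalIntegrable h volume a b) : ACDeriv (fun x => ∫ t in a..x, h t) h a b := by
  refine ⟨absolutelyContinuous_intervalIntegral hab hh, ?_⟩
  filter_upwards [hh.ae_hasDerivAt_integral] with x hx h1
  have h2 : x ∈ uIcc a b := by rw [uIcc_of_le hab]; exact Ioo_subset_Icc_self h1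
  exact hx h2 a (by simp)

theorem ACDeriv.const (r : ℂ) (a b : ℝ) : ACDeriv (fun _ => r) (fun _ => 0) a b :=
  ⟨(LipschitzWith.const r).lipschitzOnWith.absolutelyContinuousOnInterval,
    Eventually.of_forall fun x _ => hasDerivAt_const x r⟩

theorem intervalIntegrable_of_ae_eq {E : Type*} [NormedAddCommGroup E] {f g : ℝ → E} {a b : ℝ}
    (hab : a ≤ b) (hf : IntervalIntegrable f volume a b)
    (hfg : ∀ᵐ x, x ∈ Ioo a b → f x = g x) : IntervalIntegrable g volume a b := by
  refine hf.congr_ae ?_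
  refine (ae_restrict_iff' measurableSet_uIoc).2 ?_
  filter_upwards [ae_mem_uIcc_imp hab hfg] with x hx h
  exact hx (uIoc_subset_uIcc h)

theorem ACDeriv.intervalIntegrable {u h : ℝ → ℂ} {a b : ℝ} (hab : a ≤ b) (H : ACDeriv u h a b) :
    IntervalIntegrable h volume a b := by
  have h1 := (absolutelyContinuous_comp_lipschitz Complex.reCLM.lipschitz H.1).intervalIntegrable_deriv
  have h2 := (absolutelyContinuous_comp_lipschitz Complex.imCLM.lipschitz H.1).intervalIntegrable_deriv
  have h3 : IntervalIntegrable (fun x => ((deriv (fun y => Complex.reCLM (u y)) x : ℝ) : ℂ))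
    volume a b := ⟨h1.1.ofReal, h1.2.ofReal⟩
  have h4 : IntervalIntegrable (fun x => ((deriv (fun y => Complex.imCLM (u y)) x : ℝ) : ℂ))
    volume a b := ⟨h2.1.ofReal, h2.2.ofReal⟩
  refine intervalIntegrable_of_ae_eq hab (h3.add (h4.const_mul Complex.I)) ?_
  filter_upwards [H.2] with x hx h5
  have e1 := (Complex.reCLM.hasFDerivAt.comp_hasDerivAt x (hx h5)).deriv
  have e2 := (Complex.imCLM.hasFDerivAt.comp_hasDerivAt x (hx h5)).deriv
  simp only [Function.comp_def] at e1 e2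
  rw [e1, e2, mul_comm]
  exact Complex.re_add_im _

/-- The difference is absolutely continuous with derivative zero almost everywhere, hence constant.
Without absolute continuity this would fail. -/
theorem ACDeriv.eqOn {u v h : ℝ → ℂ} {a b : ℝ} (hab : a ≤ b) (H : ACDeriv u h a b)
    (K : ACDeriv v h a b) {c : ℝ} (hc : c ∈ Icc a b) (huv : u c = v c) : EqOn u v (Icc a b) := by
  have h1 := H.sub K
  obtain ⟨C, hC⟩ := h1.1.const_of_ae_hasDerivAt_zero (ae_mem_uIcc_imp hab (by simpa using h1.2))
  rw [uIcc_of_le hab] at hC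
  intro x hx
  have h2 := hC x hx
  have h3 := hC c hc
  rw [huv, sub_self] at h3
  rw [← h3] at h2
  exact sub_eq_zero.1 h2

theorem ACDeriv.eq_const {u : ℝ → ℂ} {a b : ℝ} (hab : a ≤ b) (H : ACDeriv u (fun _ => 0) a b)
    {x y : ℝ} (hx : x ∈ Icc a b) (hy : y ∈ Icc a b) : u x = u y :=
  H.eqOn hab (ACDeriv.const (u y) a b) hy rfl hx

theorem ACDeriv.eq_integral {u h : ℝ → ℂ} {a b : ℝ} (hab : a ≤ b) (H : ACDeriv u h a b) {x : ℝ}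
    (hx : x ∈ Icc a b) : u x = u a + ∫ t in a..x, h t := by
  have h1 := ((ACDeriv.const (u a) a b).add
    (ACDeriv.integral hab (H.intervalIntegrable hab))).congr_ae (g := h) (by simp)
  exact H.eqOn hab h1 (left_mem_Icc.2 hab) (by simp) hx

/-- By the integral representation, a continuous almost-everywhere derivative is a derivative at
every point, one-sidedly at the endpoints. This is how a first-order system for (u, u') yields
`AC2Data`. -/
theorem ACDeriv.hasDerivWithinAt {u h : ℝ → ℂ} {a b : ℝ} (hab : a ≤ b) (H : ACDeriv u h a b)
    (hh : ContinuousOn h (Icc a b)) {x : ℝ} (hx : x ∈ Icc a b) :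
    HasDerivWithinAt u (h x) (Icc a b) x := by
  have hi := H.intervalIntegrable hab
  have key : HasDerivWithinAt (fun x => u a + ∫ t in a..x, h t) (h x) (Icc a b) x := by
    refine HasDerivWithinAt.const_add _ ?_
    have : Fact (x ∈ Icc a b) := ⟨hx⟩
    refine intervalIntegral.integral_hasDerivWithinAt_right (s := Icc a b) (t := Icc a b) ?_ ?_
      (hh x hx)
    · refine hi.mono_set ?_
      rw [uIcc_of_le hx.1, uIcc_of_le hab]
      exact Icc_subset_Icc_right hx.2
    · exact ⟨Icc a b, self_mem_nhdsWithin, hh.aestronglyMeasurable measurableSet_Icc⟩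
  exact key.congr (fun y hy => H.eq_integral hab hy) (H.eq_integral hab hx)

theorem ACDeriv.of_hasDerivWithinAt {u h : ℝ → ℂ} {a b : ℝ} (hab : a ≤ b)
    (hu : ∀ x ∈ Icc a b, HasDerivWithinAt u (h x) (Icc a b) x) (hh : ContinuousOn h (Icc a b)) :
    ACDeriv u h a b := by
  obtain ⟨C, hC⟩ := isCompact_Icc.exists_bound_of_continuousOn hh
  refine ⟨?_, Eventually.of_forall fun x hx =>
    (hu x (Ioo_subset_Icc_self hx)).hasDerivAt (Icc_mem_nhds hx.1 hx.2)⟩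
  refine LipschitzOnWith.absolutelyContinuousOnInterval (K := C.toNNReal) ?_
  rw [uIcc_of_le hab]
  refine (convex_Icc a b).lipschitzOnWith_of_nnnorm_hasDerivWithin_le hu fun x hx => ?_
  rw [← NNReal.coe_le_coe, coe_nnnorm]
  exact (hC x hx).trans (Real.le_coe_toNNReal C)

/-! ### Functions of class `AC²` with prescribed derivatives -/

/-- `u` is of class `AC²` on `[a,b]` with first derivative `u₁` and second derivative `u₂`. -/
def AC2Data (u u₁ u₂ : ℝ → ℂ) (a b : ℝ) : Prop :=
  (∀ x ∈ Icc a b, HasDerivWithinAt u (u₁ x) (Icc a b) x) ∧ ACDeriv u₁ u₂ a b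

theorem AC2Data.acDeriv {u u₁ u₂ : ℝ → ℂ} {a b : ℝ} (hab : a ≤ b) (H : AC2Data u u₁ u₂ a b) :
    ACDeriv u u₁ a b :=
  ACDeriv.of_hasDerivWithinAt hab H.1 (H.2.continuousOn hab)

theorem AC2Data.of_acDeriv {u u₁ u₂ : ℝ → ℂ} {a b : ℝ} (hab : a ≤ b) (H : ACDeriv u u₁ a b)
    (K : ACDeriv u₁ u₂ a b) : AC2Data u u₁ u₂ a b :=
  ⟨fun _ hx => H.hasDerivWithinAt hab (K.continuousOn hab) hx, K⟩

theorem AC2Data.isAC2 {u u₁ u₂ : ℝ → ℂ} {a b : ℝ} (hab : a < b) (H : AC2Data u u₁ u₂ a b) :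
    IsAC2 u a b := by
  refine ⟨fun x hx => (H.1 x hx).differentiableWithinAt,
    absolutelyContinuous_congr hab.le H.2.1 fun x hx => ?_⟩
  exact ((H.1 x hx).derivWithin (uniqueDiffOn_Icc hab x hx)).symm

theorem AC2Data.deriv_eq {u u₁ u₂ : ℝ → ℂ} {a b : ℝ} (H : AC2Data u u₁ u₂ a b) {x : ℝ}
    (hx : x ∈ Ioo a b) : deriv u x = u₁ x :=
  ((H.1 x (Ioo_subset_Icc_self hx)).hasDerivAt (Icc_mem_nhds hx.1 hx.2)).deriv

theorem AC2Data.deriv_deriv {u u₁ u₂ : ℝ → ℂ} {a b : ℝ} (H : AC2Data u u₁ u₂ a b) :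
    ∀ᵐ x, x ∈ Ioo a b → deriv (deriv u) x = u₂ x := by
  filter_upwards [H.2.2] with x hx h
  have : deriv u =ᶠ[𝓝 x] u₁ := by
    filter_upwards [Ioo_mem_nhds h.1 h.2] with y hy
    exact H.deriv_eq hy
  rw [this.deriv_eq]
  exact (hx h).deriv

theorem AC2Data.rightDeriv {u u₁ u₂ : ℝ → ℂ} {a b : ℝ} (hab : a < b) (H : AC2Data u u₁ u₂ a b) :
    rightDeriv u a = u₁ a :=
  ((H.1 a (left_mem_Icc.2 hab.le)).mono_of_mem_nhdsWithin (Icc_mem_nhdsGE hab)).derivWithin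
    (uniqueDiffWithinAt_Ici a)

theorem AC2Data.leftDeriv {u u₁ u₂ : ℝ → ℂ} {a b : ℝ} (hab : a < b) (H : AC2Data u u₁ u₂ a b) :
    leftDeriv u b = u₁ b :=
  ((H.1 b (right_mem_Icc.2 hab.le)).mono_of_mem_nhdsWithin (Icc_mem_nhdsLE hab)).derivWithin
    (uniqueDiffWithinAt_Iic b)

/-- Bridge from the definition of the domain, phrased with `derivWithin` and `deriv`, to the
calculus with named derivatives in which the computations are done. -/
theorem IsAC2.ac2Data {u : ℝ → ℂ} {a b : ℝ} (H : IsAC2 u a b) :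
    AC2Data u (derivWithin u (Icc a b)) (deriv (deriv u)) a b := by
  refine ⟨fun x hx => (H.1 x hx).hasDerivWithinAt, H.2, ?_⟩
  filter_upwards [H.ae_differentiableAt_deriv] with x hx h
  refine (hx h).1.hasDerivAt.congr_of_eventuallyEq ?_
  filter_upwards [Ioo_mem_nhds h.1 h.2] with y hy
  exact derivWithin_of_mem_nhds (Icc_mem_nhds hy.1 hy.2)

theorem AC2Data.congr_ae {u u₁ u₂ v₂ : ℝ → ℂ} {a b : ℝ} (H : AC2Data u u₁ u₂ a b)
    (h : ∀ᵐ x, x ∈ Ioo a b → u₂ x = v₂ x) : AC2Data u u₁ v₂ a b :=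
  ⟨H.1, H.2.congr_ae h⟩

theorem AC2Data.congr {u v u₁ u₂ : ℝ → ℂ} {a b : ℝ} (H : AC2Data u u₁ u₂ a b)
    (h : EqOn v u (Icc a b)) : AC2Data v u₁ u₂ a b :=
  ⟨fun x hx => (H.1 x hx).congr h (h hx), H.2⟩

theorem AC2Data.mono {u u₁ u₂ : ℝ → ℂ} {a b c d : ℝ} (H : AC2Data u u₁ u₂ a b) (hac : a ≤ c)
    (hcd : c ≤ d) (hdb : d ≤ b) : AC2Data u u₁ u₂ c d :=
  ⟨fun x hx => (H.1 x (Icc_subset_Icc hac hdb hx)).mono (Icc_subset_Icc hac hdb),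
    H.2.mono hac hcd hdb⟩

theorem AC2Data.add {u u₁ u₂ v v₁ v₂ : ℝ → ℂ} {a b : ℝ} (H : AC2Data u u₁ u₂ a b)
    (K : AC2Data v v₁ v₂ a b) :
    AC2Data (fun x => u x + v x) (fun x => u₁ x + v₁ x) (fun x => u₂ x + v₂ x) a b :=
  ⟨fun x hx => (H.1 x hx).add (K.1 x hx), H.2.add K.2⟩

theorem AC2Data.const_mul {u u₁ u₂ : ℝ → ℂ} {a b : ℝ} (r : ℂ) (H : AC2Data u u₁ u₂ a b) :
    AC2Data (fun x => r * u x) (fun x => r * u₁ x) (fun x => r * u₂ x) a b :=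
  ⟨fun x hx => (H.1 x hx).const_mul r, H.2.const_mul r⟩

theorem AC2Data.clm {u u₁ u₂ : ℝ → ℂ} {a b : ℝ} (F : ℂ →L[ℝ] ℂ) (H : AC2Data u u₁ u₂ a b) :
    AC2Data (fun x => F (u x)) (fun x => F (u₁ x)) (fun x => F (u₂ x)) a b :=
  ⟨fun x hx => F.hasFDerivAt.comp_hasDerivWithinAt x (H.1 x hx), H.2.clm F⟩

theorem AC2Data.zero (a b : ℝ) : AC2Data (fun _ => 0) (fun _ => 0) (fun _ => 0) a b :=
  ⟨fun x _ => hasDerivWithinAt_const x _ _, ACDeriv.const 0 a b⟩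

theorem AC2Data.sum {ι : Type*} (s : Finset ι) {u u₁ u₂ : ι → ℝ → ℂ} {a b : ℝ}
    (H : ∀ i, AC2Data (u i) (u₁ i) (u₂ i) a b) :
    AC2Data (fun x => ∑ i ∈ s, u i x) (fun x => ∑ i ∈ s, u₁ i x) (fun x => ∑ i ∈ s, u₂ i x) a b := by
  classical
  induction s using Finset.induction_on with
  | empty => simpa using AC2Data.zero a b
  | insert i s hi ih => simpa [Finset.sum_insert hi] using (H i).add ih

/-- The products of first derivatives cancel. Constancy of Wronskians, the Lagrange identity and the
flux identity are all instances. -/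
theorem AC2Data.wronskian {u u₁ u₂ v v₁ v₂ : ℝ → ℂ} {a b : ℝ} (hab : a ≤ b)
    (H : AC2Data u u₁ u₂ a b) (K : AC2Data v v₁ v₂ a b) :
    ACDeriv (fun x => u x * v₁ x - u₁ x * v x) (fun x => u x * v₂ x - u₂ x * v x) a b := by
  refine (((H.acDeriv hab).mul K.2).sub (H.2.mul (K.acDeriv hab))).congr_ae ?_
  exact Eventually.of_forall fun x _ => by ring

/-- `u'' = q u` on `[a,b]`, with `u' = u₁`. -/
abbrev IsSol (q u u₁ : ℝ → ℂ) (a b : ℝ) : Prop := AC2Data u u₁ (fun x => q x * u x) a b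

theorem IsSol.wronskian_const {q u u₁ v v₁ : ℝ → ℂ} {a b : ℝ} (hab : a ≤ b)
    (H : IsSol q u u₁ a b) (K : IsSol q v v₁ a b) {x y : ℝ} (hx : x ∈ Icc a b)
    (hy : y ∈ Icc a b) : u x * v₁ x - u₁ x * v x = u y * v₁ y - u₁ y * v y :=
  ((AC2Data.wronskian hab H K).congr_ae (g := fun _ => 0)
    (Eventually.of_forall fun x _ => by ring)).eq_const hab hx hy

theorem IsSol.linear {q u u₁ v v₁ : ℝ → ℂ} {a b : ℝ} (H : IsSol q u u₁ a b)
    (K : IsSol q v v₁ a b) (r s : ℂ) :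
    IsSol q (fun x => r * u x + s * v x) (fun x => r * u₁ x + s * v₁ x) a b :=
  ((H.const_mul r).add (K.const_mul s)).congr_ae (Eventually.of_forall fun x _ => by ring)

/-- Given two solutions with nonzero Wronskian, every solution is determined by its Cauchy data. -/
theorem IsSol.eq_zero {q u u₁ v v₁ w w₁ : ℝ → ℂ} {a b : ℝ} (hab : a ≤ b) (H : IsSol q u u₁ a b)
    (K : IsSol q v v₁ a b) (W : IsSol q w w₁ a b) {x : ℝ} (hx : x ∈ Icc a b)
    (huv : u x * v₁ x - u₁ x * v x ≠ 0) (h0 : w x = 0) (h1 : w₁ x = 0) :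
    ∀ y ∈ Icc a b, w y = 0 ∧ w₁ y = 0 := by
  intro y hy
  -- The Wronskians of `w` with `u` and `v` vanish at `x`, hence at `y`. By Cramer's rule the Cauchy
  -- data of `w` at `y` vanish, so no Gronwall estimate is needed.
  have e1 := H.wronskian_const hab W hx hy
  have e2 := K.wronskian_const hab W hx hy
  have e3 := H.wronskian_const hab K hx hy
  rw [h0, h1] at e1 e2
  rw [e3] at huv
  constructor
  · have : (u y * v₁ y - u₁ y * v y) * w y = 0 := by linear_combination u y * e2 - v y * e1
    exact (mul_eq_zero.1 this).resolve_left huv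
  · have : (u y * v₁ y - u₁ y * v y) * w₁ y = 0 := by linear_combination u₁ y * e2 - v₁ y * e1
    exact (mul_eq_zero.1 this).resolve_left huv

/-- Variation of constants. -/
theorem AC2Data.variation {q u u₁ v v₁ P Q hP hQ : ℝ → ℂ} {a b : ℝ} (hab : a ≤ b)
    (H : IsSol q u u₁ a b) (K : IsSol q v v₁ a b) (HP : ACDeriv P hP a b) (HQ : ACDeriv Q hQ a b)
    (h0 : ∀ x ∈ Ioo a b, u x * hP x + v x * hQ x = 0) :
    AC2Data (fun x => u x * P x + v x * Q x) (fun x => u₁ x * P x + v₁ x * Q x)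
      (fun x => q x * (u x * P x + v x * Q x) + (u₁ x * hP x + v₁ x * hQ x)) a b := by
  refine AC2Data.of_acDeriv hab ?_ ?_
  · refine (((H.acDeriv hab).mul HP).add ((K.acDeriv hab).mul HQ)).congr_ae ?_
    exact Eventually.of_forall fun x hx => by linear_combination h0 x hx
  · refine ((H.2.mul HP).add (K.2.mul HQ)).congr_ae ?_
    exact Eventually.of_forall fun x hx => by ring

/-! ### Volterra operators -/

theorem intervalIntegrable_mul_extend {L : ℝ} (hL : 0 ≤ L) {w : ℝ → ℂ}
    (hw : IntervalIntegrable w volume 0 L) (u : C(Icc (0 : ℝ) L, ℂ)) {x : ℝ} (hx : x ∈ Icc 0 L) :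
    IntervalIntegrable (fun t => w t * IccExtend hL u t) volume 0 x := by
  refine IntervalIntegrable.mul_continuousOn (hw.mono_set ?_)
    (u.continuous.Icc_extend' (h := hL)).continuousOn
  rw [uIcc_of_le hx.1, uIcc_of_le hL]
  exact Icc_subset_Icc_right hx.2

theorem norm_extend_le {L : ℝ} (hL : 0 ≤ L) (u : C(Icc (0 : ℝ) L, ℂ)) (t : ℝ) :
    ‖IccExtend hL u t‖ ≤ ‖u‖ :=
  u.norm_coe_le_norm _

theorem norm_integral_volterra_le {L : ℝ} (hL : 0 ≤ L) {w : ℝ → ℂ}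
    (hw : IntervalIntegrable w volume 0 L) (u : C(Icc (0 : ℝ) L, ℂ)) {x y : ℝ} (hx : 0 ≤ x)
    (hxy : x ≤ y) (hy : y ≤ L) :
    ‖∫ t in 0..x, w t * IccExtend hL u t‖ ≤ ∫ t in 0..y, ‖w t‖ * ‖IccExtend hL u t‖ := by
  refine (intervalIntegral.norm_integral_le_integral_norm hx).trans ?_
  simp only [norm_mul]
  refine intervalIntegral.integral_mono_interval le_rfl hx hxy ?_ ?_
  · exact Eventually.of_forall fun t => by positivity
  · simpa using (intervalIntegrable_mul_extend hL hw u ⟨hx.trans hxy, hy⟩).norm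

/-- The Volterra operator `u ↦ ∫₀ˣ w u` on `C[0,L]`. -/
def volterra {L : ℝ} (hL : 0 ≤ L) {w : ℝ → ℂ} (hw : IntervalIntegrable w volume 0 L) :
    C(Icc (0 : ℝ) L, ℂ) →L[ℂ] C(Icc (0 : ℝ) L, ℂ) :=
  LinearMap.mkContinuous
    { toFun := fun u => ⟨fun x => ∫ t in 0..(x : ℝ), w t * IccExtend hL u t, by
        have := (ACDeriv.integral hL (intervalIntegrable_mul_extend hL hw u
          (right_mem_Icc.2 hL))).continuousOn hL
        exact continuousOn_iff_continuous_domRestrict.1 this⟩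
      map_add' := fun u v => by
        ext x
        change ∫ t in 0..(x : ℝ), w t * IccExtend hL (u + v) t =
          (∫ t in 0..(x : ℝ), w t * IccExtend hL u t) + ∫ t in 0..(x : ℝ), w t * IccExtend hL v t
        rw [← intervalIntegral.integral_add (intervalIntegrable_mul_extend hL hw u x.2)
          (intervalIntegrable_mul_extend hL hw v x.2)]
        congr 1
        ext t
        simp only [IccExtend, Function.comp, ContinuousMap.add_apply]
        ring
      map_smul' := fun r u => by
        ext x
        change ∫ t in 0..(x : ℝ), w t * IccExtend hL (r • u) t =
          r * ∫ t in 0..(x : ℝ), w t * IccExtend hL u t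
        rw [← intervalIntegral.integral_const_mul]
        congr 1
        ext t
        simp only [IccExtend, Function.comp, ContinuousMap.smul_apply, smul_eq_mul]
        ring }
    (∫ t in 0..L, ‖w t‖) fun u => by
      rw [ContinuousMap.norm_le _ (mul_nonneg (intervalIntegral.integral_nonneg hL
        fun t _ => norm_nonneg _) (norm_nonneg _))]
      intro x
      refine (norm_integral_volterra_le hL hw u x.2.1 x.2.2 le_rfl).trans ?_
      rw [← intervalIntegral.integral_mul_const]
      refine intervalIntegral.integral_mono_on hL ?_ (hw.norm.mul_const _) fun t _ =>
        mul_le_mul_of_nonneg_left (norm_extend_le hL u t) (norm_nonneg _)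
      simpa using (intervalIntegrable_mul_extend hL hw u (right_mem_Icc.2 hL)).norm

theorem volterra_apply {L : ℝ} (hL : 0 ≤ L) {w : ℝ → ℂ} (hw : IntervalIntegrable w volume 0 L)
    (u : C(Icc (0 : ℝ) L, ℂ)) (x : Icc (0 : ℝ) L) :
    volterra hL hw u x = ∫ t in 0..(x : ℝ), w t * IccExtend hL u t := rfl

/-- The integrand is almost everywhere the derivative of the absolutely continuous function
R^(n+1)/(n+1), with R the primitive of ρ. Iterated, this produces the factorial in the Volterra
estimate for weights that are only integrable. -/
theorem integral_mul_primitive_pow {ρ : ℝ → ℝ} {x : ℝ} (hρ : IntervalIntegrable ρ volume 0 x)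
    (n : ℕ) :
    ∫ t in 0..x, ρ t * (∫ s in 0..t, ρ s) ^ n = (∫ s in 0..x, ρ s) ^ (n + 1) / (n + 1) := by
  have h1 : AbsolutelyContinuousOnInterval (fun t => ∫ s in 0..t, ρ s) 0 x :=
    hρ.absolutelyContinuousOnInterval_intervalIntegral (by simp)
  have h2 : ∀ m : ℕ, AbsolutelyContinuousOnInterval (fun t => (∫ s in 0..t, ρ s) ^ (m + 1)) 0 x := by
    intro m
    induction m with
    | zero => simpa using h1
    | succ m ih =>
      have := ih.mul h1
      rwa [show ((fun t => (∫ s in 0..t, ρ s) ^ (m + 1)) * fun t => ∫ s in 0..t, ρ s) =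
        fun t => (∫ s in 0..t, ρ s) ^ (m + 1 + 1) from funext fun t => (pow_succ _ (m + 1)).symm]
        at this
  have h3 := (h2 n).integral_deriv_eq_sub
  have h4 : ∫ t in 0..x, deriv (fun t => (∫ s in 0..t, ρ s) ^ (n + 1)) t =
      ∫ t in 0..x, (n + 1 : ℝ) * (ρ t * (∫ s in 0..t, ρ s) ^ n) := by
    refine intervalIntegral.integral_congr_ae ?_
    filter_upwards [hρ.ae_hasDerivAt_integral] with t ht h
    have := ((ht (uIoc_subset_uIcc h) 0 (by simp)).pow (n + 1)).deriv
    rw [show (fun t => (∫ s in 0..t, ρ s) ^ (n + 1)) = (fun t => ∫ s in 0..t, ρ s) ^ (n + 1) from rfl,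
      this]
    push_cast
    ring
  rw [h4, intervalIntegral.integral_const_mul] at h3
  have h5 : (n + 1 : ℝ) ≠ 0 := by positivity
  rw [eq_div_iff h5, mul_comm, h3]
  simp

/-- A fixed point equation `f = g + J (A - z B) f` whose operator has a power which is a
contraction has a solution which is an entire function of `z`. -/
theorem exists_entire_fixed_point {E : Type*} [NormedAddCommGroup E] [NormedSpace ℂ E]
    [CompleteSpace E] (J A B : E →L[ℂ] E) (g : E)
    (h : ∀ z : ℂ, ∃ n : ℕ, ∃ C : ℝ, 0 ≤ C ∧ C < 1 ∧
      ∀ u, ‖(fun v => J (A v - z • B v))^[n] u‖ ≤ C * ‖u‖) :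
    ∃ f : ℂ → E, Differentiable ℂ f ∧ ∀ z, f z = g + J (A (f z) - z • B (f z)) := by
  let T : ℂ → (E →L[ℂ] E) := fun z => J * (A - z • B)
  have hTd : Differentiable ℂ T := by
    have : Differentiable ℂ fun z : ℂ => A - z • B :=
      (differentiable_const A).sub (differentiable_id.smul_const B)
    exact this.const_mul J
  have hu : ∀ z, IsUnit (1 - T z) := fun z => by
    obtain ⟨n, C, hC0, hC, hn⟩ := h z
    have hnorm : ‖T z ^ n‖ < 1 := by
      refine lt_of_le_of_lt (ContinuousLinearMap.opNorm_le_bound _ hC0 fun u => ?_) hC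
      rw [FunLike.coe_pow_eq_iterate]
      exact hn u
    have h1 : IsUnit (1 - T z ^ n) := isUnit_one_sub_of_norm_lt_one hnorm
    -- 1 - Tⁿ factors into 1 - T and the geometric sum; as these commute and the product is a unit,
    -- 1 - T is a unit. Analyticity in z is then that of inversion in the operator algebra.
    have hcomm : Commute (1 - T z) (∑ i ∈ Finset.range n, T z ^ i) := by
      rw [commute_iff_eq, mul_neg_geom_sum, geom_sum_mul_neg]
    rw [← mul_neg_geom_sum (T z) n] at h1
    exact (hcomm.isUnit_mul_iff.1 h1).1
  refine ⟨fun z => Ring.inverse (1 - T z) g, fun z => ?_, fun z => ?_⟩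
  · obtain ⟨U, hU⟩ := hu z
    have h1 : DifferentiableAt ℂ Ring.inverse (1 - T z) := by
      have := differentiableAt_inverse (𝕜 := ℂ) (R := E →L[ℂ] E) U.isUnit
      rwa [hU] at this
    have h2 : DifferentiableAt ℂ (fun z => 1 - T z) z := (differentiableAt_const _).sub (hTd z)
    have h3 : DifferentiableAt ℂ (fun z => Ring.inverse (1 - T z)) z :=
      DifferentiableAt.comp (g := Ring.inverse) z h1 h2
    exact h3.clm_apply (differentiableAt_const g)
  · have := congrArg (fun S : E →L[ℂ] E => S g) (Ring.mul_inverse_cancel _ (hu z))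
    exact sub_eq_iff_eq_add.1 this

/-- The operator `u ↦ ∫₀ˣ ∫₀ˢ w u`. -/
def volterra₂ {L : ℝ} (hL : 0 ≤ L) {w : ℝ → ℂ} (hw : IntervalIntegrable w volume 0 L)
    (u : C(Icc (0 : ℝ) L, ℂ)) : C(Icc (0 : ℝ) L, ℂ) :=
  volterra hL (w := fun _ => 1) intervalIntegrable_const (volterra hL hw u)

/-- The outer integration costs at most a factor L. Absorbing it into the weight leaves a single
integral, a form that can be iterated. -/
theorem norm_volterra₂_apply_le {L : ℝ} (hL : 0 ≤ L) {w : ℝ → ℂ}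
    (hw : IntervalIntegrable w volume 0 L) (u : C(Icc (0 : ℝ) L, ℂ)) (x : Icc (0 : ℝ) L) :
    ‖volterra₂ hL hw u x‖ ≤ ∫ t in 0..(x : ℝ), (L * ‖w t‖) * ‖IccExtend hL u t‖ := by
  have h1 : volterra₂ hL hw u x = volterra hL (w := fun _ => 1) intervalIntegrable_const
    (volterra hL hw u) x := rfl
  rw [h1, volterra_apply]
  have h2 := intervalIntegral.norm_integral_le_of_norm_le_const (a := 0) (b := (x : ℝ))
    (f := fun t => 1 * IccExtend hL (volterra hL hw u) t)
    (C := ∫ t in 0..(x : ℝ), ‖w t‖ * ‖IccExtend hL u t‖) fun t ht => by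
      rw [uIoc_of_le x.2.1] at ht
      have ht' : t ∈ Icc 0 L := ⟨ht.1.le, ht.2.trans x.2.2⟩
      rw [one_mul, IccExtend_of_mem _ _ ht', volterra_apply]
      exact norm_integral_volterra_le hL hw u ht.1.le ht.2 x.2.2
  refine h2.trans ?_
  rw [sub_zero, abs_of_nonneg x.2.1]
  simp only [mul_assoc]
  rw [intervalIntegral.integral_const_mul, mul_comm]
  refine mul_le_mul_of_nonneg_right x.2.2 ?_
  exact intervalIntegral.integral_nonneg x.2.1 fun t _ => by positivity

/-- The bound is kept pointwise in x: the induction step integrates the previous power of the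
primitive of L‖w‖ against L‖w‖, which raises the power and supplies the next factor of the
factorial. -/
theorem norm_volterra₂_pow_apply_le {L : ℝ} (hL : 0 ≤ L) {w : ℝ → ℂ}
    (hw : IntervalIntegrable w volume 0 L) (u : C(Icc (0 : ℝ) L, ℂ)) (n : ℕ) (x : Icc (0 : ℝ) L) :
    ‖(volterra₂ hL hw)^[n] u x‖ ≤ ‖u‖ * ((∫ t in 0..(x : ℝ), L * ‖w t‖) ^ n / n.factorial) := by
  induction n generalizing x with
  | zero => simpa using u.norm_coe_le_norm x
  | succ n ih =>
    have hρ : IntervalIntegrable (fun t => L * ‖w t‖) volume 0 x := by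
      refine (hw.norm.const_mul L).mono_set ?_
      rw [uIcc_of_le x.2.1, uIcc_of_le hL]
      exact Icc_subset_Icc_right x.2.2
    have hc : ContinuousOn (fun t => ∫ s in 0..t, L * ‖w s‖) (uIcc 0 x) :=
      (hρ.absolutelyContinuousOnInterval_intervalIntegral (by simp)).continuousOn
    rw [Function.iterate_succ_apply']
    refine (norm_volterra₂_apply_le hL hw _ x).trans ?_
    have e : ‖u‖ * ((∫ t in 0..(x : ℝ), L * ‖w t‖) ^ (n + 1) / (n + 1).factorial) =
        ∫ t in 0..(x : ℝ), (‖u‖ / n.factorial) *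
          ((L * ‖w t‖) * (∫ s in 0..t, L * ‖w s‖) ^ n) := by
      rw [intervalIntegral.integral_const_mul (‖u‖ / n.factorial), integral_mul_primitive_pow hρ,
        Nat.factorial_succ]
      push_cast
      field_simp
    rw [e]
    refine intervalIntegral.integral_mono_on x.2.1 ?_ ?_ fun t ht => ?_
    · refine hρ.mul_continuousOn ?_
      exact (((volterra₂ hL hw)^[n] u).continuous.Icc_extend' (h := hL)).norm.continuousOn
    · exact (hρ.mul_continuousOn (hc.pow n)).const_mul _
    · have ht' : t ∈ Icc 0 L := ⟨ht.1, ht.2.trans x.2.2⟩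
      have := ih ⟨t, ht'⟩
      rw [IccExtend_of_mem _ _ ht']
      calc _ ≤ L * ‖w t‖ * (‖u‖ * ((∫ s in 0..t, L * ‖w s‖) ^ n / n.factorial)) :=
            mul_le_mul_of_nonneg_left this (by positivity)
        _ = _ := by ring

theorem exists_iterate_volterra₂_contracting {L : ℝ} (hL : 0 ≤ L) {w : ℝ → ℂ}
    (hw : IntervalIntegrable w volume 0 L) : ∃ n : ℕ, ∃ C : ℝ, 0 ≤ C ∧ C < 1 ∧
      ∀ u, ‖(volterra₂ hL hw)^[n] u‖ ≤ C * ‖u‖ := by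
  set r := ∫ t in 0..L, L * ‖w t‖ with hr
  have hr0 : 0 ≤ r := intervalIntegral.integral_nonneg hL fun t _ => by positivity
  obtain ⟨n, hn⟩ := ((FloorSemiring.tendsto_pow_div_factorial_atTop r).eventually
    (gt_mem_nhds one_pos)).exists
  refine ⟨n, r ^ n / n.factorial, by positivity, hn, fun u => ?_⟩
  rw [ContinuousMap.norm_le _ (by positivity)]
  intro x
  refine (norm_volterra₂_pow_apply_le hL hw u n x).trans ?_
  rw [mul_comm]
  refine mul_le_mul_of_nonneg_right ?_ (norm_nonneg _)
  gcongr
  · exact intervalIntegral.integral_nonneg x.2.1 fun t _ => by positivity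
  · refine intervalIntegral.integral_mono_interval le_rfl x.2.1 x.2.2 ?_ (hw.norm.const_mul L)
    exact Eventually.of_forall fun t => by positivity

/-- The initial value problem `u'' = (V - z) u`, `u(0) = p`, `u'(0) = q` on `[0,L]` has a solution
which is an entire function of `z`. -/
theorem exists_entire_solution {L : ℝ} (hL : 0 ≤ L) {V : ℝ → ℂ}
    (hV : IntervalIntegrable V volume 0 L) (p q : ℂ) :
    ∃ u u₁ : ℂ → ℝ → ℂ, (∀ z, IsSol (fun x => V x - z) (u z) (u₁ z) 0 L ∧ u z 0 = p ∧ u₁ z 0 = q) ∧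
      ∀ x, Differentiable ℂ fun z => u z x := by
  have hw : ∀ z : ℂ, IntervalIntegrable (fun x => V x - z) volume 0 L := fun z =>
    hV.sub intervalIntegrable_const
  let g : C(Icc (0 : ℝ) L, ℂ) := ⟨fun x => p + ((x : ℝ) : ℂ) * q, by fun_prop⟩
  -- The operator with weight V - z is affine in z, the form required by
  -- `exists_entire_fixed_point`; `g` is the solution p + qx of u'' = 0.
  have hVz : ∀ z (u : C(Icc (0 : ℝ) L, ℂ)), volterra hL (hw z) u = volterra hL hV u -
      z • volterra hL (w := fun _ => 1) intervalIntegrable_const u := fun z u => by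
    ext x
    simp only [ContinuousMap.sub_apply, ContinuousMap.smul_apply, smul_eq_mul, volterra_apply]
    rw [← intervalIntegral.integral_const_mul, ← intervalIntegral.integral_sub
      (intervalIntegrable_mul_extend hL hV u x.2)
      ((intervalIntegrable_mul_extend hL intervalIntegrable_const u x.2).const_mul z)]
    congr 1
    ext t
    ring
  obtain ⟨f, hfd, hf'⟩ := exists_entire_fixed_point
    (volterra hL (w := fun _ => 1) intervalIntegrable_const) (volterra hL hV)
    (volterra hL (w := fun _ => 1) intervalIntegrable_const) g fun z => by
      obtain ⟨n, C, h0, h1, h2⟩ := exists_iterate_volterra₂_contracting hL (hw z)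
      refine ⟨n, C, h0, h1, fun u => ?_⟩
      have h3 : volterra₂ hL (hw z) = fun v => volterra hL (w := fun _ => 1)
          intervalIntegrable_const (volterra hL hV v -
            z • volterra hL (w := fun _ => 1) intervalIntegrable_const v) :=
        funext fun v => by rw [volterra₂, hVz]
      rw [← h3]
      exact h2 u
  have hf : ∀ z, f z = g + volterra₂ hL (hw z) (f z) := fun z => by
    rw [volterra₂, hVz]
    exact hf' z
  refine ⟨fun z => IccExtend hL (f z),
    fun z x => q + ∫ t in 0..x, (V t - z) * IccExtend hL (f z) t, fun z => ?_, fun x => ?_⟩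
  · have hi := intervalIntegrable_mul_extend hL (hw z) (f z) (right_mem_Icc.2 hL)
    have h1 : ACDeriv (fun x => q + ∫ t in 0..x, (V t - z) * IccExtend hL (f z) t)
        (fun x => (V x - z) * IccExtend hL (f z) x) 0 L :=
      ((ACDeriv.const q 0 L).add (ACDeriv.integral hL hi)).congr_ae (by simp)
    -- Unfolding the fixed point equation shows that the solution is p plus the integral of the
    -- proposed derivative, so both are absolutely continuous with the right derivatives.
    have hval : ∀ x ∈ Icc 0 L, IccExtend hL (f z) x =
        p + ∫ t in 0..x, (q + ∫ s in 0..t, (V s - z) * IccExtend hL (f z) s) := by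
      intro x hx
      have h2 := congrArg (fun v : C(Icc (0 : ℝ) L, ℂ) => v ⟨x, hx⟩) (hf z)
      have h3 : volterra₂ hL (hw z) (f z) ⟨x, hx⟩ = ∫ t in 0..x, 1 * IccExtend hL (volterra hL (hw z) (f z)) t := rfl
      have h4 : ∫ t in 0..x, 1 * IccExtend hL (volterra hL (hw z) (f z)) t =
          ∫ t in 0..x, ∫ s in 0..t, (V s - z) * IccExtend hL (f z) s := by
        refine intervalIntegral.integral_congr fun t ht => ?_
        rw [uIcc_of_le hx.1] at ht
        have ht' : t ∈ Icc 0 L := ⟨ht.1, ht.2.trans hx.2⟩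
        simp only [one_mul]
        rw [IccExtend_of_mem _ _ ht', volterra_apply]
      rw [IccExtend_of_mem _ _ hx]
      simp only [ContinuousMap.add_apply] at h2
      rw [h2, h3, h4, intervalIntegral.integral_add intervalIntegrable_const, ← add_assoc]
      · simp [g]
      · have hc := (ACDeriv.integral hL hi).continuousOn hL
        refine ContinuousOn.intervalIntegrable (hc.mono ?_)
        rw [uIcc_of_le hx.1]
        exact Icc_subset_Icc_right hx.2
    have hi1 : IntervalIntegrable (fun x => q + ∫ t in 0..x, (V t - z) * IccExtend hL (f z) t)
        volume 0 L := by
      refine ContinuousOn.intervalIntegrable ?_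
      rw [uIcc_of_le hL]
      exact h1.continuousOn hL
    have h5 := (((ACDeriv.const p 0 L).add (ACDeriv.integral hL hi1)).congr_ae
      (g := fun x => q + ∫ t in 0..x, (V t - z) * IccExtend hL (f z) t) (by simp)).congr hL
      (fun x hx => (hval x hx).symm)
    refine ⟨AC2Data.of_acDeriv hL h5 h1, ?_, by simp⟩
    exact (hval 0 (left_mem_Icc.2 hL)).trans (by simp)
  · exact ((ContinuousMap.evalCLM ℂ (projIcc 0 L hL x)).differentiable.comp hfd)

/-! ### Solutions on a tooth -/

theorem intervalIntegrable_of_Ioo {E : Type*} [NormedAddCommGroup E] {f : ℝ → E} {a b : ℝ}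
    (hab : a ≤ b) (hf : IntegrableOn f (Ioo a b) volume) : IntervalIntegrable f volume a b := by
  rw [intervalIntegrable_iff_integrableOn_Ioc_of_le hab]
  exact (integrableOn_Ioc_iff_integrableOn_Ioo (by simp)).2 hf

theorem IsToothSolution.isSol {V : ℝ → ℝ} {L : ℝ} {z : ℂ} {u : ℝ → ℂ}
    (h : IsToothSolution V L z u) :
    IsSol (fun x => V x - z) u (derivWithin u (Icc 0 L)) 0 L := by
  refine h.1.ac2Data.congr_ae ?_
  filter_upwards [(ae_restrict_iff' measurableSet_Ioo).1 h.2] with x hx h1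
  linear_combination -hx h1

theorem IsSol.isToothSolution {V : ℝ → ℝ} {L : ℝ} (hL : 0 < L) {z : ℂ} {u u₁ : ℝ → ℂ}
    (h : IsSol (fun x => V x - z) u u₁ 0 L) : IsToothSolution V L z u := by
  refine ⟨h.isAC2 hL, (ae_restrict_iff' measurableSet_Ioo).2 ?_⟩
  filter_upwards [h.deriv_deriv] with x hx h1
  rw [hx h1]
  ring

/-- Fundamental system of the tooth equation, depending analytically on the energy. -/
theorem exists_fundamental_system {V : ℝ → ℝ} {L : ℝ} (hL : 0 < L)
    (hV : IntegrableOn V (Ioo 0 L) volume) :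
    ∃ θ θ₁ φ φ₁ : ℂ → ℝ → ℂ,
      (∀ z, IsSol (fun x => V x - z) (θ z) (θ₁ z) 0 L ∧ θ z 0 = 1 ∧ θ₁ z 0 = 0) ∧
      (∀ z, IsSol (fun x => V x - z) (φ z) (φ₁ z) 0 L ∧ φ z 0 = 0 ∧ φ₁ z 0 = 1) ∧
      (∀ x, Differentiable ℂ fun z => θ z x) ∧ ∀ x, Differentiable ℂ fun z => φ z x := by
  have hV' : IntervalIntegrable (fun x => (V x : ℂ)) volume 0 L :=
    intervalIntegrable_of_Ioo hL.le hV.ofReal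
  obtain ⟨θ, θ₁, h1, h2⟩ := exists_entire_solution hL.le hV' 1 0
  obtain ⟨φ, φ₁, h3, h4⟩ := exists_entire_solution hL.le hV' 0 1
  exact ⟨θ, θ₁, φ, φ₁, h1, h3, h2, h4⟩

/-- Uniqueness for the Cauchy problem of the tooth equation. -/
theorem IsSol.eq_zero_of_cauchy {V : ℝ → ℝ} {L : ℝ} (hL : 0 < L)
    (hV : IntegrableOn V (Ioo 0 L) volume) {z : ℂ} {w w₁ : ℝ → ℂ}
    (W : IsSol (fun x => V x - z) w w₁ 0 L) {x : ℝ} (hx : x ∈ Icc 0 L) (h0 : w x = 0)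
    (h1 : w₁ x = 0) : ∀ y ∈ Icc 0 L, w y = 0 := by
  obtain ⟨θ, θ₁, φ, φ₁, h2, h3, -, -⟩ := exists_fundamental_system hL hV
  obtain ⟨h4, h5, h6⟩ := h2 z
  obtain ⟨h7, h8, h9⟩ := h3 z
  have e := h4.wronskian_const hL.le h7 hx (left_mem_Icc.2 hL.le)
  rw [h5, h6, h8, h9] at e
  exact fun y hy => (h4.eq_zero hL.le h7 W hx (by rw [e]; norm_num) h0 h1 y hy).1

theorem IsSol.eqOn_of_cauchy {V : ℝ → ℝ} {L : ℝ} (hL : 0 < L)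
    (hV : IntegrableOn V (Ioo 0 L) volume) {z : ℂ} {u u₁ w w₁ : ℝ → ℂ}
    (U : IsSol (fun x => V x - z) u u₁ 0 L) (W : IsSol (fun x => V x - z) w w₁ 0 L) {x : ℝ}
    (hx : x ∈ Icc 0 L) (h0 : u x = w x) (h1 : u₁ x = w₁ x) : EqOn u w (Icc 0 L) := by
  intro y hy
  have := (U.linear W 1 (-1)).eq_zero_of_cauchy hL hV hx (by rw [h0]; ring) (by rw [h1]; ring) y hy
  linear_combination this

/-- The derivative of the outer solution on the tooth. -/
def outerDeriv (V : ℝ → ℝ) (L : ℝ) (z : ℂ) : ℝ → ℂ := derivWithin (outerSol V L z) (Icc 0 L)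

/-- The derivative of the inner solution on the tooth. -/
def innerDeriv (V : ℝ → ℝ) (L : ℝ) (z : ℂ) : ℝ → ℂ := derivWithin (innerSol V L z) (Icc 0 L)

theorem IsOuterSolution.eqOn {V : ℝ → ℝ} {L : ℝ} (hL : 0 < L)
    (hV : IntegrableOn V (Ioo 0 L) volume) {z : ℂ} {u v : ℝ → ℂ} (hu : IsOuterSolution V L z u)
    (hv : IsOuterSolution V L z v) : EqOn u v (Icc 0 L) := by
  have h1 := hu.1.isSol
  have h2 := hv.1.isSol
  refine h1.eqOn_of_cauchy hL hV h2 (right_mem_Icc.2 hL.le) (hu.2.1.trans hv.2.1.symm) ?_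
  rw [← h1.leftDeriv hL, ← h2.leftDeriv hL, hu.2.2, hv.2.2]

theorem IsInnerSolution.eqOn {V : ℝ → ℝ} {L : ℝ} (hL : 0 < L)
    (hV : IntegrableOn V (Ioo 0 L) volume) {z : ℂ} {u v : ℝ → ℂ} (hu : IsInnerSolution V L z u)
    (hv : IsInnerSolution V L z v) : EqOn u v (Icc 0 L) := by
  have h1 := hu.1.isSol
  have h2 := hv.1.isSol
  refine h1.eqOn_of_cauchy hL hV h2 (left_mem_Icc.2 hL.le) (hu.2.1.trans hv.2.1.symm) ?_
  rw [← h1.rightDeriv hL, ← h2.rightDeriv hL, hu.2.2, hv.2.2]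

/-- The outer and inner solutions exist and depend analytically on the energy. -/
theorem tooth_solutions {V : ℝ → ℝ} {L : ℝ} (hL : 0 < L) (hV : IntegrableOn V (Ioo 0 L) volume) :
    (∀ z, IsOuterSolution V L z (outerSol V L z)) ∧ (∀ z, IsInnerSolution V L z (innerSol V L z)) ∧
    (∀ x ∈ Icc 0 L, Differentiable ℂ fun z => outerSol V L z x) ∧
    (∀ x ∈ Icc 0 L, Differentiable ℂ fun z => innerSol V L z x) ∧
    Differentiable ℂ fun z => rightDeriv (outerSol V L z) 0 := by
  obtain ⟨θ, θ₁, φ, φ₁, h1, h2, h3, h4⟩ := exists_fundamental_system hL hV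
  have hl := left_mem_Icc.2 hL.le
  have hr := right_mem_Icc.2 hL.le
  -- The combination θ(L)φ - φ(L)θ vanishes at L, and its derivative there is the Wronskian of θ and
  -- φ, which equals 1.
  have hsol : ∀ z, IsSol (fun x => V x - z) (fun x => θ z L * φ z x + (-φ z L) * θ z x)
      (fun x => θ z L * φ₁ z x + (-φ z L) * θ₁ z x) 0 L := fun z =>
    (h2 z).1.linear (h1 z).1 _ _
  have ho : ∀ z, IsOuterSolution V L z fun x => θ z L * φ z x + (-φ z L) * θ z x := fun z => by
    refine ⟨(hsol z).isToothSolution hL, by ring, ?_⟩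
    have e := (h1 z).1.wronskian_const hL.le (h2 z).1 hr hl
    rw [(h1 z).2.1, (h1 z).2.2, (h2 z).2.1, (h2 z).2.2] at e
    rw [(hsol z).leftDeriv hL]
    linear_combination e
  have hi : ∀ z, IsInnerSolution V L z (φ z) := fun z =>
    ⟨(h2 z).1.isToothSolution hL, (h2 z).2.1, ((h2 z).1.rightDeriv hL).trans (h2 z).2.2⟩
  have ho' : ∀ z, IsOuterSolution V L z (outerSol V L z) := fun z =>
    Classical.epsilon_spec (p := IsOuterSolution V L z) ⟨_, ho z⟩
  have hi' : ∀ z, IsInnerSolution V L z (innerSol V L z) := fun z =>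
    Classical.epsilon_spec (p := IsInnerSolution V L z) ⟨_, hi z⟩
  refine ⟨ho', hi', fun x hx => ?_, fun x hx => ?_, ?_⟩
  · have : (fun z => outerSol V L z x) = fun z => θ z L * φ z x + (-φ z L) * θ z x :=
      funext fun z => (ho' z).eqOn hL hV (ho z) hx
    rw [this]
    exact ((h3 L).mul (h4 x)).add ((h4 L).neg.mul (h3 x))
  · have : (fun z => innerSol V L z x) = fun z => φ z x :=
      funext fun z => (hi' z).eqOn hL hV (hi z) hx
    rw [this]
    exact h4 x
  -- At 0 the derivative of θ(L)φ - φ(L)θ is θ(L), so only point values of solutions have to be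
  -- known to be entire.
  · have : (fun z => rightDeriv (outerSol V L z) 0) = fun z => θ z L := funext fun z => by
      have e1 := (ho' z).eqOn hL hV (ho z)
      have e2 := ((hsol z).congr e1).rightDeriv hL
      rw [e2, (h2 z).2.2, (h1 z).2.2]
      ring
    rw [this]
    exact h3 L

theorem outerSol_isSol {V : ℝ → ℝ} {L : ℝ} (hL : 0 < L) (hV : IntegrableOn V (Ioo 0 L) volume)
    (z : ℂ) : IsSol (fun x => V x - z) (outerSol V L z) (outerDeriv V L z) 0 L :=
  ((tooth_solutions hL hV).1 z).1.isSol

theorem innerSol_isSol {V : ℝ → ℝ} {L : ℝ} (hL : 0 < L) (hV : IntegrableOn V (Ioo 0 L) volume)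
    (z : ℂ) : IsSol (fun x => V x - z) (innerSol V L z) (innerDeriv V L z) 0 L :=
  ((tooth_solutions hL hV).2.1 z).1.isSol

theorem outerSol_end {V : ℝ → ℝ} {L : ℝ} (hL : 0 < L) (hV : IntegrableOn V (Ioo 0 L) volume)
    (z : ℂ) : outerSol V L z L = 0 ∧ outerDeriv V L z L = 1 ∧
      outerDeriv V L z 0 = rightDeriv (outerSol V L z) 0 := by
  have h := (tooth_solutions hL hV).1 z
  have h' := outerSol_isSol hL hV z
  exact ⟨h.2.1, by rw [← h'.leftDeriv hL, h.2.2], (h'.rightDeriv hL).symm⟩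

theorem innerSol_start {V : ℝ → ℝ} {L : ℝ} (hL : 0 < L) (hV : IntegrableOn V (Ioo 0 L) volume)
    (z : ℂ) : innerSol V L z 0 = 0 ∧ innerDeriv V L z 0 = 1 := by
  have h := (tooth_solutions hL hV).2.1 z
  exact ⟨h.2.1, by rw [← (innerSol_isSol hL hV z).rightDeriv hL, h.2.2]⟩

open ComplexConjugate in
/-- The Lagrange identity for the outer solution. -/
theorem outerSol_lagrange {V : ℝ → ℝ} {L : ℝ} (hL : 0 < L) (hV : IntegrableOn V (Ioo 0 L) volume)
    (z : ℂ) : ∃ I : ℝ, 0 < I ∧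
      (conj (outerSol V L z 0) * rightDeriv (outerSol V L z) 0).im = z.im * I := by
  have h := outerSol_isSol hL hV z
  obtain ⟨h0, h1, h2⟩ := outerSol_end hL hV z
  have hc := h.clm (Complex.conjCLE : ℂ →L[ℝ] ℂ)
  have hW := (AC2Data.wronskian hL.le h hc)
  have e := hW.eq_integral hL.le (right_mem_Icc.2 hL.le)
  simp only [ContinuousLinearEquiv.coe_coe, Complex.conjCLE_apply] at e
  -- In the Wronskian of u and its conjugate the real potential cancels, leaving z minus its
  -- conjugate times |u|². The boundary term at L vanishes by the Dirichlet condition.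
  have hint : ∫ t in 0..L, (outerSol V L z t * conj ((V t - z) * outerSol V L z t) -
      (V t - z) * outerSol V L z t * conj (outerSol V L z t)) =
      ∫ t in 0..L, 2 * Complex.I * z.im * ((Complex.normSq (outerSol V L z t) : ℝ) : ℂ) := by
    congr 1
    ext t
    rw [← Complex.mul_conj, map_mul, map_sub, Complex.conj_ofReal]
    have : z - conj z = 2 * Complex.I * z.im := by
      rw [Complex.sub_conj]
      push_cast
      ring
    rw [← this]
    ring
  rw [hint, intervalIntegral.integral_const_mul, intervalIntegral.integral_ofReal, h0] at e
  rw [← h2]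
  refine ⟨∫ t in 0..L, Complex.normSq (outerSol V L z t), ?_, ?_⟩
  · have hcont := (h.acDeriv hL.le).continuousOn hL.le
    refine intervalIntegral.integral_pos hL ?_ (fun x _ => Complex.normSq_nonneg _) ?_
    · exact Complex.continuous_normSq.comp_continuousOn hcont
    · by_contra hcon
      push Not at hcon
      have hz : EqOn (outerSol V L z) (fun _ => 0) (Icc 0 L) := fun x hx =>
        Complex.normSq_eq_zero.1 (le_antisymm (hcon x hx) (Complex.normSq_nonneg _))
      have h5 := h.1 L (right_mem_Icc.2 hL.le)
      have h6 : HasDerivWithinAt (outerSol V L z) 0 (Icc 0 L) L :=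
        (hasDerivWithinAt_const L _ (0 : ℂ)).congr hz (hz (right_mem_Icc.2 hL.le))
      have h7 := (uniqueDiffOn_Icc hL L (right_mem_Icc.2 hL.le)).eq_deriv _ h5 h6
      rw [h1] at h7
      exact one_ne_zero h7
  · have e2 := congrArg Complex.im e
    simp only [map_zero, mul_zero, zero_mul, sub_zero, Complex.zero_im] at e2
    simp only [Complex.add_im, Complex.sub_im, Complex.mul_im, Complex.mul_re, Complex.conj_re,
      Complex.conj_im, Complex.ofReal_re, Complex.ofReal_im, Complex.I_re, Complex.I_im,
      Complex.re_ofNat, Complex.im_ofNat] at e2 ⊢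
    linarith

-- If u_L(0) = 0 or u_L(0) = c u_L'(0) with c real, the product of conj(u_L(0)) with u_L'(0) is
-- real, contradicting the Lagrange identity. This expresses the self-adjointness of these boundary
-- conditions.
open ComplexConjugate in
theorem outerSol_ne_zero {V : ℝ → ℝ} {L : ℝ} (hL : 0 < L) (hV : IntegrableOn V (Ioo 0 L) volume)
    {z : ℂ} (hz : z.im ≠ 0) (c : ℝ) : outerSol V L z 0 ≠ 0 ∧
      (c : ℂ) * rightDeriv (outerSol V L z) 0 - outerSol V L z 0 ≠ 0 := by
  obtain ⟨I, hI, h⟩ := outerSol_lagrange hL hV z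
  have hne : z.im * I ≠ 0 := mul_ne_zero hz hI.ne'
  constructor
  · intro h0
    rw [h0] at h
    exact hne (by simpa using h.symm)
  · intro h0
    rw [← sub_eq_zero.1 h0] at h
    refine hne (h.symm.trans ?_)
    simp only [map_mul, Complex.conj_ofReal, Complex.mul_im, Complex.mul_re, Complex.conj_re,
      Complex.conj_im, Complex.ofReal_re, Complex.ofReal_im]
    ring

/-! ### Exponential solutions on the line -/

theorem AC2Data.of_hasDerivAt {u u₁ u₂ : ℝ → ℂ} (h : ∀ x, HasDerivAt u (u₁ x) x)
    (h' : ∀ x, HasDerivAt u₁ (u₂ x) x) (hc : Continuous u₂) {a b : ℝ} (hab : a ≤ b) :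
    AC2Data u u₁ u₂ a b :=
  ⟨fun x _ => (h x).hasDerivWithinAt,
    ACDeriv.of_hasDerivWithinAt hab (fun x _ => (h' x).hasDerivWithinAt) hc.continuousOn⟩

theorem hasDerivAt_cexp_mul (r : ℂ) (c x : ℝ) :
    HasDerivAt (fun t : ℝ => Complex.exp (r * ((t : ℂ) - c))) (r * Complex.exp (r * ((x : ℂ) - c))) x := by
  have h1 : HasDerivAt (fun t : ℂ => Complex.exp (r * (t - c))) (r * Complex.exp (r * ((x : ℂ) - c)))
      (x : ℂ) := by
    have := (((hasDerivAt_id' (x : ℂ)).sub_const (c : ℂ)).const_mul r).cexp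
    exact this.congr_deriv (by ring)
  exact h1.comp_ofReal

theorem isSol_cexp {q r : ℂ} (hr : r ^ 2 = q) (c : ℝ) {a b : ℝ} (hab : a ≤ b) :
    IsSol (fun _ => q) (fun t : ℝ => Complex.exp (r * ((t : ℂ) - c)))
      (fun t => r * Complex.exp (r * ((t : ℂ) - c))) a b := by
  refine (AC2Data.of_hasDerivAt (hasDerivAt_cexp_mul r c)
    (fun x => (hasDerivAt_cexp_mul r c x).const_mul r) (by fun_prop) hab).congr_ae ?_
  exact Eventually.of_forall fun x _ => by rw [← hr]; ring

/-- The general solution `A e^{ikx} + C e^{-ikx}` of the free equation. -/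
def planeWave (k A C : ℂ) (x : ℝ) : ℂ :=
  A * Complex.exp (Complex.I * k * x) + C * Complex.exp (-(Complex.I * k * x))

/-- The derivative of `planeWave`. -/
def planeWaveDeriv (k A C : ℂ) (x : ℝ) : ℂ :=
  A * (Complex.I * k * Complex.exp (Complex.I * k * x)) +
    C * (-(Complex.I * k) * Complex.exp (-(Complex.I * k * x)))

theorem I_mul_sq (k : ℂ) : (Complex.I * k) ^ 2 = -k ^ 2 := by
  rw [mul_pow, Complex.I_sq]; ring

theorem isSol_planeWave (k A C : ℂ) {a b : ℝ} (hab : a ≤ b) :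
    IsSol (fun _ => -k ^ 2) (planeWave k A C) (planeWaveDeriv k A C) a b := by
  have h1 := isSol_cexp (I_mul_sq k) 0 hab
  have h2 := isSol_cexp (r := -(Complex.I * k)) ((neg_sq _).trans (I_mul_sq k)) 0 hab
  simp only [Complex.ofReal_zero, sub_zero, neg_mul (Complex.I * k)] at h1 h2
  have h3 := h1.linear h2 A C
  have e : planeWaveDeriv k A C = fun x : ℝ => A * (Complex.I * k * Complex.exp (Complex.I * k * x)) +
      C * -(Complex.I * k * Complex.exp (-(Complex.I * k * x))) := by
    ext x
    simp only [planeWaveDeriv]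
    ring
  rw [e]
  exact h3

theorem exists_planeWave_cauchy {k : ℂ} (hk : k ≠ 0) (p q : ℂ) :
    ∃ A C, planeWave k A C 0 = p ∧ planeWaveDeriv k A C 0 = q := by
  have hI := Complex.I_ne_zero
  refine ⟨(p + q / (Complex.I * k)) / 2, (p - q / (Complex.I * k)) / 2, ?_, ?_⟩
  · simp only [planeWave, Complex.ofReal_zero, mul_zero, neg_zero, Complex.exp_zero]
    ring
  · simp only [planeWaveDeriv, Complex.ofReal_zero, mul_zero, neg_zero, Complex.exp_zero]
    field_simp
    ring

/-- The exponentials with exponents ±ik(t - x) have Wronskian -2ik at x, which is where k ≠ 0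
enters. -/
theorem isSol_free_eq_zero {k : ℂ} (hk : k ≠ 0) {w w₁ : ℝ → ℂ} {a b : ℝ} (hab : a ≤ b)
    (H : IsSol (fun _ => -k ^ 2) w w₁ a b) {x : ℝ} (hx : x ∈ Icc a b) (h0 : w x = 0)
    (h1 : w₁ x = 0) : ∀ y ∈ Icc a b, w y = 0 := by
  have hp := isSol_cexp (I_mul_sq k) x hab
  have hm := isSol_cexp (r := -(Complex.I * k)) ((neg_sq _).trans (I_mul_sq k)) x hab
  refine fun y hy => (hp.eq_zero hab hm H hx ?_ h0 h1 y hy).1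
  simp only [sub_self, mul_zero, Complex.exp_zero, mul_one, one_mul]
  intro h
  have : Complex.I * k = 0 := by linear_combination (-1 / 2 : ℂ) * h
  exact mul_ne_zero Complex.I_ne_zero hk this

/-! ### Superpositions of free resolvent kernels -/

theorem node_mono (Γ : CombGraph N) {s n : Fin N} (h : s ≤ n) : Γ.node s ≤ Γ.node n := by
  unfold node
  have : ((s : ℕ) : ℝ) ≤ (n : ℕ) := by exact_mod_cast h
  exact mul_le_mul_of_nonneg_right this Γ.ℓ_pos.le

theorem node_add_le (Γ : CombGraph N) {s n : Fin N} (h : s < n) : Γ.node s + Γ.ℓ ≤ Γ.node n := by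
  unfold node
  have : ((s : ℕ) : ℝ) + 1 ≤ (n : ℕ) := by exact_mod_cast h
  nlinarith [Γ.ℓ_pos]

theorem node_nonneg (Γ : CombGraph N) (s : Fin N) : 0 ≤ Γ.node s :=
  mul_nonneg (Nat.cast_nonneg _) Γ.ℓ_pos.le

theorem node_le_last (Γ : CombGraph N) (s : Fin N) : Γ.node s ≤ ((N : ℝ) - 1) * Γ.ℓ := by
  have : ((s : ℕ) : ℝ) + 1 ≤ N := by exact_mod_cast s.2
  exact mul_le_mul_of_nonneg_right (by linarith) Γ.ℓ_pos.le

/-- The interval `(x,y)` contains no junctions. -/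
def NodeFree (Γ : CombGraph N) (x y : ℝ) : Prop := ∀ s, Γ.node s ∉ Ioo x y

theorem nodeFree_right (Γ : CombGraph N) (s : Fin N) : Γ.NodeFree (Γ.node s) (Γ.node s + Γ.ℓ) := by
  rintro n ⟨h1, h2⟩
  have h3 : s < n := by
    by_contra hc
    exact absurd (Γ.node_mono (not_lt.1 hc)) (not_le.2 h1)
  linarith [Γ.node_add_le h3]

theorem nodeFree_left (Γ : CombGraph N) (s : Fin N) : Γ.NodeFree (Γ.node s - Γ.ℓ) (Γ.node s) := by
  rintro n ⟨h1, h2⟩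
  have h3 : n < s := by
    by_contra hc
    exact absurd (Γ.node_mono (not_lt.1 hc)) (not_le.2 h2)
  linarith [Γ.node_add_le h3]

theorem nodeFree_cell (Γ : CombGraph N) (n : ℤ) : Γ.NodeFree (n * Γ.ℓ) ((n + 1) * Γ.ℓ) :=
  Γ.node_notMem_right n

theorem nodeFree_neg (Γ : CombGraph N) (x : ℝ) : Γ.NodeFree x 0 := fun s h =>
  absurd h.2 (not_lt.2 (Γ.node_nonneg s))

/-- The junctions are multiples of ℓ, so the open cells between consecutive multiples are
junction-free and cover the line up to a null set. -/
theorem ae_of_cells (Γ : CombGraph N) {p : ℝ → Prop}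
    (h : ∀ n : ℤ, ∀ᵐ x, x ∈ Ioo (n * Γ.ℓ) ((n + 1) * Γ.ℓ) → p x) : ∀ᵐ x, p x := by
  filter_upwards [Γ.ae_mem_cell, ae_all_iff.2 h] with x ⟨n, hn⟩ hx
  exact hx n hn

theorem lineKernel_of_le {k : ℂ} {c t : ℝ} (h : c ≤ t) :
    lineKernel k t c = Complex.I / (2 * k) * Complex.exp (Complex.I * k * ((t : ℂ) - c)) := by
  rw [lineKernel, abs_of_nonneg (sub_nonneg.2 h)]
  push_cast
  rfl

theorem lineKernel_of_ge {k : ℂ} {c t : ℝ} (h : t ≤ c) :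
    lineKernel k t c = Complex.I / (2 * k) * Complex.exp (-(Complex.I * k) * ((t : ℂ) - c)) := by
  rw [lineKernel, abs_of_nonpos (sub_nonpos.2 h)]
  push_cast
  congr 2
  ring

theorem lineKernel_symm (k : ℂ) (x y : ℝ) : lineKernel k x y = lineKernel k y x := by
  rw [lineKernel, lineKernel, abs_sub_comm]

/-- The derivative of `lineKernel k · c` on an interval with left endpoint `x` whose interior does
not contain `c`. -/
def lineKernelDeriv (k : ℂ) (c x t : ℝ) : ℂ :=
  if c ≤ x then Complex.I / (2 * k) * (Complex.I * k * Complex.exp (Complex.I * k * ((t : ℂ) - c)))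
  else Complex.I / (2 * k) * (-(Complex.I * k) * Complex.exp (-(Complex.I * k) * ((t : ℂ) - c)))

theorem isSol_lineKernel (k : ℂ) {c x y : ℝ} (hxy : x ≤ y) (hc : c ∉ Ioo x y) :
    IsSol (fun _ => -k ^ 2) (fun t => lineKernel k t c) (lineKernelDeriv k c x) x y := by
  by_cases h : c ≤ x
  · have h1 := (isSol_cexp (I_mul_sq k) c hxy).const_mul (Complex.I / (2 * k))
    have h2 := h1.congr (v := fun t => lineKernel k t c) fun t ht =>
      lineKernel_of_le (h.trans ht.1)
    have e : lineKernelDeriv k c x = fun t : ℝ => Complex.I / (2 * k) *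
        (Complex.I * k * Complex.exp (Complex.I * k * ((t : ℂ) - c))) := by
      ext t
      rw [lineKernelDeriv, if_pos h]
    rw [e]
    refine h2.congr_ae (Eventually.of_forall fun t ht => ?_)
    beta_reduce
    rw [lineKernel_of_le (h.trans ht.1.le)]
    ring
  · have hy : y ≤ c := by
      by_contra h'
      exact hc ⟨not_le.1 h, not_le.1 h'⟩
    have h1 := (isSol_cexp (r := -(Complex.I * k)) ((neg_sq _).trans (I_mul_sq k)) c hxy).const_mul
      (Complex.I / (2 * k))
    have h2 := h1.congr (v := fun t => lineKernel k t c) fun t ht =>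
      lineKernel_of_ge (ht.2.trans hy)
    have e : lineKernelDeriv k c x = fun t : ℝ => Complex.I / (2 * k) *
        (-(Complex.I * k) * Complex.exp (-(Complex.I * k) * ((t : ℂ) - c))) := by
      ext t
      rw [lineKernelDeriv, if_neg h]
    rw [e]
    refine h2.congr_ae (Eventually.of_forall fun t ht => ?_)
    beta_reduce
    rw [lineKernel_of_ge (ht.2.le.trans hy)]
    ring

/-- `∑ₙ μₙ R₁(·, xₙ)`. -/
def kerSum (Γ : CombGraph N) (k : ℂ) (μ : Fin N → ℂ) (t : ℝ) : ℂ :=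
  ∑ n, μ n * lineKernel k t (Γ.node n)

/-- The derivative of `kerSum` on a junction-free interval with left endpoint `x`. -/
def kerSumDeriv (Γ : CombGraph N) (k : ℂ) (μ : Fin N → ℂ) (x t : ℝ) : ℂ :=
  ∑ n, μ n * lineKernelDeriv k (Γ.node n) x t

theorem isSol_kerSum (Γ : CombGraph N) (k : ℂ) (μ : Fin N → ℂ) {x y : ℝ} (hxy : x ≤ y)
    (hf : Γ.NodeFree x y) :
    IsSol (fun _ => -k ^ 2) (Γ.kerSum k μ) (Γ.kerSumDeriv k μ x) x y := by
  refine (AC2Data.sum Finset.univ fun n =>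
    (isSol_lineKernel k hxy (hf n)).const_mul (μ n)).congr_ae ?_
  refine Eventually.of_forall fun t _ => ?_
  rw [kerSum, Finset.mul_sum]
  exact Finset.sum_congr rfl fun n _ => by ring

/-- Only the summand centred at x_s changes its branch there; its derivative jumps by (i/2k)·2ik =
-1. -/
theorem kerSumDeriv_jump (Γ : CombGraph N) {k : ℂ} (hk : k ≠ 0) (μ : Fin N → ℂ) (s : Fin N) :
    Γ.kerSumDeriv k μ (Γ.node s) (Γ.node s) - Γ.kerSumDeriv k μ (Γ.node s - Γ.ℓ) (Γ.node s) =
      -μ s := by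
  rw [kerSumDeriv, kerSumDeriv, ← Finset.sum_sub_distrib, Finset.sum_eq_single s]
  · rw [lineKernelDeriv, lineKernelDeriv, if_pos le_rfl, if_neg (by linarith [Γ.ℓ_pos])]
    simp only [sub_self, mul_zero, Complex.exp_zero]
    field_simp
    linear_combination (2 * μ s) * Complex.I_sq
  · intro n _ hn
    rcases lt_or_gt_of_ne hn with h | h
    · rw [lineKernelDeriv, lineKernelDeriv, if_pos (Γ.node_mono h.le),
        if_pos (by linarith [Γ.node_add_le h])]
      ring
    · rw [lineKernelDeriv, lineKernelDeriv,
        if_neg (by linarith [Γ.node_add_le h, Γ.ℓ_pos]),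
        if_neg (by linarith [Γ.node_add_le h, Γ.ℓ_pos])]
      ring
  · simp

theorem kerSum_jump (Γ : CombGraph N) {k : ℂ} (hk : k ≠ 0) (μ : Fin N → ℂ) {f g : ℝ → ℂ}
    {g₁ g₂ h₁ h₂ : ℝ → ℂ} (s : Fin N) {y y' : ℝ} (hy : Γ.node s < y) (hy' : y' < Γ.node s)
    (hr : AC2Data g g₁ g₂ (Γ.node s) y) (hl : AC2Data g h₁ h₂ y' (Γ.node s))
    (hf : ∀ x, f x = g x + Γ.kerSum k μ x) :
    rightDeriv f (Γ.node s) - leftDeriv f (Γ.node s) =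
      rightDeriv g (Γ.node s) - leftDeriv g (Γ.node s) - μ s := by
  have hℓ := Γ.ℓ_pos
  obtain rfl : f = fun x => g x + Γ.kerSum k μ x := funext hf
  have a1 := isSol_kerSum Γ k μ (by linarith) (Γ.nodeFree_right s)
  have a2 := isSol_kerSum Γ k μ (by linarith) (Γ.nodeFree_left s)
  -- Both sides are shrunk to intervals on which the data of `g` are available and no further
  -- junction occurs.
  set m := min y (Γ.node s + Γ.ℓ)
  have hm : Γ.node s < m := lt_min hy (by linarith)
  set m' := max y' (Γ.node s - Γ.ℓ)
  have hm' : m' < Γ.node s := max_lt hy' (by linarith)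
  have b1 := (hr.mono le_rfl hm.le (min_le_left _ _)).add (a1.mono le_rfl hm.le (min_le_right _ _))
  have b2 := (hl.mono (le_max_left _ _) hm'.le le_rfl).add
    (a2.mono (le_max_right _ _) hm'.le le_rfl)
  rw [b1.rightDeriv hm, b2.leftDeriv hm', hr.rightDeriv hy, hl.leftDeriv hy']
  linear_combination Γ.kerSumDeriv_jump hk μ s

theorem lineKernel_node (Γ : CombGraph N) (k : ℂ) (s n : Fin N) :
    lineKernel k (Γ.node s) (Γ.node n) = Complex.I / (2 * k) * Γ.epsPow k s n := by
  rw [lineKernel, epsPow, eps, ← Complex.exp_nat_mul]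
  congr 2
  have h : |Γ.node s - Γ.node n| = (((s : ℕ) : ℤ) - ((n : ℕ) : ℤ)).natAbs * Γ.ℓ := by
    rw [node, node, ← sub_mul, abs_mul, abs_of_pos Γ.ℓ_pos, Nat.cast_natAbs]
    push_cast
    rfl
  rw [h]
  push_cast
  ring

/-! ### Generalized eigenfunctions -/

/-- The derivative of `u_{L,s}` on the tooth. -/
def uLd (Γ : CombGraph N) (k : ℂ) (s : Fin N) : ℝ → ℂ := outerDeriv (Γ.V s) (Γ.L s) (k ^ 2)

theorem isSol_uL (Γ : CombGraph N) (k : ℂ) (s : Fin N) :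
    IsSol (fun x => Γ.V s x - k ^ 2) (Γ.uL k s) (Γ.uLd k s) 0 (Γ.L s) :=
  outerSol_isSol (Γ.L_pos s) (Γ.V_int s) _

theorem uL_end (Γ : CombGraph N) (k : ℂ) (s : Fin N) :
    Γ.uL k s (Γ.L s) = 0 ∧ Γ.uLd k s (Γ.L s) = 1 ∧ Γ.uLd k s 0 = Γ.uL' k s :=
  outerSol_end (Γ.L_pos s) (Γ.V_int s) _

/-- The amplitude of `u_{L,s}` in a generalized eigenfunction with value `1` at the junction. -/
def toothAmp (Γ : CombGraph N) (k : ℂ) (s : Fin N) : ℂ :=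
  -(Γ.b s : ℂ) / ((Γ.c s : ℂ) * Γ.uL' k s - Γ.uL k s 0)

/-- The meaning of β: inserting the tooth derivative into the jump condition leaves a δ-interaction
of strength 2kβ_s for the line component alone. -/
theorem two_mul_beta (Γ : CombGraph N) {k : ℂ} (hk : k ≠ 0) (s : Fin N) :
    2 * k * Γ.beta k s = (Γ.d s : ℂ) - (Γ.b s : ℂ) * (Γ.toothAmp k s * Γ.uL' k s) := by
  change 2 * k * ((Γ.d s : ℂ) / (2 * k) + (Γ.b s : ℂ) ^ 2 / (2 * k) *
    (Γ.uL' k s / ((Γ.c s : ℂ) * Γ.uL' k s - Γ.uL k s 0))) = _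
  rw [toothAmp]
  field_simp
  ring

/-- The candidate for a generalized eigenfunction with incoming amplitudes `A`, `C` and junction
values `v`. -/
def genEig (Γ : CombGraph N) (k A C : ℂ) (v : Fin N → ℂ) (i : Option (Fin N)) (x : ℝ) : ℂ :=
  match i with
  | none => planeWave k A C x + Γ.kerSum k (fun n => -(2 * k * Γ.beta k n * v n)) x
  | some s => Γ.toothAmp k s * v s * Γ.uL k s x

/-- The matrix `i βₙ ε^{|s-n|} + δ`. -/
def combMatrix (Γ : CombGraph N) (k : ℂ) : Matrix (Fin N) (Fin N) ℂ :=
  Matrix.of fun s n : Fin N => Complex.I * Γ.beta k n * Γ.epsPow k s n + if s = n then 1 else 0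

theorem combDet_eq (Γ : CombGraph N) (k : ℂ) : Γ.combDet k = (Γ.combMatrix k).det := rfl

theorem combMatrix_mulVec (Γ : CombGraph N) (k : ℂ) (v : Fin N → ℂ) (s : Fin N) :
    (Γ.combMatrix k).mulVec v s = (∑ n, Complex.I * Γ.beta k n * Γ.epsPow k s n * v n) + v s := by
  simp [Matrix.mulVec, dotProduct, combMatrix, add_mul, Finset.sum_add_distrib]

/-- Thus the candidate really takes the values `v` at the junctions exactly when `combMatrix` maps
`v` to the junction values of the plane wave. -/
theorem genEig_node (Γ : CombGraph N) {k : ℂ} (hk : k ≠ 0) (A C : ℂ) (v : Fin N → ℂ) (s : Fin N) :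
    Γ.genEig k A C v none (Γ.node s) =
      planeWave k A C (Γ.node s) + v s - (Γ.combMatrix k).mulVec v s := by
  rw [combMatrix_mulVec, genEig, kerSum]
  simp only [lineKernel_node]
  have : ∀ n, -(2 * k * Γ.beta k n * v n) * (Complex.I / (2 * k) * Γ.epsPow k s n) =
      -(Complex.I * Γ.beta k n * Γ.epsPow k s n * v n) := fun n => by
    field_simp
  simp only [this, Finset.sum_neg_distrib]
  ring

theorem isSol_genEig_line (Γ : CombGraph N) (k A C : ℂ) (v : Fin N → ℂ) {x y : ℝ} (hxy : x ≤ y)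
    (hf : Γ.NodeFree x y) :
    ∃ f₁, IsSol (fun _ => -k ^ 2) (Γ.genEig k A C v none) f₁ x y :=
  ⟨_, ((isSol_planeWave k A C hxy).add (isSol_kerSum Γ k _ hxy hf)).congr_ae
    (Eventually.of_forall fun t _ => by simp only [genEig]; ring)⟩

theorem planeWave_smooth_jump (k A C : ℂ) (x : ℝ) :
    rightDeriv (planeWave k A C) x = leftDeriv (planeWave k A C) x := by
  rw [(isSol_planeWave k A C (a := x) (b := x + 1) (by linarith)).rightDeriv (by linarith),
    (isSol_planeWave k A C (a := x - 1) (b := x) (by linarith)).leftDeriv (by linarith)]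

/-- The consistency condition `hv` suffices: `toothAmp` was chosen to satisfy the tooth condition,
and the coefficients -2kβ_n v_n of the kernels give the jump required by `two_mul_beta`. -/
theorem genEig_isGenEigenfunction (Γ : CombGraph N) {k : ℂ} (hk : Γ.IsRegular k) (A C : ℂ)
    (v : Fin N → ℂ) (hv : ∀ s, Γ.genEig k A C v none (Γ.node s) = v s) :
    Γ.IsGenEigenfunction k (Γ.genEig k A C v) := by
  have htooth : ∀ s, IsSol (fun x => Γ.V s x - k ^ 2) (Γ.genEig k A C v (some s))
      (fun x => Γ.toothAmp k s * v s * Γ.uLd k s x) 0 (Γ.L s) := fun s =>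
    ((Γ.isSol_uL k s).const_mul (Γ.toothAmp k s * v s)).congr_ae
      (Eventually.of_forall fun t _ => by simp only [genEig]; ring)
  have htd : ∀ s, rightDeriv (Γ.genEig k A C v (some s)) 0 = Γ.toothAmp k s * v s * Γ.uL' k s :=
    fun s => by rw [(htooth s).rightDeriv (Γ.L_pos s), (Γ.uL_end k s).2.2]
  refine ⟨⟨fun x y hxy hf => ?_, fun s => (htooth s).isAC2 (Γ.L_pos s), fun s => ?_, fun s => ?_,
    fun s => ?_⟩, fun i => ?_⟩
  · obtain ⟨f₁, h⟩ := Γ.isSol_genEig_line k A C v hxy.le hf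
    exact h.isAC2 hxy
  · rw [hv s, htd]
    have h := (hk.2 s).2
    simp only [genEig, toothAmp]
    field_simp
    ring
  · have hℓ := Γ.ℓ_pos
    rw [Γ.kerSum_jump hk.1 (fun n => -(2 * k * Γ.beta k n * v n)) (f := Γ.genEig k A C v none)
      (g := planeWave k A C) s
      (y := Γ.node s + 1) (y' := Γ.node s - 1) (by linarith) (by linarith)
      (isSol_planeWave k A C (by linarith)) (isSol_planeWave k A C (by linarith)) (fun x => rfl),
      planeWave_smooth_jump, hv s, htd]
    linear_combination v s * Γ.two_mul_beta hk.1 s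
  · simp [genEig, (Γ.uL_end k s).1]
  · cases i with
    | none =>
      refine Γ.ae_of_cells fun n => ?_
      obtain ⟨f₁, h⟩ := Γ.isSol_genEig_line k A C v (x := n * Γ.ℓ) (y := (n + 1) * Γ.ℓ)
        (by nlinarith [Γ.ℓ_pos]) (Γ.nodeFree_cell n)
      filter_upwards [h.deriv_deriv] with x hx h1
      simp only [action]
      rw [hx h1]
      ring
    | some s =>
      refine (ae_restrict_iff' measurableSet_Ioo).2 ?_
      filter_upwards [(htooth s).deriv_deriv] with x hx h1
      simp only [action]
      rw [hx h1]
      ring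

theorem IsGenEigenfunction.isSol_line {Γ : CombGraph N} {k : ℂ} {ψ : Option (Fin N) → ℝ → ℂ}
    (h : Γ.IsGenEigenfunction k ψ) {x y : ℝ} (hxy : x < y) (hf : Γ.NodeFree x y) :
    IsSol (fun _ => -k ^ 2) (ψ none) (derivWithin (ψ none) (Icc x y)) x y := by
  refine (h.1.line_reg x y hxy hf).ac2Data.congr_ae ?_
  have h1 : ∀ᵐ t : ℝ, Γ.action ψ none t = k ^ 2 * ψ none t := h.2 none
  filter_upwards [h1] with t ht _
  simp only [action] at ht
  linear_combination -ht

theorem IsGenEigenfunction.isSol_tooth {Γ : CombGraph N} {k : ℂ} {ψ : Option (Fin N) → ℝ → ℂ}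
    (h : Γ.IsGenEigenfunction k ψ) (s : Fin N) :
    IsSol (fun x => Γ.V s x - k ^ 2) (ψ (some s)) (derivWithin (ψ (some s)) (Icc 0 (Γ.L s)))
      0 (Γ.L s) := by
  refine (h.1.tooth_reg s).ac2Data.congr_ae ?_
  filter_upwards [(ae_restrict_iff' measurableSet_Ioo).1 (h.2 (some s))] with t ht h1
  have := ht h1
  simp only [action] at this
  linear_combination -this

/-- By uniqueness for the Cauchy problem at the outer end the tooth component is α u_L, with α its
derivative there. The junction condition determines α because c u_L' - u_L does not vanish at 0. -/
theorem IsGenEigenfunction.tooth_eq {Γ : CombGraph N} {k : ℂ} (hk : Γ.IsRegular k)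
    {ψ : Option (Fin N) → ℝ → ℂ} (h : Γ.IsGenEigenfunction k ψ) (s : Fin N) :
    EqOn (ψ (some s)) (fun x => Γ.toothAmp k s * ψ none (Γ.node s) * Γ.uL k s x)
      (Icc 0 (Γ.L s)) ∧
    rightDeriv (ψ (some s)) 0 = Γ.toothAmp k s * ψ none (Γ.node s) * Γ.uL' k s := by
  have hL := Γ.L_pos s
  have hr := right_mem_Icc.2 hL.le
  set α := leftDeriv (ψ (some s)) (Γ.L s) with hα
  have h1 := h.isSol_tooth s
  have h2 : IsSol (fun x => Γ.V s x - k ^ 2) (fun x => α * Γ.uL k s x)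
      (fun x => α * Γ.uLd k s x) 0 (Γ.L s) :=
    ((Γ.isSol_uL k s).const_mul α).congr_ae (Eventually.of_forall fun t _ => by ring)
  have h3 : EqOn (ψ (some s)) (fun x => α * Γ.uL k s x) (Icc 0 (Γ.L s)) := by
    refine h1.eqOn_of_cauchy hL (Γ.V_int s) h2 hr ?_ ?_
    · rw [h.1.dirichlet s, (Γ.uL_end k s).1, mul_zero]
    · rw [(Γ.uL_end k s).2.1, mul_one, hα, h1.leftDeriv hL]
  have h4 : rightDeriv (ψ (some s)) 0 = α * Γ.uL' k s := by
    rw [(h2.congr h3).rightDeriv hL, (Γ.uL_end k s).2.2]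
  have h5 := h.1.tooth_bc s
  rw [h3 (left_mem_Icc.2 hL.le), h4] at h5
  have h6 : α = Γ.toothAmp k s * ψ none (Γ.node s) := by
    have h7 := (hk.2 s).2
    rw [toothAmp, div_mul_eq_mul_div, eq_div_iff h7]
    beta_reduce at h5
    linear_combination -h5
  rw [← h6]
  exact ⟨h3, h4⟩

/-- Structure of the generalized eigenfunctions. -/
theorem IsGenEigenfunction.exists_eq_genEig {Γ : CombGraph N} (hN : 1 ≤ N) {k : ℂ}
    (hk : Γ.IsRegular k) {ψ : Option (Fin N) → ℝ → ℂ} (h : Γ.IsGenEigenfunction k ψ) :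
    ∃ A C, ∀ x, ψ none x = Γ.genEig k A C (fun s => ψ none (Γ.node s)) none x := by
  have hℓ := Γ.ℓ_pos
  set v : Fin N → ℂ := fun s => ψ none (Γ.node s) with hv
  set μ : Fin N → ℂ := fun n => 2 * k * Γ.beta k n * v n with hμ
  have hjump : ∀ s, rightDeriv (ψ none) (Γ.node s) - leftDeriv (ψ none) (Γ.node s) = μ s := by
    intro s
    rw [h.1.line_bc s, (h.tooth_eq hk s).2, hμ]
    linear_combination -v s * Γ.two_mul_beta hk.1 s
  -- Adding the kernels with weights μ_s removes the derivative jumps μ_s, so `p` is a free solution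
  -- across the junctions and should be a single plane wave.
  set p : ℝ → ℂ := fun x => ψ none x + Γ.kerSum k μ x with hp
  have hpsol : ∀ x y, x < y → Γ.NodeFree x y → ∃ p₁, IsSol (fun _ => -k ^ 2) p p₁ x y :=
    fun x y hxy hf => ⟨_, ((h.isSol_line hxy hf).add (isSol_kerSum Γ k μ hxy.le hf)).congr_ae
      (Eventually.of_forall fun t _ => by simp only [hp]; ring)⟩
  -- The plane wave is matched from the left at 0, the first junction; the difference `w` is then
  -- propagated as zero, first to the negative half-line and then junction by junction to the right.
  obtain ⟨A, C, hA, hC⟩ := exists_planeWave_cauchy hk.1 (p 0) (leftDeriv p 0)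
  set w : ℝ → ℂ := fun x => p x - planeWave k A C x with hw
  have hwsol : ∀ x y, x < y → Γ.NodeFree x y → ∃ w₁, IsSol (fun _ => -k ^ 2) w w₁ x y := by
    intro x y hxy hf
    obtain ⟨p₁, hp₁⟩ := hpsol x y hxy hf
    refine ⟨_, (hp₁.add ((isSol_planeWave k A C hxy.le).const_mul (-1))).congr
      (v := w) (fun t _ => by simp only [hw]; ring) |>.congr_ae
      (Eventually.of_forall fun t _ => by simp only [hw]; ring)⟩
  have hwjump : ∀ s, rightDeriv w (Γ.node s) = leftDeriv w (Γ.node s) := by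
    intro s
    have a1 : Γ.node s < Γ.node s + Γ.ℓ := by linarith
    have a2 : Γ.node s - Γ.ℓ < Γ.node s := by linarith
    have b1 := (h.isSol_line a1 (Γ.nodeFree_right s)).add
      ((isSol_planeWave k A C a1.le).const_mul (-1))
    have b2 := (h.isSol_line a2 (Γ.nodeFree_left s)).add
      ((isSol_planeWave k A C a2.le).const_mul (-1))
    have c1 := Γ.kerSum_jump hk.1 μ (f := w) s a1 a2 b1 b2
      (fun x => by simp only [hw, hp]; ring)
    rw [b1.rightDeriv a1, b2.leftDeriv a2] at c1
    have c2 := hjump s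
    rw [(h.isSol_line a1 (Γ.nodeFree_right s)).rightDeriv a1,
      (h.isSol_line a2 (Γ.nodeFree_left s)).leftDeriv a2] at c2
    linear_combination c1 + c2
  have hneg : ∀ x ≤ 0, w x = 0 := by
    intro x hx
    -- The minimum with -1 keeps the interval nondegenerate when x = 0.
    have hx' : min x (-1) < 0 := lt_of_le_of_lt (min_le_right _ _) (by norm_num)
    obtain ⟨p₁, hp₁⟩ := hpsol _ 0 hx' (Γ.nodeFree_neg _)
    have e := (hp₁.add ((isSol_planeWave k A C hx'.le).const_mul (-1))).congr
      (v := w) (fun t _ => by simp only [hw]; ring) |>.congr_ae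
      (v₂ := fun t => -k ^ 2 * w t) (Eventually.of_forall fun t _ => by simp only [hw]; ring)
    refine isSol_free_eq_zero hk.1 hx'.le e (right_mem_Icc.2 hx'.le) ?_ ?_ x
      ⟨min_le_left _ _, hx⟩
    · simp only [hw, hA, sub_self]
    · rw [hC, hp₁.leftDeriv hx']
      ring
  -- Crossing one junction: `w` and its left derivative vanish there, and the absence of a jump
  -- transfers the latter to the right derivative.
  have hstep : ∀ s : Fin N, (∀ x ≤ Γ.node s, w x = 0) → ∀ y, Γ.node s < y →
      Γ.NodeFree (Γ.node s) y → ∀ x ≤ y, w x = 0 := by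
    intro s hs y hy hf x hx
    rcases le_or_gt x (Γ.node s) with h1 | h1
    · exact hs x h1
    · obtain ⟨w₁, hw₁⟩ := hwsol _ _ hy hf
      refine isSol_free_eq_zero hk.1 hy.le hw₁ (left_mem_Icc.2 hy.le) (hs _ le_rfl) ?_ x
        ⟨h1.le, hx⟩
      rw [← hw₁.rightDeriv hy, hwjump s]
      have : EqOn w (fun _ => 0) (Iic (Γ.node s)) := fun t ht => hs t ht
      rw [CombGraph.leftDeriv, derivWithin_congr this (hs _ le_rfl), derivWithin_fun_const]
      rfl
  have hnodes : ∀ n : ℕ, ∀ hn : n < N, ∀ x ≤ Γ.node ⟨n, hn⟩, w x = 0 := by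
    intro n
    induction n with
    | zero =>
      intro hn x hx
      exact hneg x (by simpa [node] using hx)
    | succ n ih =>
      intro hn x hx
      refine hstep ⟨n, by omega⟩ (ih (by omega)) (Γ.node ⟨n + 1, hn⟩) ?_ ?_ x hx
      · simp only [node]
        push_cast
        linarith
      · have := Γ.nodeFree_right ⟨n, by omega⟩
        have e : Γ.node ⟨n, by omega⟩ + Γ.ℓ = Γ.node ⟨n + 1, hn⟩ := by
          simp only [node]
          push_cast
          ring
        rwa [e] at this
  have hall : ∀ x, w x = 0 := by
    intro x
    have hlast := hnodes (N - 1) (by omega)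
    set m : Fin N := ⟨N - 1, by omega⟩
    refine hstep m hlast (max x (Γ.node m + 1))
      (lt_of_lt_of_le (by linarith) (le_max_right _ _)) ?_ x (le_max_left _ _)
    rintro n ⟨h1, -⟩
    have : n ≤ m := by
      rw [Fin.le_def]
      have := n.2
      simp only [m]
      omega
    exact absurd (Γ.node_mono this) (not_le.2 h1)
  refine ⟨A, C, fun x => ?_⟩
  have e1 := hall x
  simp only [hw, hp] at e1
  have e2 : Γ.kerSum k (fun n => -(2 * k * Γ.beta k n * v n)) x = -Γ.kerSum k μ x := by
    simp only [kerSum, hμ, neg_mul, Finset.sum_neg_distrib]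
  simp only [genEig]
  rw [e2]
  linear_combination e1

/-! ### Integral operators between `L²` spaces -/

/-- Cauchy–Schwarz for the splitting κφ = κ^(1/2) · (κ^(1/2) φ), the pointwise input of the Schur
test. -/
theorem lintegral_mul_sq_le {μ : Measure ℝ} {κ φ : ℝ → ℝ≥0∞} (hκ : AEMeasurable κ μ)
    (hφ : AEMeasurable φ μ) :
    (∫⁻ y, κ y * φ y ∂μ) ^ (2 : ℝ) ≤ (∫⁻ y, κ y ∂μ) * ∫⁻ y, κ y * φ y ^ (2 : ℝ) ∂μ := by
  have h := ENNReal.lintegral_mul_le_Lp_mul_Lq μ Real.HolderConjugate.two_two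
    (f := fun y => κ y ^ (1 / 2 : ℝ)) (g := fun y => κ y ^ (1 / 2 : ℝ) * φ y)
    (hκ.pow_const _) ((hκ.pow_const _).mul hφ)
  have e1 : ∀ y, ((fun y => κ y ^ (1 / 2 : ℝ)) * fun y => κ y ^ (1 / 2 : ℝ) * φ y) y = κ y * φ y := by
    intro y
    simp only [Pi.mul_apply]
    rw [← mul_assoc, ← ENNReal.rpow_add_of_nonneg _ _ (by norm_num) (by norm_num)]
    norm_num
  have e2 : ∀ y, (κ y ^ (1 / 2 : ℝ)) ^ (2 : ℝ) = κ y := by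
    intro y
    rw [← ENNReal.rpow_mul]
    norm_num
  have e3 : ∀ y, (κ y ^ (1 / 2 : ℝ) * φ y) ^ (2 : ℝ) = κ y * φ y ^ (2 : ℝ) := by
    intro y
    rw [ENNReal.mul_rpow_of_nonneg _ _ (by norm_num), e2]
  simp only [e1, e2, e3] at h
  calc _ ≤ ((∫⁻ y, κ y ∂μ) ^ (1 / 2 : ℝ) * (∫⁻ y, κ y * φ y ^ (2 : ℝ) ∂μ) ^ (1 / 2 : ℝ)) ^ (2 : ℝ) :=
        ENNReal.rpow_le_rpow h (by norm_num)
    _ = _ := by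
        rw [ENNReal.mul_rpow_of_nonneg _ _ (by norm_num), ← ENNReal.rpow_mul, ← ENNReal.rpow_mul]
        norm_num

/-- `T` is the integral operator with kernel `K`. -/
def IsKernelOp {μ ν : Measure ℝ} (K : ℝ → ℝ → ℂ) (T : Lp ℂ 2 μ →L[ℂ] Lp ℂ 2 ν) : Prop :=
  ∀ Φ : Lp ℂ 2 μ, ∀ᵐ x ∂ν, Integrable (fun y => K x y * Φ y) μ ∧ T Φ x = ∫ y, K x y * Φ y ∂μ

theorem exists_isKernelOp_of_bound {μ ν : Measure ℝ} {K : ℝ → ℝ → ℂ} (C : ℝ≥0)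
    (hint : ∀ Φ : Lp ℂ 2 μ, ∀ᵐ x ∂ν, Integrable (fun y => K x y * Φ y) μ)
    (hmeas : ∀ Φ : Lp ℂ 2 μ, AEStronglyMeasurable (fun x => ∫ y, K x y * Φ y ∂μ) ν)
    (hbd : ∀ Φ : Lp ℂ 2 μ, eLpNorm (fun x => ∫ y, K x y * Φ y ∂μ) 2 ν ≤ C * eLpNorm Φ 2 μ) :
    ∃ T : Lp ℂ 2 μ →L[ℂ] Lp ℂ 2 ν, IsKernelOp K T := by
  have hL : ∀ Φ : Lp ℂ 2 μ, MemLp (fun x => ∫ y, K x y * Φ y ∂μ) 2 ν := fun Φ =>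
    ⟨hmeas Φ, (hbd Φ).trans_lt (ENNReal.mul_lt_top ENNReal.coe_lt_top (Lp.eLpNorm_lt_top Φ))⟩
  refine ⟨LinearMap.mkContinuous
    { toFun := fun Φ => (hL Φ).toLp _
      map_add' := fun Φ Ψ => ?_
      map_smul' := fun r Φ => ?_ } (C : ℝ) fun Φ => ?_, fun Φ => ?_⟩
  · refine Lp.ext ?_
    filter_upwards [(hL (Φ + Ψ)).coeFn_toLp, (hL Φ).coeFn_toLp, (hL Ψ).coeFn_toLp,
      Lp.coeFn_add ((hL Φ).toLp _) ((hL Ψ).toLp _), hint Φ, hint Ψ] with x h1 h2 h3 h4 h5 h6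
    rw [h1, h4, Pi.add_apply, h2, h3, ← integral_add h5 h6]
    refine integral_congr_ae ?_
    filter_upwards [Lp.coeFn_add Φ Ψ] with y hy
    rw [hy, Pi.add_apply]
    ring
  · refine Lp.ext ?_
    filter_upwards [(hL (r • Φ)).coeFn_toLp, (hL Φ).coeFn_toLp,
      Lp.coeFn_smul r ((hL Φ).toLp _)] with x h1 h2 h4
    rw [h1, RingHom.id_apply, h4, Pi.smul_apply, h2, smul_eq_mul, ← integral_const_mul]
    refine integral_congr_ae ?_
    filter_upwards [Lp.coeFn_smul r Φ] with y hy
    rw [hy, Pi.smul_apply, smul_eq_mul]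
    ring
  · simp only [LinearMap.coe_mk, AddHom.coe_mk]
    rw [Lp.norm_toLp, Lp.norm_def]
    have := ENNReal.toReal_mono (ENNReal.mul_ne_top ENNReal.coe_ne_top (Lp.eLpNorm_ne_top Φ)) (hbd Φ)
    rwa [ENNReal.toReal_mul, ENNReal.coe_toReal] at this
  · filter_upwards [hint Φ, (hL Φ).coeFn_toLp] with x h1 h2
    exact ⟨h1, h2⟩

/-- The Schur test. -/
theorem exists_isKernelOp_of_schur {μ ν : Measure ℝ} [SFinite μ] [SFinite ν] {K : ℝ → ℝ → ℂ}
    (C : ℝ≥0) (hK : AEStronglyMeasurable (Function.uncurry K) (ν.prod μ))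
    (h1 : ∀ᵐ x ∂ν, ∫⁻ y, ‖K x y‖ₑ ∂μ ≤ C) (h2 : ∀ᵐ y ∂μ, ∫⁻ x, ‖K x y‖ₑ ∂ν ≤ C) :
    ∃ T : Lp ℂ 2 μ →L[ℂ] Lp ℂ 2 ν, IsKernelOp K T := by
  have hKΦ : ∀ Φ : Lp ℂ 2 μ, AEStronglyMeasurable (fun p : ℝ × ℝ => K p.1 p.2 * Φ p.2) (ν.prod μ) :=
    fun Φ => hK.mul (Lp.aestronglyMeasurable Φ).comp_snd
  have hKx : ∀ᵐ x ∂ν, AEStronglyMeasurable (fun y => K x y) μ := hK.prodMk_left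
  -- Tonelli and the column bound `h2`; the row bound `h1` enters in `hpt`.
  have hsq : ∀ Φ : Lp ℂ 2 μ, ∫⁻ x, ∫⁻ y, ‖K x y‖ₑ * ‖Φ y‖ₑ ^ (2 : ℝ) ∂μ ∂ν ≤
      C * ∫⁻ y, ‖Φ y‖ₑ ^ (2 : ℝ) ∂μ := fun Φ => by
    rw [lintegral_lintegral_swap]
    · calc _ = ∫⁻ y, (∫⁻ x, ‖K x y‖ₑ ∂ν) * ‖Φ y‖ₑ ^ (2 : ℝ) ∂μ := by
            refine lintegral_congr fun y => ?_
            rw [lintegral_mul_const' _ _ (ENNReal.rpow_ne_top_of_nonneg (by norm_num) enorm_ne_top)]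
        _ ≤ ∫⁻ y, C * ‖Φ y‖ₑ ^ (2 : ℝ) ∂μ := by
            refine lintegral_mono_ae ?_
            filter_upwards [h2] with y hy
            gcongr
        _ = _ := lintegral_const_mul' _ _ ENNReal.coe_ne_top
    · exact hK.enorm.mul ((Lp.aestronglyMeasurable Φ).comp_snd.enorm.pow_const _)
  have hΦfin : ∀ Φ : Lp ℂ 2 μ, ∫⁻ y, ‖Φ y‖ₑ ^ (2 : ℝ) ∂μ < ∞ := fun Φ => by
    have := lintegral_rpow_enorm_lt_top_of_eLpNorm_lt_top (by norm_num) (by norm_num)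
      (Lp.eLpNorm_lt_top Φ)
    simpa using this
  have hpt : ∀ Φ : Lp ℂ 2 μ, ∀ᵐ x ∂ν, (∫⁻ y, ‖K x y‖ₑ * ‖Φ y‖ₑ ∂μ) ^ (2 : ℝ) ≤
      C * ∫⁻ y, ‖K x y‖ₑ * ‖Φ y‖ₑ ^ (2 : ℝ) ∂μ := fun Φ => by
    filter_upwards [h1, hKx] with x hx hm
    refine (lintegral_mul_sq_le hm.enorm (Lp.aestronglyMeasurable Φ).enorm).trans ?_
    gcongr
  have haem : ∀ Φ : Lp ℂ 2 μ, AEMeasurable (fun x => ∫⁻ y, ‖K x y‖ₑ * ‖Φ y‖ₑ ^ (2 : ℝ) ∂μ) ν :=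
    fun Φ => (hK.enorm.mul ((Lp.aestronglyMeasurable Φ).comp_snd.enorm.pow_const _)).lintegral_prod_right'
  refine exists_isKernelOp_of_bound C (fun Φ => ?_) (fun Φ => (hKΦ Φ).integral_prod_right')
    fun Φ => ?_
  · have hfin : ∀ᵐ x ∂ν, ∫⁻ y, ‖K x y‖ₑ * ‖Φ y‖ₑ ^ (2 : ℝ) ∂μ < ∞ :=
      ae_lt_top' (haem Φ) ((hsq Φ).trans_lt
        (ENNReal.mul_lt_top ENNReal.coe_lt_top (hΦfin Φ))).ne
    filter_upwards [hfin, hpt Φ, hKx] with x h3 h4 h5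
    refine ⟨h5.mul (Lp.aestronglyMeasurable Φ), ?_⟩
    rw [hasFiniteIntegral_iff_enorm]
    simp only [enorm_mul]
    have h6 := h4.trans_lt (ENNReal.mul_lt_top ENNReal.coe_lt_top h3)
    exact (ENNReal.rpow_lt_top_iff_of_pos (by norm_num)).1 h6
  · rw [eLpNorm_eq_lintegral_rpow_enorm_toReal (by norm_num) (by norm_num),
      eLpNorm_eq_lintegral_rpow_enorm_toReal (by norm_num) (by norm_num)]
    simp only [ENNReal.toReal_ofNat]
    have h3 : ∫⁻ x, ‖∫ y, K x y * Φ y ∂μ‖ₑ ^ (2 : ℝ) ∂ν ≤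
        (C : ℝ≥0∞) ^ (2 : ℝ) * ∫⁻ y, ‖Φ y‖ₑ ^ (2 : ℝ) ∂μ := by
      calc _ ≤ ∫⁻ x, C * ∫⁻ y, ‖K x y‖ₑ * ‖Φ y‖ₑ ^ (2 : ℝ) ∂μ ∂ν := by
            refine lintegral_mono_ae ?_
            filter_upwards [hpt Φ] with x hx
            refine le_trans (ENNReal.rpow_le_rpow ?_ (by norm_num)) hx
            refine (enorm_integral_le_lintegral_enorm _).trans_eq ?_
            simp only [enorm_mul]
        _ = C * ∫⁻ x, ∫⁻ y, ‖K x y‖ₑ * ‖Φ y‖ₑ ^ (2 : ℝ) ∂μ ∂ν :=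
            lintegral_const_mul' _ _ ENNReal.coe_ne_top
        _ ≤ C * (C * ∫⁻ y, ‖Φ y‖ₑ ^ (2 : ℝ) ∂μ) := by
            gcongr
            exact hsq Φ
        _ = _ := by
            rw [← mul_assoc, ENNReal.rpow_two, pow_two]
    calc _ ≤ ((C : ℝ≥0∞) ^ (2 : ℝ) * ∫⁻ y, ‖Φ y‖ₑ ^ (2 : ℝ) ∂μ) ^ (1 / 2 : ℝ) :=
          ENNReal.rpow_le_rpow h3 (by norm_num)
      _ = _ := by
          rw [ENNReal.mul_rpow_of_nonneg _ _ (by norm_num), ← ENNReal.rpow_mul]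
          norm_num

theorem IsKernelOp.add {μ ν : Measure ℝ} {K K' : ℝ → ℝ → ℂ} {T T' : Lp ℂ 2 μ →L[ℂ] Lp ℂ 2 ν}
    (h : IsKernelOp K T) (h' : IsKernelOp K' T') :
    IsKernelOp (fun x y => K x y + K' x y) (T + T') := by
  intro Φ
  filter_upwards [h Φ, h' Φ, Lp.coeFn_add (T Φ) (T' Φ)] with x h1 h2 h3
  simp only [add_mul]
  refine ⟨h1.1.add h2.1, ?_⟩
  rw [integral_add h1.1 h2.1, ← h1.2, ← h2.2]
  exact h3

theorem IsKernelOp.const_mul {μ ν : Measure ℝ} {K : ℝ → ℝ → ℂ} {T : Lp ℂ 2 μ →L[ℂ] Lp ℂ 2 ν}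
    (r : ℂ) (h : IsKernelOp K T) : IsKernelOp (fun x y => r * K x y) (r • T) := by
  intro Φ
  filter_upwards [h Φ, Lp.coeFn_smul r (T Φ)] with x h1 h3
  simp only [mul_assoc]
  refine ⟨h1.1.const_mul r, ?_⟩
  rw [integral_const_mul, ← h1.2]
  exact h3

theorem isKernelOp_zero (μ ν : Measure ℝ) :
    IsKernelOp (fun _ _ => 0) (0 : Lp ℂ 2 μ →L[ℂ] Lp ℂ 2 ν) := by
  intro Φ
  filter_upwards [Lp.coeFn_zero ℂ 2 ν] with x hx
  simpa using hx

theorem exists_isKernelOp_sum {μ ν : Measure ℝ} {ι : Type*} (s : Finset ι) {K : ι → ℝ → ℝ → ℂ}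
    (h : ∀ i, ∃ T : Lp ℂ 2 μ →L[ℂ] Lp ℂ 2 ν, IsKernelOp (K i) T) :
    ∃ T : Lp ℂ 2 μ →L[ℂ] Lp ℂ 2 ν, IsKernelOp (fun x y => ∑ i ∈ s, K i x y) T := by
  classical
  induction s using Finset.induction_on with
  | empty => exact ⟨0, by simpa using isKernelOp_zero μ ν⟩
  | insert i s hi ih =>
    obtain ⟨T, hT⟩ := h i
    obtain ⟨T', hT'⟩ := ih
    exact ⟨T + T', by simpa [Finset.sum_insert hi] using hT.add hT'⟩

theorem integrable_mul_of_memLp {μ : Measure ℝ} {f g : ℝ → ℂ} (hf : MemLp f 2 μ)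
    (hg : MemLp g 2 μ) : Integrable (fun y => f y * g y) μ :=
  hf.integrable_mul hg

theorem exists_isKernelOp_rankOne {μ ν : Measure ℝ} {F G : ℝ → ℂ} (hF : MemLp F 2 ν)
    (hG : MemLp G 2 μ) : ∃ T : Lp ℂ 2 μ →L[ℂ] Lp ℂ 2 ν, IsKernelOp (fun x y => F x * G y) T := by
  have e : ∀ (Φ : Lp ℂ 2 μ) x, (fun y => F x * G y * Φ y) = fun y => F x * (G y * Φ y) :=
    fun Φ x => by
      ext y
      ring
  have hi : ∀ Φ : Lp ℂ 2 μ, Integrable (fun y => G y * Φ y) μ := fun Φ =>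
    integrable_mul_of_memLp hG (Lp.memLp Φ)
  let T₀ : Lp ℂ 2 μ →ₗ[ℂ] ℂ :=
    { toFun := fun Φ => ∫ y, G y * Φ y ∂μ
      map_add' := fun Φ Ψ => by
        rw [← integral_add (hi Φ) (hi Ψ)]
        refine integral_congr_ae ?_
        filter_upwards [Lp.coeFn_add Φ Ψ] with y hy
        rw [hy, Pi.add_apply]
        ring
      map_smul' := fun r Φ => by
        rw [RingHom.id_apply, smul_eq_mul, ← integral_const_mul]
        refine integral_congr_ae ?_
        filter_upwards [Lp.coeFn_smul r Φ] with y hy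
        rw [hy, Pi.smul_apply, smul_eq_mul]
        ring }
  have hT₀ : ∀ Φ, ‖T₀ Φ‖ ≤ (eLpNorm G 2 μ).toReal * ‖Φ‖ := fun Φ => by
    have h1 : ‖T₀ Φ‖ₑ ≤ eLpNorm G 2 μ * eLpNorm Φ 2 μ := by
      refine (enorm_integral_le_lintegral_enorm _).trans ?_
      have := eLpNorm_smul_le_mul_eLpNorm (p := 2) (q := 2) (r := 1)
        (Lp.aestronglyMeasurable Φ) hG.1
      rw [eLpNorm_one_eq_lintegral_enorm] at this
      exact this
    have h2 := ENNReal.toReal_mono (ENNReal.mul_ne_top hG.2.ne (Lp.eLpNorm_ne_top Φ)) h1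
    rwa [ENNReal.toReal_mul, ← Lp.norm_def, toReal_enorm] at h2
  refine ⟨(T₀.mkContinuous _ hT₀).smulRight (hF.toLp F), fun Φ => ?_⟩
  have h3 : ((T₀.mkContinuous _ hT₀).smulRight (hF.toLp F)) Φ = T₀ Φ • hF.toLp F := rfl
  rw [h3]
  filter_upwards [Lp.coeFn_smul (T₀ Φ) (hF.toLp F), hF.coeFn_toLp] with x h4 h5
  rw [e]
  refine ⟨(hi Φ).const_mul _, ?_⟩
  rw [h4, Pi.smul_apply, h5, integral_const_mul, smul_eq_mul, mul_comm]
  rfl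

/-! ### The free resolvent kernel on the line -/

theorem integrable_exp_neg_mul_abs {a : ℝ} (ha : 0 < a) :
    Integrable fun t : ℝ => Real.exp (-(a * |t|)) := by
  rw [← integrableOn_univ, ← Iic_union_Ioi (a := (0 : ℝ)), integrableOn_union]
  constructor
  · refine (integrableOn_exp_mul_Iic ha 0).congr_fun (fun t ht => ?_) measurableSet_Iic
    beta_reduce
    rw [abs_of_nonpos ht]
    ring_nf
  · refine (exp_neg_integrableOn_Ioi 0 ha).congr_fun (fun t ht => ?_) measurableSet_Ioi
    beta_reduce
    rw [abs_of_pos ht]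
    ring_nf

theorem norm_lineKernel (k : ℂ) (x y : ℝ) :
    ‖lineKernel k x y‖ = ‖Complex.I / (2 * k)‖ * Real.exp (-(k.im * |x - y|)) := by
  rw [lineKernel, norm_mul, Complex.norm_exp]
  congr 2
  simp [Complex.mul_re, Complex.mul_im]

theorem continuous_lineKernel (k : ℂ) : Continuous (Function.uncurry (lineKernel k)) := by
  unfold Function.uncurry lineKernel
  fun_prop

theorem lintegral_lineKernel (k : ℂ) (x : ℝ) :
    ∫⁻ y, ‖lineKernel k x y‖ₑ = ∫⁻ t, ‖lineKernel k t 0‖ₑ := by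
  have : ∀ y, ‖lineKernel k x y‖ₑ = ‖lineKernel k (x - y) 0‖ₑ := fun y => by
    rw [lineKernel, lineKernel, sub_zero]
  simp only [this]
  exact lintegral_sub_left_eq_self (μ := volume) (fun t => ‖lineKernel k t 0‖ₑ) x

theorem integrable_lineKernel {k : ℂ} (hk : 0 < k.im) : Integrable fun t => lineKernel k t 0 := by
  have hc : Continuous fun t => lineKernel k t 0 :=
    (continuous_lineKernel k).comp (Continuous.prodMk_left 0)
  refine ((integrable_exp_neg_mul_abs hk).const_mul ‖Complex.I / (2 * k)‖).mono'
    hc.aestronglyMeasurable (Eventually.of_forall fun t => ?_)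
  rw [norm_lineKernel, sub_zero]

theorem memLp_lineKernel {k : ℂ} (hk : 0 < k.im) (c : ℝ) :
    MemLp (fun t => lineKernel k t c) 2 volume := by
  have hc : Continuous fun t => lineKernel k t c :=
    (continuous_lineKernel k).comp (Continuous.prodMk_left c)
  refine (memLp_two_iff_integrable_sq_norm hc.aestronglyMeasurable).2 ?_
  have h := ((integrable_exp_neg_mul_abs (a := 2 * k.im) (by linarith)).comp_sub_right c).const_mul
    (‖Complex.I / (2 * k)‖ ^ 2)
  refine h.congr (Eventually.of_forall fun t => ?_)
  beta_reduce
  rw [norm_lineKernel, mul_pow, ← Real.exp_nat_mul]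
  push_cast
  ring_nf

/-- The kernel depends only on |x - y|, so all row and column integrals equal the integral of one
exponentially decaying function. -/
theorem exists_isKernelOp_lineKernel {k : ℂ} (hk : 0 < k.im) :
    ∃ T : Lp ℂ 2 (volume : Measure ℝ) →L[ℂ] Lp ℂ 2 (volume : Measure ℝ),
      IsKernelOp (lineKernel k) T := by
  have hfin : ∫⁻ t, ‖lineKernel k t 0‖ₑ < ∞ := by
    have := (integrable_lineKernel hk).2
    rwa [hasFiniteIntegral_iff_enorm] at this
  have hC : ∀ x, ∫⁻ y, ‖lineKernel k x y‖ₑ ≤ ((∫⁻ t, ‖lineKernel k t 0‖ₑ).toNNReal : ℝ≥0∞) :=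
    fun x => by rw [ENNReal.coe_toNNReal hfin.ne, lintegral_lineKernel]
  refine exists_isKernelOp_of_schur _ (continuous_lineKernel k).aestronglyMeasurable
    (Eventually.of_forall hC) (Eventually.of_forall fun y => ?_)
  have : ∀ x, ‖lineKernel k x y‖ₑ = ‖lineKernel k y x‖ₑ := fun x => by rw [lineKernel_symm]
  simp only [this]
  exact hC y

/-- The free resolvent on the line inverts `-d²/dx² - k²`. -/
theorem ac2Data_lineKernel_integral {k : ℂ} (hk : 0 < k.im) {φ : ℝ → ℂ} (hφ : MemLp φ 2 volume) :
    ∃ f₁ : ℝ → ℂ, ∀ a b, a ≤ b → AC2Data (fun x => ∫ y, lineKernel k x y * φ y) f₁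
      (fun x => -k ^ 2 * (∫ y, lineKernel k x y * φ y) + -φ x) a b := by
  have hk0 : k ≠ 0 := by
    rintro rfl
    simp at hk
  have hI := Complex.I_ne_zero
  have hint : ∀ x, Integrable fun y => lineKernel k x y * φ y := fun x => by
    have := integrable_mul_of_memLp (memLp_lineKernel hk x) hφ
    simpa only [lineKernel_symm k x] using this
  set r := Complex.I / (2 * k) with hr
  have hr0 : r ≠ 0 := div_ne_zero hI (mul_ne_zero two_ne_zero hk0)
  -- The kernel factors on either side of the diagonal, so the integral takes the form required by
  -- variation of constants, with one-sided integrals of `p` and `q`. These are integrated only over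
  -- half-lines, because the exponentials grow in the other direction.
  set p : ℝ → ℂ := fun y => Complex.exp (-(Complex.I * k) * y) * φ y with hp
  set q : ℝ → ℂ := fun y => Complex.exp (Complex.I * k * y) * φ y with hq
  have ep : ∀ x : ℝ, ∀ y ∈ Iic x, r * Complex.exp (Complex.I * k * x) * p y = lineKernel k x y * φ y := by
    intro x y hy
    rw [lineKernel_of_le hy, ← hr, hp, mul_sub, sub_eq_add_neg, Complex.exp_add]
    ring_nf
  have eq : ∀ x : ℝ, ∀ y ∈ Ioi x, r * Complex.exp (-(Complex.I * k) * x) * q y =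
      lineKernel k x y * φ y := by
    intro x y hy
    rw [lineKernel_of_ge (le_of_lt hy), ← hr, hq, mul_sub, sub_eq_add_neg, Complex.exp_add]
    ring_nf
  have ip : ∀ x, IntegrableOn p (Iic x) := by
    intro x
    have h0 : r * Complex.exp (Complex.I * k * x) ≠ 0 := mul_ne_zero hr0 (Complex.exp_ne_zero _)
    have h1 : IntegrableOn (fun y => (r * Complex.exp (Complex.I * k * x))⁻¹ *
        (lineKernel k x y * φ y)) (Iic x) := (hint x).integrableOn.const_mul _
    refine h1.congr_fun (fun y hy => ?_) measurableSet_Iic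
    beta_reduce
    rw [← ep x y hy, inv_mul_cancel_left₀ h0]
  have iq : ∀ x, IntegrableOn q (Ioi x) := by
    intro x
    have h0 : r * Complex.exp (-(Complex.I * k) * x) ≠ 0 := mul_ne_zero hr0 (Complex.exp_ne_zero _)
    have h1 : IntegrableOn (fun y => (r * Complex.exp (-(Complex.I * k) * x))⁻¹ *
        (lineKernel k x y * φ y)) (Ioi x) := (hint x).integrableOn.const_mul _
    refine h1.congr_fun (fun y hy => ?_) measurableSet_Ioi
    beta_reduce
    rw [← eq x y hy, inv_mul_cancel_left₀ h0]
  have hsplit : ∀ x, ∫ y, lineKernel k x y * φ y =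
      r * Complex.exp (Complex.I * k * x) * (∫ y in Iic x, p y) +
        r * Complex.exp (-(Complex.I * k) * x) * ∫ y in Ioi x, q y := by
    intro x
    rw [← intervalIntegral.integral_Iic_add_Ioi (hint x).integrableOn (hint x).integrableOn (b := x),
      ← integral_const_mul, ← integral_const_mul]
    congr 1
    · exact setIntegral_congr_fun measurableSet_Iic fun y hy => (ep x y hy).symm
    · exact setIntegral_congr_fun measurableSet_Ioi fun y hy => (eq x y hy).symm
  refine ⟨fun x => r * (Complex.I * k * Complex.exp (Complex.I * k * x)) * (∫ y in Iic x, p y) +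
    r * (-(Complex.I * k) * Complex.exp (-(Complex.I * k) * x)) * ∫ y in Ioi x, q y,
    fun a b hab => ?_⟩
  have hP : ACDeriv (fun x => ∫ y in Iic x, p y) p a b := by
    have h1 : IntervalIntegrable p volume a b :=
      (intervalIntegrable_iff_integrableOn_Ioc_of_le hab).2
        ((ip b).mono_set Ioc_subset_Iic_self)
    have h2 := ((ACDeriv.const (∫ y in Iic a, p y) a b).add (ACDeriv.integral hab h1)).congr_ae
      (g := p) (by simp)
    refine h2.congr hab fun x hx => ?_
    rw [← intervalIntegral.integral_Iic_sub_Iic (ip a) (ip x)]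
    ring
  have hQ : ACDeriv (fun x => ∫ y in Ioi x, q y) (fun x => -q x) a b := by
    have h1 : IntervalIntegrable q volume a b :=
      (intervalIntegrable_iff_integrableOn_Ioc_of_le hab).2
        ((iq a).mono_set Ioc_subset_Ioi_self)
    have h2 := ((ACDeriv.const (∫ y in Ioi a, q y) a b).sub (ACDeriv.integral hab h1)).congr_ae
      (g := fun x => -q x) (by simp)
    refine h2.congr hab fun x hx => ?_
    rw [← intervalIntegral.integral_Ioi_sub_Ioi (iq a) hx.1]
    ring
  have hu := (isSol_cexp (I_mul_sq k) 0 hab).const_mul r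
  have hv := (isSol_cexp (r := -(Complex.I * k)) ((neg_sq _).trans (I_mul_sq k)) 0 hab).const_mul r
  simp only [Complex.ofReal_zero, sub_zero] at hu hv
  have hu' : IsSol (fun _ => -k ^ 2) (fun x : ℝ => r * Complex.exp (Complex.I * k * x))
      (fun x => r * (Complex.I * k * Complex.exp (Complex.I * k * x))) a b :=
    hu.congr_ae (Eventually.of_forall fun x _ => by ring)
  have hv' : IsSol (fun _ => -k ^ 2) (fun x : ℝ => r * Complex.exp (-(Complex.I * k) * x))
      (fun x => r * (-(Complex.I * k) * Complex.exp (-(Complex.I * k) * x))) a b :=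
    hv.congr_ae (Eventually.of_forall fun x _ => by ring)
  have hexp : ∀ x : ℝ, Complex.exp (Complex.I * k * x) * Complex.exp (-(Complex.I * k) * x) = 1 := by
    intro x
    rw [← Complex.exp_add]
    ring_nf
    exact Complex.exp_zero
  -- The normalization of R₁: this constant makes the source term exactly -φ.
  have hrk : r * (2 * Complex.I * k) = -1 := by
    rw [hr]
    field_simp
    exact Complex.I_sq
  refine ((AC2Data.variation hab hu' hv' hP hQ fun x _ => ?_).congr
    (v := fun x => ∫ y, lineKernel k x y * φ y) fun x _ => hsplit x).congr_ae
    (Eventually.of_forall fun x _ => ?_)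
  · simp only [hp, hq]
    ring
  · rw [hsplit x]
    simp only [hp, hq]
    linear_combination r * (2 * Complex.I * k) * φ x * hexp x + φ x * hrk

/-! ### The resolvent kernel of a tooth -/

/-- The normalization of u_0 at the junction makes the Wronskian there equal to -u_L(0), so the
kernel is singular only at Dirichlet eigenvalues of the tooth. -/
theorem toothKernel_eq {V : ℝ → ℝ} {L : ℝ} (hL : 0 < L) (hV : IntegrableOn V (Ioo 0 L) volume)
    (k : ℂ) (x y : ℝ) : toothKernel V L k x y =
      (outerSol V L (k ^ 2) 0)⁻¹ *
        (innerSol V L (k ^ 2) (min x y) * outerSol V L (k ^ 2) (max x y)) := by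
  have h1 := ((tooth_solutions hL hV).2.1 (k ^ 2)).2
  rw [toothKernel, h1.1, h1.2, zero_mul, one_mul, zero_sub, neg_div_neg_eq, div_eq_inv_mul]

theorem toothKernel_symm (V : ℝ → ℝ) (L : ℝ) (k : ℂ) (x y : ℝ) :
    toothKernel V L k x y = toothKernel V L k y x := by
  rw [toothKernel, toothKernel, min_comm, max_comm]

theorem aestronglyMeasurable_of_continuousOn_Icc {f : ℝ → ℂ} {a b : ℝ}
    (hf : ContinuousOn f (Icc a b)) : AEStronglyMeasurable f (volume.restrict (Ioo a b)) :=
  (hf.mono Ioo_subset_Icc_self).aestronglyMeasurable measurableSet_Ioo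

theorem exists_bound_toothKernel {V : ℝ → ℝ} {L : ℝ} (hL : 0 < L)
    (hV : IntegrableOn V (Ioo 0 L) volume) (k : ℂ) :
    ∃ C : ℝ≥0, ∀ x ∈ Icc 0 L, ∀ y ∈ Icc 0 L, ‖toothKernel V L k x y‖ₑ ≤ C := by
  obtain ⟨C₁, h₁⟩ := isCompact_Icc.exists_bound_of_continuousOn
    (((outerSol_isSol hL hV (k ^ 2)).acDeriv hL.le).continuousOn hL.le)
  obtain ⟨C₂, h₂⟩ := isCompact_Icc.exists_bound_of_continuousOn
    (((innerSol_isSol hL hV (k ^ 2)).acDeriv hL.le).continuousOn hL.le)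
  refine ⟨(‖(outerSol V L (k ^ 2) 0)⁻¹‖ * (C₂ * C₁)).toNNReal, fun x hx y hy => ?_⟩
  rw [← ofReal_norm, ← ENNReal.ofReal]
  refine ENNReal.ofReal_le_ofReal ?_
  rw [toothKernel_eq hL hV, norm_mul, norm_mul]
  have a1 := h₂ (min x y) ⟨le_min hx.1 hy.1, (min_le_left _ _).trans hx.2⟩
  have a2 := h₁ (max x y) ⟨hx.1.trans (le_max_left _ _), max_le hx.2 hy.2⟩
  have : 0 ≤ C₂ := (norm_nonneg _).trans a1
  gcongr

theorem aestronglyMeasurable_toothKernel {V : ℝ → ℝ} {L : ℝ} (hL : 0 < L)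
    (hV : IntegrableOn V (Ioo 0 L) volume) (k : ℂ) :
    AEStronglyMeasurable (Function.uncurry (toothKernel V L k))
      ((volume.restrict (Ioo 0 L)).prod (volume.restrict (Ioo 0 L))) := by
  have h1 := ((outerSol_isSol hL hV (k ^ 2)).acDeriv hL.le).continuousOn hL.le
  have h2 := ((innerSol_isSol hL hV (k ^ 2)).acDeriv hL.le).continuousOn hL.le
  have h3 : ContinuousOn (Function.uncurry (toothKernel V L k)) (Ioo 0 L ×ˢ Ioo 0 L) := by
    have e : Function.uncurry (toothKernel V L k) = fun p : ℝ × ℝ => (outerSol V L (k ^ 2) 0)⁻¹ *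
        (innerSol V L (k ^ 2) (min p.1 p.2) * outerSol V L (k ^ 2) (max p.1 p.2)) :=
      funext fun p => toothKernel_eq hL hV k p.1 p.2
    rw [e]
    refine continuousOn_const.mul (ContinuousOn.mul ?_ ?_)
    · refine h2.comp (by fun_prop) fun p hp => ?_
      exact ⟨le_min hp.1.1.le hp.2.1.le, (min_le_left _ _).trans hp.1.2.le⟩
    · refine h1.comp (by fun_prop) fun p hp => ?_
      exact ⟨hp.1.1.le.trans (le_max_left _ _), max_le hp.1.2.le hp.2.2.le⟩
  rw [Measure.prod_restrict]
  exact h3.aestronglyMeasurable (measurableSet_Ioo.prod measurableSet_Ioo)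

theorem exists_isKernelOp_toothKernel {V : ℝ → ℝ} {L : ℝ} (hL : 0 < L)
    (hV : IntegrableOn V (Ioo 0 L) volume) (k : ℂ) :
    ∃ T : Lp ℂ 2 (volume.restrict (Ioo 0 L)) →L[ℂ] Lp ℂ 2 (volume.restrict (Ioo 0 L)),
      IsKernelOp (toothKernel V L k) T := by
  obtain ⟨C, hC⟩ := exists_bound_toothKernel hL hV k
  have hmem : ∀ᵐ x ∂(volume.restrict (Ioo 0 L)), x ∈ Ioo 0 L := ae_restrict_mem measurableSet_Ioo
  have key : ∀ᵐ x ∂(volume.restrict (Ioo 0 L)),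
      ∫⁻ y in Ioo 0 L, ‖toothKernel V L k x y‖ₑ ≤ ((C * L.toNNReal : ℝ≥0) : ℝ≥0∞) := by
    filter_upwards [hmem] with x hx
    calc _ ≤ ∫⁻ _ in Ioo 0 L, (C : ℝ≥0∞) := by
          refine lintegral_mono_ae ?_
          filter_upwards [hmem] with y hy
          exact hC x (Ioo_subset_Icc_self hx) y (Ioo_subset_Icc_self hy)
      _ = _ := by
          rw [lintegral_const, Measure.restrict_apply MeasurableSet.univ, univ_inter,
            Real.volume_Ioo, sub_zero]
          push_cast
          rfl
  refine exists_isKernelOp_of_schur (C * L.toNNReal) (aestronglyMeasurable_toothKernel hL hV k)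
    key ?_
  simp only [toothKernel_symm V L k _]
  filter_upwards [key] with y hy
  refine le_trans (le_of_eq ?_) hy
  exact lintegral_congr fun x => by rw [toothKernel_symm]

/-- The Dirichlet resolvent of a tooth inverts `-d²/dx² + V - k²`. -/
theorem ac2Data_toothKernel_integral {V : ℝ → ℝ} {L : ℝ} (hL : 0 < L)
    (hV : IntegrableOn V (Ioo 0 L) volume) {k : ℂ} (hk : outerSol V L (k ^ 2) 0 ≠ 0) {φ : ℝ → ℂ}
    (hφ : IntegrableOn φ (Ioo 0 L) volume) :
    ∃ f₁ : ℝ → ℂ, AC2Data (fun x => ∫ y in Ioo 0 L, toothKernel V L k x y * φ y) f₁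
      (fun x => (V x - k ^ 2) * (∫ y in Ioo 0 L, toothKernel V L k x y * φ y) + -φ x) 0 L ∧
      f₁ 0 = (outerSol V L (k ^ 2) 0)⁻¹ * ∫ y in Ioo 0 L, outerSol V L (k ^ 2) y * φ y := by
  set u := outerSol V L (k ^ 2) with hu
  set v := innerSol V L (k ^ 2) with hv
  set r := (u 0)⁻¹ with hr
  have hus := outerSol_isSol hL hV (k ^ 2)
  have hvs := innerSol_isSol hL hV (k ^ 2)
  have hcu := (hus.acDeriv hL.le).continuousOn hL.le
  have hcv := (hvs.acDeriv hL.le).continuousOn hL.le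
  have hφi := intervalIntegrable_of_Ioo hL.le hφ
  have iu : IntervalIntegrable (fun y => u y * φ y) volume 0 L :=
    hφi.continuousOn_mul (by rwa [uIcc_of_le hL.le])
  have iv : IntervalIntegrable (fun y => v y * φ y) volume 0 L :=
    hφi.continuousOn_mul (by rwa [uIcc_of_le hL.le])
  have hsub : ∀ (g : ℝ → ℂ), IntervalIntegrable g volume 0 L → ∀ x ∈ Icc 0 L,
      IntervalIntegrable g volume 0 x ∧ IntervalIntegrable g volume x L := by
    intro g hg x hx
    constructor
    · refine hg.mono_set ?_
      rw [uIcc_of_le hx.1, uIcc_of_le hL.le]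
      exact Icc_subset_Icc_right hx.2
    · refine hg.mono_set ?_
      rw [uIcc_of_le hx.2, uIcc_of_le hL.le]
      exact Icc_subset_Icc_left hx.1
  have hsplit : ∀ x ∈ Icc 0 L, ∫ y in Ioo 0 L, toothKernel V L k x y * φ y =
      r * u x * (∫ y in 0..x, v y * φ y) + r * v x * ∫ y in x..L, u y * φ y := by
    intro x hx
    have h1 : EqOn (fun y => r * u x * (v y * φ y)) (fun y => toothKernel V L k x y * φ y)
        (uIcc 0 x) := fun y hy => by
      rw [uIcc_of_le hx.1] at hy
      beta_reduce
      rw [toothKernel_eq hL hV, min_eq_right hy.2, max_eq_left hy.2]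
      ring
    have h2 : EqOn (fun y => r * v x * (u y * φ y)) (fun y => toothKernel V L k x y * φ y)
        (uIcc x L) := fun y hy => by
      rw [uIcc_of_le hx.2] at hy
      beta_reduce
      rw [toothKernel_eq hL hV, min_eq_left hy.1, max_eq_right hy.1]
      ring
    have h3 : IntervalIntegrable (fun y => toothKernel V L k x y * φ y) volume 0 x :=
      intervalIntegrable_of_ae_eq hx.1 ((hsub _ iv x hx).1.const_mul (r * u x))
        (Eventually.of_forall fun y hy => h1 (Icc_subset_uIcc (Ioo_subset_Icc_self hy)))
    have h4 : IntervalIntegrable (fun y => toothKernel V L k x y * φ y) volume x L :=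
      intervalIntegrable_of_ae_eq hx.2 ((hsub _ iu x hx).2.const_mul (r * v x))
        (Eventually.of_forall fun y hy => h2 (Icc_subset_uIcc (Ioo_subset_Icc_self hy)))
    rw [← integral_Ioc_eq_integral_Ioo, ← intervalIntegral.integral_of_le hL.le,
      ← intervalIntegral.integral_add_adjacent_intervals h3 h4,
      ← intervalIntegral.integral_congr h1, ← intervalIntegral.integral_congr h2,
      intervalIntegral.integral_const_mul, intervalIntegral.integral_const_mul]
  have hP : ACDeriv (fun x => ∫ y in 0..x, v y * φ y) (fun x => v x * φ x) 0 L :=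
    ACDeriv.integral hL.le iv
  have hQ : ACDeriv (fun x => ∫ y in x..L, u y * φ y) (fun x => -(u x * φ x)) 0 L := by
    have h2 := ((ACDeriv.const (∫ y in 0..L, u y * φ y) 0 L).sub
      (ACDeriv.integral hL.le iu)).congr_ae (g := fun x => -(u x * φ x)) (by simp)
    refine h2.congr hL.le fun x hx => ?_
    rw [← intervalIntegral.integral_add_adjacent_intervals (hsub _ iu x hx).1 (hsub _ iu x hx).2]
    ring
  have hu' : IsSol (fun x => V x - k ^ 2) (fun x => r * u x)
      (fun x => r * outerDeriv V L (k ^ 2) x) 0 L :=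
    (hus.const_mul r).congr_ae (Eventually.of_forall fun x _ => by ring)
  have hv' : IsSol (fun x => V x - k ^ 2) (fun x => r * v x)
      (fun x => r * innerDeriv V L (k ^ 2) x) 0 L :=
    (hvs.const_mul r).congr_ae (Eventually.of_forall fun x _ => by ring)
  -- The constant Wronskian, evaluated at 0, produces the source term -φ.
  have hW : ∀ x ∈ Icc 0 L, r * (v x * outerDeriv V L (k ^ 2) x - innerDeriv V L (k ^ 2) x * u x) =
      -1 := fun x hx => by
    have e := hvs.wronskian_const hL.le hus hx (left_mem_Icc.2 hL.le)
    obtain ⟨e1, e2⟩ := innerSol_start hL hV (k ^ 2)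
    rw [e1, e2, ← hu, ← hv] at e
    rw [e, hr]
    field_simp
    ring
  refine ⟨_, ((AC2Data.variation hL.le hu' hv' hP hQ fun x _ => ?_).congr
    (v := fun x => ∫ y in Ioo 0 L, toothKernel V L k x y * φ y) fun x hx => hsplit x hx).congr_ae
    (Eventually.of_forall fun x hx => ?_), ?_⟩
  · ring
  · rw [hsplit x (Ioo_subset_Icc_self hx)]
    linear_combination φ x * hW x (Ioo_subset_Icc_self hx)
  -- At 0 the integral multiplying u_L' is empty and u_0' = 1, so only the pairing of φ with u_L
  -- remains.
  · rw [intervalIntegral.integral_same, (innerSol_start hL hV (k ^ 2)).2,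
      intervalIntegral.integral_of_le hL.le, integral_Ioc_eq_integral_Ioo]
    ring

/-! ### Operators on the state space given by matrix kernels -/

theorem coeFn_sum_Lp {μ : Measure ℝ} {ι : Type*} (s : Finset ι) (f : ι → Lp ℂ 2 μ) :
    ⇑(∑ i ∈ s, f i) =ᵐ[μ] fun x => ∑ i ∈ s, f i x := by
  classical
  induction s using Finset.induction_on with
  | empty =>
    filter_upwards [Lp.coeFn_zero ℂ 2 μ] with x hx
    simpa using hx
  | insert i s hi ih =>
    rw [Finset.sum_insert hi]
    filter_upwards [Lp.coeFn_add (f i) (∑ j ∈ s, f j), ih] with x h1 h2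
    rw [h1, Pi.add_apply, h2, Finset.sum_insert hi]

theorem exists_hasKernel (Γ : CombGraph N) (G : Option (Fin N) → Option (Fin N) → ℝ → ℝ → ℂ)
    (h : ∀ i j, ∃ T : Lp ℂ 2 (Γ.edgeMeasure j) →L[ℂ] Lp ℂ 2 (Γ.edgeMeasure i),
      IsKernelOp (G i j) T) : ∃ R : Γ.Space →L[ℂ] Γ.Space, Γ.HasKernel R G := by
  choose T hT using h
  refine ⟨((PiLp.continuousLinearEquiv 2 ℂ
    (fun i : Option (Fin N) => Lp ℂ 2 (Γ.edgeMeasure i))).symm :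
      (∀ i : Option (Fin N), Lp ℂ 2 (Γ.edgeMeasure i)) →L[ℂ] Γ.Space).comp
    (ContinuousLinearMap.pi fun i => ∑ j, (T i j).comp (PiLp.proj 2 _ j)), fun Φ i => ?_⟩
  have e : (((PiLp.continuousLinearEquiv 2 ℂ
    (fun i : Option (Fin N) => Lp ℂ 2 (Γ.edgeMeasure i))).symm :
      (∀ i : Option (Fin N), Lp ℂ 2 (Γ.edgeMeasure i)) →L[ℂ] Γ.Space).comp
    (ContinuousLinearMap.pi fun i => ∑ j, (T i j).comp (PiLp.proj 2 _ j))) Φ i =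
      ∑ j, T i j (Φ j) := by
    change (∑ j, (T i j).comp (PiLp.proj 2 _ j)) Φ = _
    rw [sum_apply]
    rfl
  rw [e]
  filter_upwards [coeFn_sum_Lp Finset.univ fun j => T i j (Φ j),
    ae_all_iff.2 fun j => hT i j (Φ j)] with x h1 h2
  exact ⟨fun j => (h2 j).1, h1.trans (Finset.sum_congr rfl fun j _ => (h2 j).2)⟩

theorem memLp_of_continuousOn {f : ℝ → ℂ} {a b : ℝ} (hf : ContinuousOn f (Icc a b)) :
    MemLp f 2 (volume.restrict (Ioo a b)) := by
  obtain ⟨C, hC⟩ := isCompact_Icc.exists_bound_of_continuousOn hf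
  refine MemLp.of_bound (aestronglyMeasurable_of_continuousOn_Icc hf) C ?_
  filter_upwards [ae_restrict_mem measurableSet_Ioo] with x hx
  exact hC x (Ioo_subset_Icc_self hx)

theorem memLp_uL (Γ : CombGraph N) (k : ℂ) (s : Fin N) :
    MemLp (Γ.uL k s) 2 (volume.restrict (Ioo 0 (Γ.L s))) :=
  memLp_of_continuousOn (((Γ.isSol_uL k s).acDeriv (Γ.L_pos s).le).continuousOn (Γ.L_pos s).le)

theorem memLp_defVector (Γ : CombGraph N) {k : ℂ} (hk : 0 < k.im) (m : Fin N ⊕ Fin N)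
    (i : Option (Fin N)) : MemLp (Γ.defVector k m i) 2 (Γ.edgeMeasure i) := by
  rcases m with n | n <;> rcases i with _ | s
  · exact memLp_lineKernel hk _
  · exact MemLp.zero'
  · exact MemLp.zero'
  · by_cases h : s = n
    · subst h
      have e : Γ.defVector k (Sum.inr s) (some s) = Γ.uL k s := by
        ext x
        simp [defVector]
      rw [e]
      exact Γ.memLp_uL k s
    · have e : Γ.defVector k (Sum.inr n) (some s) = fun _ => 0 := by
        ext x
        simp [defVector, h]
      rw [e]
      exact MemLp.zero'

theorem exists_isKernelOp_freeKernel (Γ : CombGraph N) {k : ℂ} (hk : 0 < k.im)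
    (i j : Option (Fin N)) :
    ∃ T : Lp ℂ 2 (Γ.edgeMeasure j) →L[ℂ] Lp ℂ 2 (Γ.edgeMeasure i),
      IsKernelOp (Γ.freeKernel k i j) T := by
  rcases i with _ | s <;> rcases j with _ | n
  · exact exists_isKernelOp_lineKernel hk
  · exact ⟨0, isKernelOp_zero _ _⟩
  · exact ⟨0, isKernelOp_zero _ _⟩
  · by_cases h : s = n
    · subst h
      have e : Γ.freeKernel k (some s) (some s) = toothKernel (Γ.V s) (Γ.L s) k := by
        ext x y
        simp [freeKernel]
      rw [e]
      exact exists_isKernelOp_toothKernel (Γ.L_pos s) (Γ.V_int s) k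
    · have e : Γ.freeKernel k (some s) (some n) = fun _ _ => 0 := by
        ext x y
        simp [freeKernel, h]
      rw [e]
      exact ⟨0, isKernelOp_zero _ _⟩

/-- A bounded operator plus a finite-rank one with square integrable deficiency vectors. Boundedness
is insensitive to the values of the coefficients, so neither regularity nor D_N ≠ 0 enters here. -/
theorem exists_hasKernel_kreinKernel (Γ : CombGraph N) {k : ℂ} (hk : 0 < k.im) :
    ∃ R : Γ.Space →L[ℂ] Γ.Space, Γ.HasKernel R (Γ.kreinKernel k) := by
  refine Γ.exists_hasKernel _ fun i j => ?_
  obtain ⟨T, hT⟩ := Γ.exists_isKernelOp_freeKernel hk i j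
  have h1 := exists_isKernelOp_sum (μ := Γ.edgeMeasure j) (ν := Γ.edgeMeasure i) Finset.univ
    (K := fun m x y => ∑ n, Γ.kreinCoef k m n * Γ.defVector k m i x * Γ.defVector k n j y)
    fun m => exists_isKernelOp_sum Finset.univ fun n => by
      obtain ⟨T', hT'⟩ := exists_isKernelOp_rankOne (Γ.memLp_defVector hk m i)
        (Γ.memLp_defVector hk n j)
      have := hT'.const_mul (Γ.kreinCoef k m n)
      simp only [← mul_assoc] at this
      exact ⟨_, this⟩
  obtain ⟨T', hT'⟩ := h1
  exact ⟨T + T', hT.add hT'⟩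

/-! ### The Krein formula -/

/-- The pairings `∑ⱼ ∫ F_m(j, y) φ(j, y) dy`. -/
def pairing (Γ : CombGraph N) (k : ℂ) (φ : Option (Fin N) → ℝ → ℂ) : Fin N ⊕ Fin N → ℂ
  | Sum.inl n => ∫ y, lineKernel k y (Γ.node n) * φ none y
  | Sum.inr n => ∫ y in Ioo 0 (Γ.L n), Γ.uL k n y * φ (some n) y

/-- The decoupled resolvent applied to `φ`, plus a superposition of deficiency vectors. -/
def kreinFun (Γ : CombGraph N) (k : ℂ) (φ : Option (Fin N) → ℝ → ℂ) (Λ : Fin N ⊕ Fin N → ℂ)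
    (i : Option (Fin N)) (x : ℝ) : ℂ :=
  match i with
  | none => (∫ y, lineKernel k x y * φ none y) + Γ.kerSum k (fun n => Λ (Sum.inl n)) x
  | some s => (∫ y in Ioo 0 (Γ.L s), toothKernel (Γ.V s) (Γ.L s) k x y * φ (some s) y) +
      Λ (Sum.inr s) * Γ.uL k s x

/-- The differential equation holds for every Λ, since the deficiency vectors solve the homogeneous
equation. The linear system is needed only for the coupling conditions at the junctions. -/
theorem kreinFun_spec (Γ : CombGraph N) {k : ℂ} (hk : 0 < k.im) (hreg : Γ.IsRegular k)
    {φ : Option (Fin N) → ℝ → ℂ} (hφ : ∀ i, MemLp (φ i) 2 (Γ.edgeMeasure i))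
    {Λ : Fin N ⊕ Fin N → ℂ}
    (hΛ : (Γ.coefMatrix k).mulVec Λ = (Γ.coefRhs k).mulVec (Γ.pairing k φ)) :
    Γ.IsLocallyInDomain (Γ.kreinFun k φ Λ) ∧
      ∀ i, ∀ᵐ x ∂(Γ.edgeMeasure i), Γ.action (Γ.kreinFun k φ Λ) i x =
        k ^ 2 * Γ.kreinFun k φ Λ i x + φ i x := by
  have hφn : MemLp (φ none) 2 volume := hφ none
  have hφs : ∀ s, MemLp (φ (some s)) 2 (volume.restrict (Ioo 0 (Γ.L s))) := fun s => hφ (some s)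
  obtain ⟨f₁, hf⟩ := ac2Data_lineKernel_integral hk hφn
  have ht := fun s => ac2Data_toothKernel_integral (Γ.L_pos s) (Γ.V_int s) (k := k) (hreg.2 s).1
    ((hφs s).integrable (by norm_num))
  choose g₁ hg hg0 using ht
  have hline : ∀ x y, x ≤ y → Γ.NodeFree x y → ∃ ψ₁, AC2Data (Γ.kreinFun k φ Λ none) ψ₁
      (fun t => -k ^ 2 * Γ.kreinFun k φ Λ none t + -φ none t) x y := fun x y hxy hfree =>
    ⟨_, ((hf x y hxy).add (isSol_kerSum Γ k _ hxy hfree)).congr_ae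
      (Eventually.of_forall fun t _ => by simp only [kreinFun]; ring)⟩
  have htooth : ∀ s, AC2Data (Γ.kreinFun k φ Λ (some s))
      (fun x => g₁ s x + Λ (Sum.inr s) * Γ.uLd k s x)
      (fun t => (Γ.V s t - k ^ 2) * Γ.kreinFun k φ Λ (some s) t + -φ (some s) t) 0 (Γ.L s) :=
    fun s => ((hg s).add ((Γ.isSol_uL k s).const_mul (Λ (Sum.inr s)))).congr_ae
      (Eventually.of_forall fun t _ => by simp only [kreinFun]; ring)
  have hnode : ∀ s, Γ.kreinFun k φ Λ none (Γ.node s) = Γ.pairing k φ (Sum.inl s) +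
      ∑ n, Λ (Sum.inl n) * (Complex.I / (2 * k) * Γ.epsPow k s n) := fun s => by
    simp only [kreinFun, pairing, kerSum, lineKernel_node]
    simp only [lineKernel_symm k (Γ.node s)]
  have htd : ∀ s, rightDeriv (Γ.kreinFun k φ Λ (some s)) 0 =
      (Γ.uL k s 0)⁻¹ * Γ.pairing k φ (Sum.inr s) + Λ (Sum.inr s) * Γ.uL' k s := fun s => by
    rw [(htooth s).rightDeriv (Γ.L_pos s), hg0 s, (Γ.uL_end k s).2.2]
    rfl
  -- The Dirichlet resolvent of the tooth contributes nothing to the value at the junction; it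
  -- enters only through its derivative there, computed in `htd`.
  have ht0 : ∀ s, Γ.kreinFun k φ Λ (some s) 0 = Λ (Sum.inr s) * Γ.uL k s 0 := fun s => by
    have h1 := (innerSol_start (Γ.L_pos s) (Γ.V_int s) (k ^ 2)).1
    have h2 : ∫ y in Ioo 0 (Γ.L s), toothKernel (Γ.V s) (Γ.L s) k 0 y * φ (some s) y = 0 := by
      rw [setIntegral_congr_fun (g := fun _ => (0 : ℂ)) measurableSet_Ioo]
      · simp
      · intro y hy
        beta_reduce
        rw [toothKernel_eq (Γ.L_pos s) (Γ.V_int s), min_eq_left hy.1.le, h1]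
        ring
    simp only [kreinFun, h2, zero_add]
  have htL : ∀ s, Γ.kreinFun k φ Λ (some s) (Γ.L s) = 0 := fun s => by
    have h1 := (Γ.uL_end k s).1
    have h2 : ∫ y in Ioo 0 (Γ.L s), toothKernel (Γ.V s) (Γ.L s) k (Γ.L s) y * φ (some s) y = 0 := by
      rw [setIntegral_congr_fun (g := fun _ => (0 : ℂ)) measurableSet_Ioo]
      · simp
      · intro y hy
        beta_reduce
        have h3 : outerSol (Γ.V s) (Γ.L s) (k ^ 2) (Γ.L s) = 0 := h1
        rw [toothKernel_eq (Γ.L_pos s) (Γ.V_int s), max_eq_left hy.2.le, h3]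
        ring
    simp only [kreinFun, h2, h1, mul_zero, add_zero]
  -- The first block of rows is the condition on u_s(0), the second the jump condition for f'.
  have row1 := fun s => congrFun hΛ (Sum.inl s)
  have row2 := fun s => congrFun hΛ (Sum.inr s)
  simp only [coefMatrix, coefRhs, Matrix.mulVec, dotProduct, Fintype.sum_sum_type,
    Matrix.fromBlocks_apply₁₁, Matrix.fromBlocks_apply₁₂, Matrix.fromBlocks_apply₂₁,
    Matrix.fromBlocks_apply₂₂, Matrix.of_apply, Matrix.diagonal_apply, ite_mul, zero_mul,
    Finset.sum_ite_eq, Finset.mem_univ, if_true, add_mul, one_mul,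
    Finset.sum_add_distrib] at row1 row2
  have hℓ := Γ.ℓ_pos
  refine ⟨⟨fun x y hxy hfree => ?_, fun s => (htooth s).isAC2 (Γ.L_pos s), fun s => ?_, fun s => ?_,
    htL⟩, fun i => ?_⟩
  · obtain ⟨ψ₁, h⟩ := hline x y hxy.le hfree
    exact h.isAC2 hxy
  · have h0 := (hreg.2 s).1
    have e : (Γ.b s : ℂ) * ∑ n, Λ (Sum.inl n) * (Complex.I / (2 * k) * Γ.epsPow k s n) =
        ∑ n, Complex.I * Γ.b s / (2 * k) * Γ.epsPow k s n * Λ (Sum.inl n) := by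
      rw [Finset.mul_sum]
      exact Finset.sum_congr rfl fun n _ => by ring
    rw [ht0, hnode, htd, mul_add, e]
    linear_combination -row1 s
  · have a1 : Γ.node s < Γ.node s + 1 := by linarith
    have a2 : Γ.node s - 1 < Γ.node s := by linarith
    have h0 := (hreg.2 s).1
    have e : (Γ.d s : ℂ) * ∑ n, Λ (Sum.inl n) * (Complex.I / (2 * k) * Γ.epsPow k s n) =
        ∑ n, Complex.I * Γ.d s / (2 * k) * Γ.epsPow k s n * Λ (Sum.inl n) := by
      rw [Finset.mul_sum]
      exact Finset.sum_congr rfl fun n _ => by ring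
    rw [Γ.kerSum_jump hreg.1 (fun n => Λ (Sum.inl n)) (f := Γ.kreinFun k φ Λ none)
      (g := fun x => ∫ y, lineKernel k x y * φ none y) s a1 a2 (hf _ _ a1.le) (hf _ _ a2.le)
      (fun x => rfl), (hf _ _ a1.le).rightDeriv a1, (hf _ _ a2.le).leftDeriv a2, hnode, htd,
      mul_add, e]
    linear_combination -row2 s
  · cases i with
    | none =>
      refine Γ.ae_of_cells fun n => ?_
      obtain ⟨ψ₁, h⟩ := hline (n * Γ.ℓ) ((n + 1) * Γ.ℓ) (by nlinarith) (Γ.nodeFree_cell n)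
      filter_upwards [h.deriv_deriv] with x hx h1
      simp only [action]
      rw [hx h1]
      ring
    | some s =>
      refine (ae_restrict_iff' measurableSet_Ioo).2 ?_
      filter_upwards [(htooth s).deriv_deriv] with x hx h1
      simp only [action]
      rw [hx h1]
      ring

theorem integral_add_double_sum {μ : Measure ℝ} {ι : Type*} [Fintype ι] {f : ℝ → ℂ}
    {g : ι → ℝ → ℂ} (a : ι → ι → ℂ) (hf : Integrable f μ) (hg : ∀ n, Integrable (g n) μ) :
    ∫ y, (f y + ∑ m, ∑ n, a m n * g n y) ∂μ = (∫ y, f y ∂μ) + ∑ m, ∑ n, a m n * ∫ y, g n y ∂μ := by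
  have h1 : ∀ m, Integrable (fun y => ∑ n, a m n * g n y) μ := fun m =>
    integrable_finsetSum _ fun n _ => (hg n).const_mul _
  rw [integral_add hf (integrable_finsetSum _ fun m _ => h1 m),
    integral_finsetSum _ fun m _ => h1 m]
  congr 1
  refine Finset.sum_congr rfl fun m _ => ?_
  rw [integral_finsetSum _ fun n _ => (hg n).const_mul _]
  exact Finset.sum_congr rfl fun n _ => integral_const_mul _ _

theorem kreinKernel_apply (Γ : CombGraph N) {k : ℂ} (hk : 0 < k.im) (Φ : Γ.Space)
    (i : Option (Fin N)) (x : ℝ)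
    (h0 : ∀ j, Integrable (fun y => Γ.freeKernel k i j x y * Φ j y) (Γ.edgeMeasure j)) :
    ∑ j, ∫ y, Γ.kreinKernel k i j x y * Φ j y ∂(Γ.edgeMeasure j) =
      Γ.kreinFun k (fun j => Φ j)
        ((Γ.kreinCoef k).mulVec (Γ.pairing k fun j => Φ j)) i x := by
  have hF : ∀ n j, Integrable (fun y => Γ.defVector k n j y * Φ j y) (Γ.edgeMeasure j) :=
    fun n j => integrable_mul_of_memLp (Γ.memLp_defVector hk n j) (Lp.memLp (Φ j))
  have hpair : ∀ n, ∑ j, ∫ y, Γ.defVector k n j y * Φ j y ∂(Γ.edgeMeasure j) =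
      Γ.pairing k (fun j => Φ j) n := by
    intro n
    rw [Fintype.sum_option]
    rcases n with n | n
    · simp only [defVector, zero_mul, integral_zero, Finset.sum_const_zero, add_zero]
      rfl
    · simp only [defVector, zero_mul, integral_zero, zero_add]
      rw [Finset.sum_eq_single n]
      · simp only [if_true]
        rfl
      · intro s _ hs
        simp [hs]
      · simp
  have h1 : ∀ j, ∫ y, Γ.kreinKernel k i j x y * Φ j y ∂(Γ.edgeMeasure j) =
      (∫ y, Γ.freeKernel k i j x y * Φ j y ∂(Γ.edgeMeasure j)) +
      ∑ m, ∑ n, Γ.kreinCoef k m n * Γ.defVector k m i x *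
        ∫ y, Γ.defVector k n j y * Φ j y ∂(Γ.edgeMeasure j) := by
    intro j
    rw [← integral_add_double_sum (fun m n => Γ.kreinCoef k m n * Γ.defVector k m i x) (h0 j)
      fun n => hF n j]
    congr 1
    ext y
    simp only [kreinKernel, add_mul, Finset.sum_mul, mul_assoc]
  have h2 : ∑ j, ∑ m, ∑ n, Γ.kreinCoef k m n * Γ.defVector k m i x *
        ∫ y, Γ.defVector k n j y * Φ j y ∂(Γ.edgeMeasure j) =
      ∑ m, (Γ.kreinCoef k).mulVec (Γ.pairing k fun j => Φ j) m * Γ.defVector k m i x := by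
    rw [Finset.sum_comm]
    refine Finset.sum_congr rfl fun m _ => ?_
    rw [Finset.sum_comm, Matrix.mulVec, dotProduct, Finset.sum_mul]
    refine Finset.sum_congr rfl fun n _ => ?_
    rw [← Finset.mul_sum, hpair]
    ring
  simp only [h1]
  rw [Finset.sum_add_distrib, h2, Fintype.sum_option, Fintype.sum_sum_type]
  cases i with
  | none =>
    simp only [freeKernel, defVector, zero_mul, integral_zero, Finset.sum_const_zero, add_zero,
      mul_zero, kreinFun, kerSum]
    rfl
  | some s =>
    simp only [freeKernel, defVector, zero_mul, integral_zero, Finset.sum_const_zero, zero_add,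
      mul_zero, kreinFun]
    congr 1
    · rw [Finset.sum_eq_single s]
      · simp only [if_true]
        rfl
      · intro n _ hn
        simp [Ne.symm hn]
      · simp
    · simp

/-! ### The linear system -/

theorem epsPow_symm (Γ : CombGraph N) (k : ℂ) (s n : Fin N) : Γ.epsPow k s n = Γ.epsPow k n s := by
  rw [epsPow, epsPow]
  congr 1
  omega

/-- By regularity the diagonal block c u_L' - u_L is invertible, so the first rows express q through
p. Substitution into the second rows turns d into 2kβ; here β carries the row index, whence the
transpose. -/
theorem coefMatrix_mulVec_eq_zero_iff (Γ : CombGraph N) {k : ℂ} (hreg : Γ.IsRegular k)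
    (p q : Fin N → ℂ) : (Γ.coefMatrix k).mulVec (Sum.elim p q) = 0 ↔
      (Γ.combMatrix k).transpose.mulVec p = 0 ∧
        ∀ s, q s = Γ.toothAmp k s * ∑ n, Complex.I / (2 * k) * Γ.epsPow k s n * p n := by
  have hk := hreg.1
  have e : ∀ (r : ℝ) (s : Fin N), ∑ n, Complex.I * r / (2 * k) * Γ.epsPow k s n * p n =
      r * ∑ n, Complex.I / (2 * k) * Γ.epsPow k s n * p n := fun r s => by
    rw [Finset.mul_sum]
    exact Finset.sum_congr rfl fun n _ => by ring
  have e' : ∀ s, (Γ.combMatrix k).transpose.mulVec p s =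
      2 * k * Γ.beta k s * (∑ n, Complex.I / (2 * k) * Γ.epsPow k s n * p n) + p s := fun s => by
    simp only [Matrix.mulVec, dotProduct, Matrix.transpose_apply, combMatrix, Matrix.of_apply,
      add_mul, Finset.sum_add_distrib, ite_mul, one_mul, zero_mul, Finset.sum_ite_eq',
      Finset.mem_univ, if_true]
    rw [Finset.mul_sum]
    congr 1
    refine Finset.sum_congr rfl fun n _ => ?_
    rw [Γ.epsPow_symm k n s]
    field_simp
  have r1 : ∀ s, (Γ.coefMatrix k).mulVec (Sum.elim p q) (Sum.inl s) =
      Γ.b s * (∑ n, Complex.I / (2 * k) * Γ.epsPow k s n * p n) +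
        (Γ.c s * Γ.uL' k s - Γ.uL k s 0) * q s := fun s => by
    simp [coefMatrix, Matrix.mulVec, dotProduct, Fintype.sum_sum_type, Matrix.diagonal_apply, e]
  have r2 : ∀ s, (Γ.coefMatrix k).mulVec (Sum.elim p q) (Sum.inr s) =
      Γ.d s * (∑ n, Complex.I / (2 * k) * Γ.epsPow k s n * p n) + p s -
        Γ.b s * Γ.uL' k s * q s := fun s => by
    simp [coefMatrix, Matrix.mulVec, dotProduct, Fintype.sum_sum_type, Matrix.diagonal_apply, e,
      add_mul, Finset.sum_add_distrib]
    ring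
  constructor
  · intro h
    have hq : ∀ s, q s = Γ.toothAmp k s * ∑ n, Complex.I / (2 * k) * Γ.epsPow k s n * p n := by
      intro s
      have h1 := congrFun h (Sum.inl s)
      rw [r1] at h1
      have h2 := (hreg.2 s).2
      rw [toothAmp, div_mul_eq_mul_div, eq_div_iff h2]
      rw [Pi.zero_apply] at h1
      linear_combination h1
    refine ⟨funext fun s => ?_, hq⟩
    have h1 := congrFun h (Sum.inr s)
    rw [r2, hq s, Pi.zero_apply] at h1
    rw [e', Γ.two_mul_beta hk, Pi.zero_apply]
    linear_combination h1
  · rintro ⟨h, hq⟩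
    funext i
    rcases i with s | s
    · rw [r1, hq s, toothAmp, Pi.zero_apply]
      have h2 := (hreg.2 s).2
      field_simp
      ring
    · have h1 := congrFun h s
      rw [e', Γ.two_mul_beta hk, Pi.zero_apply] at h1
      rw [r2, hq s, Pi.zero_apply]
      linear_combination h1

theorem coefMatrix_det_eq_zero_iff (Γ : CombGraph N) {k : ℂ} (hreg : Γ.IsRegular k) :
    (Γ.coefMatrix k).det = 0 ↔ Γ.combDet k = 0 := by
  rw [combDet_eq, ← Matrix.det_transpose (Γ.combMatrix k), ← Matrix.exists_mulVec_eq_zero_iff,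
    ← Matrix.exists_mulVec_eq_zero_iff]
  constructor
  · rintro ⟨Λ, hΛ, h⟩
    rw [← Sum.elim_comp_inl_inr Λ, Γ.coefMatrix_mulVec_eq_zero_iff hreg] at h
    refine ⟨_, fun h0 => hΛ ?_, h.1⟩
    funext i
    rcases i with s | s
    · exact congrFun h0 s
    · have := h.2 s
      rw [h0] at this
      simpa using this
  · rintro ⟨p, hp, h⟩
    refine ⟨Sum.elim p _, fun h0 => hp ?_, (Γ.coefMatrix_mulVec_eq_zero_iff hreg p _).2
      ⟨h, fun s => rfl⟩⟩
    funext s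
    exact congrFun h0 (Sum.inl s)

theorem coefMatrix_mul_eq_iff (Γ : CombGraph N) {k : ℂ} (h : (Γ.coefMatrix k).det ≠ 0)
    (M : Matrix (Fin N ⊕ Fin N) (Fin N ⊕ Fin N) ℂ) :
    Γ.coefMatrix k * M = Γ.coefRhs k ↔ M = Γ.kreinCoef k := by
  have hu := isUnit_iff_ne_zero.2 h
  constructor
  · intro e
    rw [kreinCoef, ← e, Matrix.nonsing_inv_mul_cancel_left _ _ hu]
  · rintro rfl
    rw [kreinCoef, Matrix.mul_nonsing_inv_cancel_left _ _ hu]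

/-! ### Square integrable eigenfunctions -/

/-- On each half-line the wave is multiplied by a bounded exponential that makes its growing part
constant, while the other part becomes a decaying exponential of rate 2k. A square integrable
constant on a set of infinite measure is zero. -/
theorem planeWave_eq_zero_of_memLp {k A C : ℂ} (hk : 0 < k.im)
    (h : MemLp (planeWave k A C) 2 volume) : A = 0 ∧ C = 0 := by
  have hk0 : k ≠ 0 := by
    rintro rfl
    simp at hk
  have h2k : 0 < (2 * k).im := by simpa using hk
  -- Common to both half-lines; the decaying exponential is written as a multiple of the free kernel
  -- at momentum 2k, whose square integrability is already known.
  have key : ∀ (s : Set ℝ) (_ : MeasurableSet s) (_ : volume s = ⊤) (E : ℝ → ℂ)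
      (_ : Continuous E) (_ : ∀ x ∈ s, ‖E x‖ ≤ 1) (a c : ℂ)
      (_ : ∀ x ∈ s, E x * planeWave k A C x = a * lineKernel (2 * k) x 0 + c), c = 0 := by
    intro s hs hs' E hE hE1 a c he
    have m1 : MemLp (fun x => E x * planeWave k A C x) 2 (volume.restrict s) := by
      refine (h.restrict s).of_le (hE.aestronglyMeasurable.mul (h.1.restrict)) ?_
      filter_upwards [ae_restrict_mem hs] with x hx
      rw [norm_mul]
      exact mul_le_of_le_one_left (norm_nonneg _) (hE1 x hx)
    have m2 : MemLp (fun x => a * lineKernel (2 * k) x 0) 2 (volume.restrict s) :=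
      ((memLp_lineKernel h2k 0).restrict s).const_mul a
    have m3 : MemLp (fun _ : ℝ => c) 2 (volume.restrict s) := by
      refine (memLp_congr_ae ?_).1 (m1.sub m2)
      filter_upwards [ae_restrict_mem hs] with x hx
      simp only [Pi.sub_apply]
      rw [he x hx]
      ring
    rw [memLp_const_iff (by norm_num) (by norm_num)] at m3
    rcases m3 with m3 | m3
    · exact m3
    · simp [hs'] at m3
  constructor
  · refine key (Iic 0) measurableSet_Iic (by simp) (fun x => Complex.exp (-(Complex.I * k * x)))
      (by fun_prop) (fun x hx => ?_) (C * (4 * k / Complex.I)) A fun x hx => ?_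
    · rw [Complex.norm_exp]
      refine Real.exp_le_one_iff.2 ?_
      simp
      nlinarith [mem_Iic.1 hx]
    · have e1 : Complex.exp (-(Complex.I * k * x)) * Complex.exp (Complex.I * k * x) = 1 := by
        rw [← Complex.exp_add]
        simp
      have e2 : lineKernel (2 * k) x 0 = Complex.I / (2 * (2 * k)) *
          (Complex.exp (-(Complex.I * k * x)) * Complex.exp (-(Complex.I * k * x))) := by
        rw [lineKernel, ← Complex.exp_add, sub_zero, abs_of_nonpos (mem_Iic.1 hx)]
        congr 2
        push_cast
        ring
      rw [e2, planeWave, mul_add]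
      have hI := Complex.I_ne_zero
      field_simp
      linear_combination 4 * A * e1
  · refine key (Ici 0) measurableSet_Ici (by simp) (fun x => Complex.exp (Complex.I * k * x))
      (by fun_prop) (fun x hx => ?_) (A * (4 * k / Complex.I)) C fun x hx => ?_
    · rw [Complex.norm_exp]
      refine Real.exp_le_one_iff.2 ?_
      simp
      nlinarith [mem_Ici.1 hx]
    · have e1 : Complex.exp (-(Complex.I * k * x)) * Complex.exp (Complex.I * k * x) = 1 := by
        rw [← Complex.exp_add]
        simp
      have e2 : lineKernel (2 * k) x 0 = Complex.I / (2 * (2 * k)) *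
          (Complex.exp (Complex.I * k * x) * Complex.exp (Complex.I * k * x)) := by
        rw [lineKernel, ← Complex.exp_add, sub_zero, abs_of_nonneg (mem_Ici.1 hx)]
        congr 2
        ring
      rw [e2, planeWave, mul_add]
      have hI := Complex.I_ne_zero
      field_simp
      linear_combination 4 * C * e1

theorem memLp_kerSum (Γ : CombGraph N) {k : ℂ} (hk : 0 < k.im) (μ : Fin N → ℂ) :
    MemLp (Γ.kerSum k μ) 2 volume :=
  memLp_finsetSum Finset.univ fun n _ => (memLp_lineKernel hk (Γ.node n)).const_mul (μ n)

/-- The kernel superposition is square integrable, hence so is the plane wave part, which then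
vanishes. The junction values form a null vector of `combMatrix`, so they vanish too, and with them
everything else. -/
theorem IsGenEigenfunction.eq_zero_of_memLp {Γ : CombGraph N} (hN : 1 ≤ N) {k : ℂ} (hk : 0 < k.im)
    (hreg : Γ.IsRegular k) (hD : Γ.combDet k ≠ 0) {ψ : Option (Fin N) → ℝ → ℂ}
    (h : Γ.IsGenEigenfunction k ψ) (hψ : MemLp (ψ none) 2 volume) :
    ∀ i, ψ i =ᵐ[Γ.edgeMeasure i] 0 := by
  obtain ⟨A, C, he⟩ := h.exists_eq_genEig hN hreg
  have h1 : MemLp (planeWave k A C) 2 volume := by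
    refine (memLp_congr_ae (Eventually.of_forall fun x => ?_)).1
      (hψ.sub (Γ.memLp_kerSum hk (fun n => -(2 * k * Γ.beta k n * ψ none (Γ.node n)))))
    simp only [Pi.sub_apply]
    rw [he x, genEig]
    ring
  obtain ⟨rfl, rfl⟩ := planeWave_eq_zero_of_memLp hk h1
  have h2 : (Γ.combMatrix k).mulVec (fun s => ψ none (Γ.node s)) = 0 := by
    funext s
    have := he (Γ.node s)
    rw [Γ.genEig_node hreg.1] at this
    simp only [planeWave, zero_mul, zero_add] at this
    rw [Pi.zero_apply]
    linear_combination this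
  have h3 : (fun s => ψ none (Γ.node s)) = 0 := by
    by_contra hne
    exact hD (Matrix.exists_mulVec_eq_zero_iff.1 ⟨_, hne, h2⟩)
  rintro (_ | s)
  · refine Eventually.of_forall fun x => ?_
    rw [he x, h3]
    simp [genEig, planeWave, kerSum]
  · refine (ae_restrict_iff' measurableSet_Ioo).2 (Eventually.of_forall fun x hx => ?_)
    rw [(h.tooth_eq hreg s).1 (Ioo_subset_Icc_self hx)]
    have : ψ none (Γ.node s) = 0 := congrFun h3 s
    simp [this]

/-! ### The resolvent -/

theorem hamiltonian_sub_smul_eq_iff (Γ : CombGraph N) (z : ℂ) (Φ Ψ : Γ.Space) :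
    (∃ hΨ : Ψ ∈ Γ.hamiltonian.domain, Γ.hamiltonian ⟨Ψ, hΨ⟩ - z • Ψ = Φ) ↔
      (Ψ, Φ + z • Ψ) ∈ Γ.hamiltonianGraph := by
  rw [← hamiltonian_graph, LinearPMap.mem_graph_iff]
  constructor
  · rintro ⟨hΨ, h⟩
    exact ⟨⟨Ψ, hΨ⟩, rfl, sub_eq_iff_eq_add.1 h⟩
  · rintro ⟨⟨y, hy⟩, h1, h2⟩
    obtain rfl : y = Ψ := h1
    exact ⟨hy, sub_eq_iff_eq_add.2 h2⟩

theorem eq_zero_of_mem_hamiltonianGraph {Γ : CombGraph N} (hN : 1 ≤ N) {k : ℂ} (hk : 0 < k.im)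
    (hreg : Γ.IsRegular k) (hD : Γ.combDet k ≠ 0) {Ψ : Γ.Space}
    (h : (Ψ, k ^ 2 • Ψ) ∈ Γ.hamiltonianGraph) : Ψ = 0 := by
  obtain ⟨ψ, hdom, h1, h2⟩ := h
  dsimp only at h1 h2
  have hgen : Γ.IsGenEigenfunction k ψ := by
    refine ⟨hdom, fun i => ?_⟩
    filter_upwards [h1 i, h2 i, Lp.coeFn_smul (k ^ 2) (Ψ i)] with x a b c
    rw [← b, ← a]
    exact c
  have h0 := hgen.eq_zero_of_memLp hN hk hreg hD ((memLp_congr_ae (h1 none)).1 (Lp.memLp (Ψ none)))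
  refine PiLp.ext fun i => Lp.ext ?_
  exact (h1 i).trans ((h0 i).trans (Lp.coeFn_zero _ _ _).symm)

theorem isResolvent_of_hasKernel {Γ : CombGraph N} (hN : 1 ≤ N) {k : ℂ} (hk : 0 < k.im)
    (hreg : Γ.IsRegular k) (hD : Γ.combDet k ≠ 0) {R : Γ.Space →L[ℂ] Γ.Space}
    (hR : Γ.HasKernel R (Γ.kreinKernel k)) : IsResolvent Γ.hamiltonian (k ^ 2) R := by
  have hdet : (Γ.coefMatrix k).det ≠ 0 := fun h => hD ((Γ.coefMatrix_det_eq_zero_iff hreg).1 h)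
  have key : ∀ Φ, (R Φ, Φ + k ^ 2 • R Φ) ∈ Γ.hamiltonianGraph := by
    intro Φ
    set φ : Option (Fin N) → ℝ → ℂ := fun j => Φ j with hφ
    set Λ := (Γ.kreinCoef k).mulVec (Γ.pairing k φ) with hΛ
    have hsys : (Γ.coefMatrix k).mulVec Λ = (Γ.coefRhs k).mulVec (Γ.pairing k φ) := by
      rw [hΛ, Matrix.mulVec_mulVec, (Γ.coefMatrix_mul_eq_iff hdet _).2 rfl]
    obtain ⟨hdom, hact⟩ := Γ.kreinFun_spec hk hreg (φ := φ) (fun i => Lp.memLp (Φ i)) hsys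
    have hrep : ∀ i, R Φ i =ᵐ[Γ.edgeMeasure i] Γ.kreinFun k φ Λ i := by
      intro i
      have hfree : ∀ᵐ x ∂(Γ.edgeMeasure i), ∀ j,
          Integrable (fun y => Γ.freeKernel k i j x y * Φ j y) (Γ.edgeMeasure j) := by
        refine ae_all_iff.2 fun j => ?_
        obtain ⟨T, hT⟩ := Γ.exists_isKernelOp_freeKernel hk i j
        filter_upwards [hT (Φ j)] with x hx
        exact hx.1
      filter_upwards [hR Φ i, hfree] with x hx h0
      rw [hx.2, Γ.kreinKernel_apply hk Φ i x h0]
    refine ⟨Γ.kreinFun k φ Λ, hdom, hrep, fun i => ?_⟩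
    filter_upwards [hact i, hrep i, Lp.coeFn_add (Φ i) (k ^ 2 • R Φ i),
      Lp.coeFn_smul (k ^ 2) (R Φ i)] with x a b c d
    refine Eq.trans c ?_
    rw [Pi.add_apply, d, Pi.smul_apply, smul_eq_mul, a, b]
    ring
  intro Φ Ψ
  rw [hamiltonian_sub_smul_eq_iff]
  constructor
  · rintro rfl
    exact key Φ
  · intro h
    -- Two solutions of (H - k²)Ψ = Φ differ by an eigenvector, and D_N ≠ 0 excludes eigenvectors.
    have h1 := Γ.hamiltonianGraph.sub_mem (key Φ) h
    have h2 : (R Φ, Φ + k ^ 2 • R Φ) - (Ψ, Φ + k ^ 2 • Ψ) =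
        (R Φ - Ψ, k ^ 2 • (R Φ - Ψ)) := by
      rw [Prod.mk_sub_mk, smul_sub]
      congr 1
      abel
    rw [h2] at h1
    exact sub_eq_zero.1 (eq_zero_of_mem_hamiltonianGraph hN hk hreg hD h1)

theorem exists_resolvent_kreinKernel {Γ : CombGraph N} (hN : 1 ≤ N) {k : ℂ} (hk : 0 < k.im)
    (hreg : Γ.IsRegular k) (hD : Γ.combDet k ≠ 0) : ∃ R : Γ.Space →L[ℂ] Γ.Space,
      IsResolvent Γ.hamiltonian (k ^ 2) R ∧ Γ.HasKernel R (Γ.kreinKernel k) := by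
  obtain ⟨R, hR⟩ := Γ.exists_hasKernel_kreinKernel hk
  exact ⟨R, isResolvent_of_hasKernel hN hk hreg hD hR, hR⟩

/-! ### The fully decoupled comb and the characterization of the resolvent set -/

theorem decoupled_isRegular {Γ : CombGraph N} {k : ℂ} (hreg : Γ.IsRegular k) :
    Γ.decoupled.IsRegular k := by
  refine ⟨hreg.1, fun s => ⟨(hreg.2 s).1, ?_⟩⟩
  change ((0 : ℝ) : ℂ) * Γ.uL' k s - Γ.uL k s 0 ≠ 0
  simpa using (hreg.2 s).1

theorem decoupled_combDet (Γ : CombGraph N) (k : ℂ) : Γ.decoupled.combDet k = 1 := by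
  have : Γ.decoupled.combMatrix k = 1 := by
    ext s n
    have hb : Γ.decoupled.beta k n = 0 := by
      simp [beta, effCoupling, decoupled]
    simp [combMatrix, hb, Matrix.one_apply]
  rw [combDet_eq, this, Matrix.det_one]

theorem decoupled_kreinKernel (Γ : CombGraph N) (k : ℂ) :
    Γ.decoupled.kreinKernel k = Γ.freeKernel k := by
  have h0 : Γ.decoupled.coefRhs k = 0 := by
    have : ∀ s, Γ.decoupled.b s = 0 ∧ Γ.decoupled.c s = 0 ∧ Γ.decoupled.d s = 0 :=
      fun s => ⟨rfl, rfl, rfl⟩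
    simp [coefRhs, this]
  have h1 : Γ.decoupled.kreinCoef k = 0 := by rw [kreinCoef, h0, mul_zero]
  funext i j x y
  rw [kreinKernel, h1]
  simp only [Matrix.zero_apply, zero_mul, Finset.sum_const_zero, add_zero]
  rfl

/-- A special case of the Krein formula: for zero couplings the right-hand side of the system
vanishes, so λ = 0, and D_N = 1. -/
theorem exists_resolvent_freeKernel {Γ : CombGraph N} (hN : 1 ≤ N) {k : ℂ} (hk : 0 < k.im)
    (hreg : Γ.IsRegular k) : ∃ R : Γ.decoupled.Space →L[ℂ] Γ.decoupled.Space,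
      IsResolvent Γ.decoupled.hamiltonian (k ^ 2) R ∧
        Γ.decoupled.HasKernel R (Γ.freeKernel k) := by
  rw [← decoupled_kreinKernel]
  exact exists_resolvent_kreinKernel hN hk (decoupled_isRegular hreg)
    (by rw [decoupled_combDet]; exact one_ne_zero)

theorem genEig_eq_kerSum (Γ : CombGraph N) (k : ℂ) (v : Fin N → ℂ) :
    Γ.genEig k 0 0 v none = Γ.kerSum k (fun n => -(2 * k * Γ.beta k n * v n)) := by
  funext x
  simp [genEig, planeWave]

theorem memLp_genEig (Γ : CombGraph N) {k : ℂ} (hk : 0 < k.im) (v : Fin N → ℂ)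
    (i : Option (Fin N)) : MemLp (Γ.genEig k 0 0 v i) 2 (Γ.edgeMeasure i) := by
  rcases i with _ | s
  · rw [genEig_eq_kerSum]
    exact Γ.memLp_kerSum hk _
  · exact (Γ.memLp_uL k s).const_mul _

/-- If D_N = 0, a null vector of `combMatrix` gives a square integrable eigenfunction. A resolvent
would force it to vanish almost everywhere, hence by continuity at the junctions, where its values
are the null vector. -/
theorem inResolventSet_iff {Γ : CombGraph N} (hN : 1 ≤ N) {k : ℂ} (hk : 0 < k.im)
    (hreg : Γ.IsRegular k) :
    InResolventSet Γ.hamiltonian (k ^ 2) ↔ Γ.combDet k ≠ 0 := by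
  constructor
  · rintro ⟨R, hR⟩ hD
    obtain ⟨v, hv, h0⟩ := Matrix.exists_mulVec_eq_zero_iff.2 ((Γ.combDet_eq k).symm.trans hD)
    have hnode : ∀ s, Γ.genEig k 0 0 v none (Γ.node s) = v s := fun s => by
      rw [Γ.genEig_node hreg.1, h0]
      simp [planeWave]
    obtain ⟨hdom, hact⟩ := Γ.genEig_isGenEigenfunction hreg 0 0 v hnode
    set Ψ : Γ.Space := WithLp.toLp 2 fun i => (Γ.memLp_genEig hk v i).toLp _ with hΨ
    have hrep : ∀ i, Ψ i =ᵐ[Γ.edgeMeasure i] Γ.genEig k 0 0 v i := fun i =>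
      (Γ.memLp_genEig hk v i).coeFn_toLp
    have hmem : (Ψ, 0 + k ^ 2 • Ψ) ∈ Γ.hamiltonianGraph := by
      refine ⟨Γ.genEig k 0 0 v, hdom, hrep, fun i => ?_⟩
      dsimp only
      rw [zero_add]
      filter_upwards [hact i, hrep i, Lp.coeFn_smul (k ^ 2) (Ψ i)] with x a b c
      refine Eq.trans c ?_
      rw [Pi.smul_apply, smul_eq_mul, a, b]
    have hz : Ψ = 0 := by
      rw [← (hR 0 Ψ).2 ((Γ.hamiltonian_sub_smul_eq_iff _ _ _).2 hmem), map_zero]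
    have h1 : Γ.genEig k 0 0 v none =ᵐ[volume] 0 := by
      refine (hrep none).symm.trans ?_
      rw [hz]
      exact Lp.coeFn_zero _ _ _
    have hc : Continuous (Γ.genEig k 0 0 v none) := by
      rw [genEig_eq_kerSum]
      unfold kerSum
      refine continuous_finsetSum _ fun n _ => continuous_const.mul ?_
      exact (continuous_lineKernel k).comp (Continuous.prodMk_left (Γ.node n))
    have h2 := (hc.ae_eq_iff_eq volume continuous_zero).1 h1
    refine hv (funext fun s => ?_)
    rw [← hnode s, h2]
    rfl
  · intro hD
    obtain ⟨R, hR, -⟩ := exists_resolvent_kreinKernel hN hk hreg hD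
    exact ⟨R, hR⟩

/-! ### Momenta with nonreal energy -/

theorem isRegular_of_im_ne_zero (Γ : CombGraph N) {k : ℂ} (hk : (k ^ 2).im ≠ 0) :
    Γ.IsRegular k := by
  refine ⟨?_, fun s => outerSol_ne_zero (Γ.L_pos s) (Γ.V_int s) hk (Γ.c s)⟩
  rintro rfl
  simp at hk

theorem differentiable_uL (Γ : CombGraph N) (s : Fin N) {x : ℝ} (hx : x ∈ Icc 0 (Γ.L s)) :
    Differentiable ℂ fun k => Γ.uL k s x :=
  ((tooth_solutions (Γ.L_pos s) (Γ.V_int s)).2.2.1 x hx).comp (differentiable_id.pow 2)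

theorem differentiable_u0 (Γ : CombGraph N) (s : Fin N) {x : ℝ} (hx : x ∈ Icc 0 (Γ.L s)) :
    Differentiable ℂ fun k => Γ.u0 k s x :=
  ((tooth_solutions (Γ.L_pos s) (Γ.V_int s)).2.2.2.1 x hx).comp (differentiable_id.pow 2)

theorem differentiable_uL' (Γ : CombGraph N) (s : Fin N) :
    Differentiable ℂ fun k => Γ.uL' k s :=
  (tooth_solutions (Γ.L_pos s) (Γ.V_int s)).2.2.2.2.comp (differentiable_id.pow 2)

theorem _root_.Differentiable.eventually_punctured_ne_zero {f : ℂ → ℂ} (hf : Differentiable ℂ f)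
    {k₁ : ℂ} (h1 : f k₁ ≠ 0) (k₀ : ℂ) : ∀ᶠ k in 𝓝[≠] k₀, f k ≠ 0 := by
  by_contra h
  have h2 : ∃ᶠ k in 𝓝[≠] k₀, f k = 0 := h
  -- Identity theorem: zeros accumulating at k₀ would make f vanish at the witness `k₁`.
  have := (hf.differentiableOn.analyticOnNhd isOpen_univ).eqOn_zero_of_preconnected_of_frequently_eq_zero
    isPreconnected_univ (mem_univ k₀) h2
  exact h1 (this (mem_univ k₁))

theorem one_add_I_sq_im : ((1 + Complex.I) ^ 2).im ≠ 0 := by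
  simp [pow_two]

theorem eventually_isRegular (Γ : CombGraph N) (k₀ : ℂ) : ∀ᶠ k in 𝓝[≠] k₀, Γ.IsRegular k := by
  -- The reference momentum 1 + i has energy 2i, so every entire function in the definition of
  -- regularity is nonzero there.
  have hreg := Γ.isRegular_of_im_ne_zero one_add_I_sq_im
  refine (differentiable_id.eventually_punctured_ne_zero (k₁ := 1) one_ne_zero k₀).and
    (eventually_all.2 fun s => ?_)
  have h0 := left_mem_Icc.2 (Γ.L_pos s).le
  exact ((Γ.differentiable_uL s h0).eventually_punctured_ne_zero (hreg.2 s).1 k₀).and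
    ((((Γ.differentiable_uL' s).const_mul (Γ.c s : ℂ)).sub
      (Γ.differentiable_uL s h0)).eventually_punctured_ne_zero (hreg.2 s).2 k₀)

open ComplexConjugate in
/-- The flux of a solution of `-u'' = z u` across an interval. -/
theorem IsSol.flux {z : ℂ} {u u₁ : ℝ → ℂ} {a b : ℝ} (hab : a ≤ b)
    (h : IsSol (fun _ => -z) u u₁ a b) : ∃ I : ℝ, 0 ≤ I ∧
      (conj (u b) * u₁ b).im = (conj (u a) * u₁ a).im - z.im * I := by
  have hc := h.clm (Complex.conjCLE : ℂ →L[ℝ] ℂ)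
  have e := (AC2Data.wronskian hab h hc).eq_integral hab (right_mem_Icc.2 hab)
  simp only [ContinuousLinearEquiv.coe_coe, Complex.conjCLE_apply] at e
  have hint : ∫ t in a..b, (u t * conj (-z * u t) - -z * u t * conj (u t)) =
      ∫ t in a..b, 2 * Complex.I * z.im * ((Complex.normSq (u t) : ℝ) : ℂ) := by
    congr 1
    ext t
    rw [← Complex.mul_conj, map_mul, map_neg]
    have : z - conj z = 2 * Complex.I * z.im := by
      rw [Complex.sub_conj]
      push_cast
      ring
    rw [← this]
    ring
  rw [hint, intervalIntegral.integral_const_mul, intervalIntegral.integral_ofReal] at e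
  refine ⟨∫ t in a..b, Complex.normSq (u t),
    intervalIntegral.integral_nonneg hab fun x _ => Complex.normSq_nonneg _, ?_⟩
  have e2 := congrArg Complex.im e
  simp only [Complex.add_im, Complex.sub_im, Complex.mul_im, Complex.mul_re, Complex.conj_re,
    Complex.conj_im, Complex.ofReal_re, Complex.ofReal_im, Complex.I_re, Complex.I_im,
    Complex.re_ofNat, Complex.im_ofNat] at e2 ⊢
  linarith

-- The teeth absorb flux with a definite sign. In 2kβ the coupling d is real, the term with c
-- contributes c|u_L'|², also real, and the rest is governed by the Lagrange identity on the tooth.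
open ComplexConjugate in
theorem im_two_mul_beta (Γ : CombGraph N) {k : ℂ} (hreg : Γ.IsRegular k) (s : Fin N) :
    ∃ I : ℝ, 0 ≤ I ∧ (2 * k * Γ.beta k s).im = -(k ^ 2).im * I := by
  obtain ⟨I, hI, h⟩ := outerSol_lagrange (Γ.L_pos s) (Γ.V_int s) (k ^ 2)
  change (conj (Γ.uL k s 0) * Γ.uL' k s).im = _ at h
  set w := (Γ.c s : ℂ) * Γ.uL' k s - Γ.uL k s 0 with hw
  have hw0 : w ≠ 0 := (hreg.2 s).2
  have hn : 0 < Complex.normSq w := Complex.normSq_pos.2 hw0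
  refine ⟨Γ.b s ^ 2 * I / Complex.normSq w, by positivity, ?_⟩
  have e : 2 * k * Γ.beta k s = Γ.d s + ((Γ.b s ^ 2 / Complex.normSq w : ℝ) : ℂ) *
      (conj w * Γ.uL' k s) := by
    rw [Γ.two_mul_beta hreg.1, toothAmp, ← hw]
    push_cast
    rw [← Complex.mul_conj]
    have : conj w ≠ 0 := by simpa using hw0
    field_simp
    ring
  rw [e, Complex.add_im, Complex.ofReal_im, Complex.im_ofReal_mul, zero_add]
  have e2 : (conj w * Γ.uL' k s).im = -(k ^ 2).im * I := by
    rw [neg_mul, ← h, hw, map_sub, map_mul, Complex.conj_ofReal]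
    simp only [Complex.sub_im, Complex.mul_im, Complex.sub_re, Complex.mul_re, Complex.conj_re,
      Complex.conj_im, Complex.ofReal_re, Complex.ofReal_im]
    ring
  rw [e2]
  ring

/-- A null vector v yields a superposition F of outgoing kernels with F(x_s) = v_s. The flux J =
Im(conj(F) F'), multiplied by Im(k²), is nonincreasing to the right, along cells as well as across
junctions. The outgoing form makes this product nonpositive at the left end and nonnegative at the
right end, so the end values vanish. The argument is pointwise and uses no integration by parts on
the whole line. -/
theorem combDet_ne_zero_of_im_ne_zero {Γ : CombGraph N} (hN : 1 ≤ N) {k : ℂ} (hk : 0 < k.im)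
    (hk2 : (k ^ 2).im ≠ 0) : Γ.combDet k ≠ 0 := by
  have hreg := Γ.isRegular_of_im_ne_zero hk2
  have hℓ := Γ.ℓ_pos
  rw [combDet_eq]
  intro hD
  obtain ⟨v, hv, hv0⟩ := Matrix.exists_mulVec_eq_zero_iff.2 hD
  set μ : Fin N → ℂ := fun n => -(2 * k * Γ.beta k n * v n) with hμ
  set F := Γ.kerSum k μ with hF
  have hFv : ∀ s, F (Γ.node s) = v s := fun s => by
    have := Γ.genEig_node hreg.1 0 0 v s
    rw [genEig_eq_kerSum, hv0] at this
    rw [hF, this]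
    simp [planeWave]
  set dp : Fin N → ℂ := fun s => Γ.kerSumDeriv k μ (Γ.node s) (Γ.node s) with hdp
  set dm : Fin N → ℂ := fun s => Γ.kerSumDeriv k μ (Γ.node s - Γ.ℓ) (Γ.node s) with hdm
  have hjump : ∀ s, dp s = dm s + 2 * k * Γ.beta k s * v s := fun s => by
    have := Γ.kerSumDeriv_jump hreg.1 μ s
    simp only [hdp, hdm]
    linear_combination this
  have hnode : ∀ n (hn : n + 1 < N), Γ.node ⟨n + 1, hn⟩ = Γ.node ⟨n, by omega⟩ + Γ.ℓ :=
    fun n hn => by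
      simp only [node]
      push_cast
      ring
  have hcell : ∀ n (hn : n + 1 < N), IsSol (fun _ => -k ^ 2) F
      (Γ.kerSumDeriv k μ (Γ.node ⟨n, by omega⟩)) (Γ.node ⟨n, by omega⟩) (Γ.node ⟨n + 1, hn⟩) :=
    fun n hn => by
      rw [hnode]
      exact isSol_kerSum Γ k μ (by linarith) (Γ.nodeFree_right _)
  have hdm' : ∀ n (hn : n + 1 < N), dm ⟨n + 1, hn⟩ =
      Γ.kerSumDeriv k μ (Γ.node ⟨n, by omega⟩) (Γ.node ⟨n + 1, hn⟩) := fun n hn => by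
    have e : Γ.node ⟨n + 1, hn⟩ - Γ.ℓ = Γ.node ⟨n, by omega⟩ := by
      rw [hnode]
      ring
    simp only [hdm, e]
  have h0N : 0 < N := hN
  -- To the left of all junctions F is a multiple of e^(-ikx); to the right of the last one, a
  -- multiple of e^(ikx).
  have hfirst : dm ⟨0, h0N⟩ = -(Complex.I * k) * v ⟨0, h0N⟩ := by
    rw [← hFv]
    simp only [hdm, hF, kerSumDeriv, kerSum, Finset.mul_sum]
    refine Finset.sum_congr rfl fun n _ => ?_
    have h1 : Γ.node ⟨0, h0N⟩ ≤ Γ.node n := Γ.node_mono (Fin.le_def.2 (Nat.zero_le _))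
    rw [lineKernelDeriv, if_neg (by linarith), lineKernel_of_ge h1]
    ring
  have hlast : dp ⟨N - 1, by omega⟩ = Complex.I * k * v ⟨N - 1, by omega⟩ := by
    rw [← hFv]
    simp only [hdp, hF, kerSumDeriv, kerSum, Finset.mul_sum]
    refine Finset.sum_congr rfl fun n _ => ?_
    have h1 : Γ.node n ≤ Γ.node ⟨N - 1, by omega⟩ := Γ.node_mono (Fin.le_def.2 (by
      have := n.2
      simp only
      omega))
    rw [lineKernelDeriv, if_pos h1, lineKernel_of_le h1]
    ring
  set J : ℂ → ℂ → ℝ := fun a b => (starRingEnd ℂ a * b).im with hJ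
  have hJp : ∀ s, (k ^ 2).im * J (v s) (dp s) ≤ (k ^ 2).im * J (v s) (dm s) := fun s => by
    obtain ⟨I, hI, h⟩ := Γ.im_two_mul_beta hreg s
    have e : J (v s) (dp s) = J (v s) (dm s) + Complex.normSq (v s) * (2 * k * Γ.beta k s).im := by
      simp only [hJ]
      rw [hjump, mul_add, Complex.add_im, ← Complex.im_ofReal_mul, ← Complex.mul_conj]
      congr 2
      ring
    rw [e, h]
    have : 0 ≤ (k ^ 2).im ^ 2 * Complex.normSq (v s) * I :=
      mul_nonneg (mul_nonneg (sq_nonneg _) (Complex.normSq_nonneg _)) hI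
    nlinarith
  have hJm : ∀ n (hn : n < N), (k ^ 2).im * J (v ⟨n, hn⟩) (dm ⟨n, hn⟩) ≤
      (k ^ 2).im * J (v ⟨0, h0N⟩) (dm ⟨0, h0N⟩) := by
    intro n
    induction n with
    | zero => exact fun _ => le_rfl
    | succ n ih =>
      intro hn
      obtain ⟨I, hI, h⟩ := (hcell n hn).flux (by rw [hnode]; linarith)
      rw [hFv, hFv, ← hdm'] at h
      refine le_trans ?_ ((hJp _).trans (ih (by omega)))
      simp only [hJ]
      rw [h]
      have := mul_nonneg (sq_nonneg (k ^ 2).im) hI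
      simp only [hdp]
      nlinarith
  -- The flux is -Re k |v|² at the left end and Re k |v|² at the right end. With Im(k²) = 2 Re k Im
  -- k, monotonicity gives 2(Re k)² Im k times the sum of the two squared moduli ≤ 0.
  have hv00 : v ⟨0, h0N⟩ = 0 := by
    have h1 := (hJp ⟨N - 1, by omega⟩).trans (hJm (N - 1) (by omega))
    rw [hlast, hfirst] at h1
    have e : ∀ a : ℂ, J a (Complex.I * k * a) = k.re * Complex.normSq a := fun a => by
      simp only [hJ]
      rw [mul_comm, mul_assoc, Complex.mul_conj, mul_comm _ ((Complex.normSq a : ℝ) : ℂ),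
        Complex.im_ofReal_mul]
      simp
      ring
    have e' : ∀ a : ℂ, J a (-(Complex.I * k) * a) = -(k.re * Complex.normSq a) := fun a => by
      rw [← e]
      simp only [hJ]
      rw [neg_mul, mul_neg, Complex.neg_im]
    rw [e, e'] at h1
    have e3 : (k ^ 2).im = 2 * k.re * k.im := by
      rw [pow_two, Complex.mul_im]
      ring
    have hre : k.re ≠ 0 := by
      intro h
      rw [e3, h] at hk2
      simp at hk2
    rw [e3] at h1
    have h2 := Complex.normSq_nonneg (v ⟨N - 1, by omega⟩)
    have h3 := Complex.normSq_nonneg (v ⟨0, h0N⟩)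
    have hp : 0 < 2 * k.re ^ 2 * k.im := by positivity
    have h4 : 2 * k.re ^ 2 * k.im * (Complex.normSq (v ⟨N - 1, by omega⟩) +
        Complex.normSq (v ⟨0, h0N⟩)) ≤ 0 := by linarith
    have h5 := nonpos_of_mul_nonpos_right h4 hp
    exact Complex.normSq_eq_zero.1 (by linarith)
  -- Vanishing Cauchy data at the first junction are carried to the next ones: a junction with v = 0
  -- causes no jump, and the free equation propagates zero.
  have hall : ∀ n (hn : n < N), v ⟨n, hn⟩ = 0 ∧ dm ⟨n, hn⟩ = 0 := by
    intro n
    induction n with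
    | zero => exact fun _ => ⟨hv00, by rw [hfirst, hv00, mul_zero]⟩
    | succ n ih =>
      intro hn
      obtain ⟨h1, h2⟩ := ih (by omega)
      have hlt : Γ.node ⟨n, by omega⟩ < Γ.node ⟨n + 1, hn⟩ := by
        rw [hnode]
        linarith
      have h3 : dp ⟨n, by omega⟩ = 0 := by rw [hjump, h1, h2, mul_zero, add_zero]
      have h4 : EqOn (fun _ => 0) F (Icc (Γ.node ⟨n, by omega⟩) (Γ.node ⟨n + 1, hn⟩)) :=
        fun x hx => (isSol_free_eq_zero hreg.1 hlt.le (hcell n hn) (left_mem_Icc.2 hlt.le)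
          ((hFv _).trans h1) h3 x hx).symm
      refine ⟨by rw [← hFv, ← h4 (right_mem_Icc.2 hlt.le)], ?_⟩
      rw [hdm', ← ((hcell n hn).congr h4).leftDeriv hlt, CombGraph.leftDeriv,
        derivWithin_fun_const]
      rfl
  exact hv (funext fun s => (hall s s.2).1)

/-! ### Meromorphic functions of the momentum -/

/-- Reduces questions about poles to punctured limits. The value at k itself plays no role, which
matters because inverses of singular matrices and the chosen S-matrix have arbitrary values there.
-/
theorem not_hasPoleAt_iff {f : ℂ → ℂ} {k : ℂ} (hf : MeromorphicAt f k) :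
    ¬HasPoleAt f k ↔ ∃ c, Tendsto f (𝓝[≠] k) (𝓝 c) := by
  rw [tendsto_nhds_iff_meromorphicOrderAt_nonneg hf, HasPoleAt]
  simp [hf]

theorem _root_.ContinuousAt.exists_tendsto_punctured {f : ℂ → ℂ} {k : ℂ} (hf : ContinuousAt f k) :
    ∃ c, Tendsto f (𝓝[≠] k) (𝓝 c) :=
  ⟨_, hf.tendsto.mono_left nhdsWithin_le_nhds⟩

/-- Finiteness of the order spreads over the connected plane. Continuity at the witness is
essential, since a meromorphic function may be altered at a single point. -/
theorem _root_.Meromorphic.eventually_punctured_ne_zero {f : ℂ → ℂ} (hf : Meromorphic f) {k₁ : ℂ}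
    (hc : ContinuousAt f k₁) (h1 : f k₁ ≠ 0) (k₀ : ℂ) : ∀ᶠ k in 𝓝[≠] k₀, f k ≠ 0 := by
  have h2 : meromorphicOrderAt f k₁ ≠ ⊤ :=
    (meromorphicOrderAt_ne_top_iff_eventually_ne_zero (hf k₁)).2
      (nhdsWithin_le_nhds (hc.eventually_ne h1))
  exact (meromorphicOrderAt_ne_top_iff_eventually_ne_zero (hf k₀)).1
    ((hf.meromorphicOn (s := univ)).meromorphicOrderAt_ne_top_of_isPreconnected
      isPreconnected_univ (mem_univ k₁) (mem_univ k₀) h2)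

theorem _root_.MeromorphicAt.matrix_det {n : Type*} [Fintype n] [DecidableEq n]
    {M : ℂ → Matrix n n ℂ} {k : ℂ} (h : ∀ i j, MeromorphicAt (fun k => M k i j) k) :
    MeromorphicAt (fun k => (M k).det) k := by
  simp only [Matrix.det_apply']
  refine MeromorphicAt.fun_sum fun σ _ => (MeromorphicAt.const _ _).mul ?_
  exact MeromorphicAt.fun_prod fun i _ => h _ _

theorem _root_.MeromorphicAt.matrix_inv {n : Type*} [Fintype n] [DecidableEq n]
    {M : ℂ → Matrix n n ℂ} {k : ℂ} (h : ∀ i j, MeromorphicAt (fun k => M k i j) k) (i j : n) :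
    MeromorphicAt (fun k => (M k)⁻¹ i j) k := by
  simp only [Matrix.inv_def, Ring.inverse_eq_inv', Matrix.smul_apply, smul_eq_mul,
    Matrix.adjugate_apply]
  refine (MeromorphicAt.matrix_det h).inv.mul (MeromorphicAt.matrix_det fun a b => ?_)
  by_cases hab : a = j
  · subst hab
    simp only [Matrix.updateRow_self]
    exact MeromorphicAt.const _ _
  · simp only [Matrix.updateRow_ne hab]
    exact h a b

theorem _root_.ContinuousAt.matrix_det' {n : Type*} [Fintype n] [DecidableEq n]
    {M : ℂ → Matrix n n ℂ} {k : ℂ} (h : ∀ i j, ContinuousAt (fun k => M k i j) k) :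
    ContinuousAt (fun k => (M k).det) k :=
  (continuous_id.matrix_det (n := n) (R := ℂ)).continuousAt.comp
    (continuousAt_pi.2 fun i => continuousAt_pi.2 fun j => h i j)

theorem _root_.ContinuousAt.matrix_inv {n : Type*} [Fintype n] [DecidableEq n]
    {M : ℂ → Matrix n n ℂ} {k : ℂ} (h : ∀ i j, ContinuousAt (fun k => M k i j) k)
    (hd : (M k).det ≠ 0) (i j : n) : ContinuousAt (fun k => (M k)⁻¹ i j) k := by
  simp only [Matrix.inv_def, Ring.inverse_eq_inv', Matrix.smul_apply, smul_eq_mul]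
  refine ((ContinuousAt.matrix_det' h).inv₀ hd).mul ?_
  have h1 : ContinuousAt (fun k => (M k).adjugate) k :=
    (continuous_id.matrix_adjugate (n := n) (R := ℂ)).continuousAt.comp
      (continuousAt_pi.2 fun i => continuousAt_pi.2 fun j => h i j)
  exact continuousAt_pi.1 (continuousAt_pi.1 h1 i) j

theorem meromorphic_of_differentiable {f : ℂ → ℂ} (hf : Differentiable ℂ f) : Meromorphic f :=
  fun k => (hf.analyticAt k).meromorphicAt

theorem differentiable_epsPow (Γ : CombGraph N) (s n : Fin N) :
    Differentiable ℂ fun k => Γ.epsPow k s n := by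
  unfold epsPow eps
  fun_prop

theorem coefMatrix_meromorphic (Γ : CombGraph N) (i j : Fin N ⊕ Fin N) :
    Meromorphic fun k => Γ.coefMatrix k i j := by
  intro k
  have hu := fun s => meromorphic_of_differentiable
    (Γ.differentiable_uL s (left_mem_Icc.2 (Γ.L_pos s).le)) k
  have hu' := fun s => meromorphic_of_differentiable (Γ.differentiable_uL' s) k
  have he := fun s n => meromorphic_of_differentiable (Γ.differentiable_epsPow s n) k
  have hk := meromorphic_of_differentiable (f := fun k => 2 * k) (by fun_prop) k
  rcases i with s | s <;> rcases j with n | n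
  · exact ((MeromorphicAt.const _ _).div hk).mul (he s n)
  · by_cases h : s = n
    · subst h
      simp only [coefMatrix, Matrix.fromBlocks_apply₁₂, Matrix.diagonal_apply_eq]
      exact ((MeromorphicAt.const _ _).mul (hu' s)).sub (hu s)
    · simp only [coefMatrix, Matrix.fromBlocks_apply₁₂, Matrix.diagonal_apply_ne _ h]
      exact MeromorphicAt.const _ _
  · exact (((MeromorphicAt.const _ _).div hk).mul (he s n)).add (MeromorphicAt.const _ _)
  · by_cases h : s = n
    · subst h
      simp only [coefMatrix, Matrix.fromBlocks_apply₂₂, Matrix.diagonal_apply_eq]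
      exact (MeromorphicAt.const _ _).mul (hu' s)
    · simp only [coefMatrix, Matrix.fromBlocks_apply₂₂, Matrix.diagonal_apply_ne _ h]
      exact MeromorphicAt.const _ _

theorem coefMatrix_continuousAt (Γ : CombGraph N) {k : ℂ} (hk0 : k ≠ 0) (i j : Fin N ⊕ Fin N) :
    ContinuousAt (fun k => Γ.coefMatrix k i j) k := by
  have hu := fun s => (Γ.differentiable_uL s (left_mem_Icc.2 (Γ.L_pos s).le)).continuous.continuousAt
    (x := k)
  have hu' := fun s => (Γ.differentiable_uL' s).continuous.continuousAt (x := k)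
  have he := fun s n => (Γ.differentiable_epsPow s n).continuous.continuousAt (x := k)
  have hk : ContinuousAt (fun k : ℂ => 2 * k) k := by fun_prop
  have hk2 : 2 * k ≠ 0 := by simpa using hk0
  rcases i with s | s <;> rcases j with n | n
  · exact (continuousAt_const.div hk hk2).mul (he s n)
  · by_cases h : s = n
    · subst h
      simp only [coefMatrix, Matrix.fromBlocks_apply₁₂, Matrix.diagonal_apply_eq]
      exact (continuousAt_const.mul (hu' s)).sub (hu s)
    · simp only [coefMatrix, Matrix.fromBlocks_apply₁₂, Matrix.diagonal_apply_ne _ h]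
      exact continuousAt_const
  · exact ((continuousAt_const.div hk hk2).mul (he s n)).add continuousAt_const
  · by_cases h : s = n
    · subst h
      simp only [coefMatrix, Matrix.fromBlocks_apply₂₂, Matrix.diagonal_apply_eq]
      exact continuousAt_const.mul (hu' s)
    · simp only [coefMatrix, Matrix.fromBlocks_apply₂₂, Matrix.diagonal_apply_ne _ h]
      exact continuousAt_const

theorem coefRhs_meromorphic (Γ : CombGraph N) (i j : Fin N ⊕ Fin N) :
    Meromorphic fun k => Γ.coefRhs k i j := by
  intro k
  have hu := fun s => meromorphic_of_differentiable
    (Γ.differentiable_uL s (left_mem_Icc.2 (Γ.L_pos s).le)) k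
  rcases i with s | s <;> rcases j with n | n
  · exact MeromorphicAt.const _ _
  · by_cases h : s = n
    · subst h
      simp only [coefRhs, Matrix.fromBlocks_apply₁₂, Matrix.diagonal_apply_eq]
      exact (MeromorphicAt.const _ _).div (hu s)
    · simp only [coefRhs, Matrix.fromBlocks_apply₁₂, Matrix.diagonal_apply_ne _ h]
      exact MeromorphicAt.const _ _
  · exact MeromorphicAt.const _ _
  · by_cases h : s = n
    · subst h
      simp only [coefRhs, Matrix.fromBlocks_apply₂₂, Matrix.diagonal_apply_eq]
      exact (MeromorphicAt.const _ _).div (hu s)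
    · simp only [coefRhs, Matrix.fromBlocks_apply₂₂, Matrix.diagonal_apply_ne _ h]
      exact MeromorphicAt.const _ _

theorem coefRhs_continuousAt (Γ : CombGraph N) {k : ℂ} (hreg : Γ.IsRegular k)
    (i j : Fin N ⊕ Fin N) : ContinuousAt (fun k => Γ.coefRhs k i j) k := by
  have hu := fun s => (Γ.differentiable_uL s (left_mem_Icc.2 (Γ.L_pos s).le)).continuous.continuousAt
    (x := k)
  rcases i with s | s <;> rcases j with n | n
  · exact continuousAt_const
  · by_cases h : s = n
    · subst h
      simp only [coefRhs, Matrix.fromBlocks_apply₁₂, Matrix.diagonal_apply_eq]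
      exact continuousAt_const.div (hu s) (hreg.2 s).1
    · simp only [coefRhs, Matrix.fromBlocks_apply₁₂, Matrix.diagonal_apply_ne _ h]
      exact continuousAt_const
  · exact continuousAt_const
  · by_cases h : s = n
    · subst h
      simp only [coefRhs, Matrix.fromBlocks_apply₂₂, Matrix.diagonal_apply_eq]
      exact continuousAt_const.div (hu s) (hreg.2 s).1
    · simp only [coefRhs, Matrix.fromBlocks_apply₂₂, Matrix.diagonal_apply_ne _ h]
      exact continuousAt_const

/-! ### Poles of the Krein coefficients -/

theorem kreinCoef_meromorphic (Γ : CombGraph N) (m n : Fin N ⊕ Fin N) :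
    Meromorphic fun k => Γ.kreinCoef k m n := by
  intro k
  simp only [kreinCoef, Matrix.mul_apply]
  exact MeromorphicAt.fun_sum fun i _ =>
    (MeromorphicAt.matrix_inv (fun a b => Γ.coefMatrix_meromorphic a b k) m i).mul
      (Γ.coefRhs_meromorphic i n k)

theorem kreinCoef_continuousAt (Γ : CombGraph N) {k : ℂ} (hreg : Γ.IsRegular k)
    (hD : Γ.combDet k ≠ 0) (m n : Fin N ⊕ Fin N) :
    ContinuousAt (fun k => Γ.kreinCoef k m n) k := by
  have hdet : (Γ.coefMatrix k).det ≠ 0 := fun h => hD ((Γ.coefMatrix_det_eq_zero_iff hreg).1 h)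
  simp only [kreinCoef, Matrix.mul_apply]
  exact tendsto_finsetSum _ fun i _ =>
    (ContinuousAt.matrix_inv (fun a b => Γ.coefMatrix_continuousAt hreg.1 a b) hdet m i).mul
      (Γ.coefRhs_continuousAt hreg i n)

theorem one_add_I_im_pos : 0 < (1 + Complex.I).im := by simp

theorem eventually_coefMatrix_det_ne_zero (Γ : CombGraph N) (hN : 1 ≤ N) (k₀ : ℂ) :
    ∀ᶠ k in 𝓝[≠] k₀, (Γ.coefMatrix k).det ≠ 0 := by
  have hreg := Γ.isRegular_of_im_ne_zero one_add_I_sq_im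
  refine Meromorphic.eventually_punctured_ne_zero (k₁ := 1 + Complex.I)
    (fun k => MeromorphicAt.matrix_det fun a b => Γ.coefMatrix_meromorphic a b k)
    (ContinuousAt.matrix_det' fun a b => Γ.coefMatrix_continuousAt hreg.1 a b) ?_ k₀
  exact fun h => combDet_ne_zero_of_im_ne_zero hN one_add_I_im_pos one_add_I_sq_im
    ((Γ.coefMatrix_det_eq_zero_iff hreg).1 h)

theorem eventually_combDet_ne_zero (Γ : CombGraph N) (hN : 1 ≤ N) (k₀ : ℂ) :
    ∀ᶠ k in 𝓝[≠] k₀, Γ.IsRegular k ∧ Γ.combDet k ≠ 0 := by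
  filter_upwards [Γ.eventually_isRegular k₀, Γ.eventually_coefMatrix_det_ne_zero hN k₀] with k h1 h2
  exact ⟨h1, fun h => h2 ((Γ.coefMatrix_det_eq_zero_iff h1).2 h)⟩

/-- The linear system has no solution where its determinant vanishes. -/
theorem coefMatrix_mul_ne_coefRhs (Γ : CombGraph N) {k : ℂ} (hreg : Γ.IsRegular k)
    (hdet : (Γ.coefMatrix k).det = 0) (M : Matrix (Fin N ⊕ Fin N) (Fin N ⊕ Fin N) ℂ) :
    Γ.coefMatrix k * M ≠ Γ.coefRhs k := by
  intro hM
  -- A left null vector of the matrix must annihilate the right-hand side of a solvable system. The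
  -- resulting relations `r1`, `r2` eliminate b, c, d from the columns of w · `coefMatrix`: the
  -- tooth columns leave w u_L(0) = 0 and the line columns then leave w = 0.
  obtain ⟨w, hw, h0⟩ := Matrix.exists_vecMul_eq_zero_iff.2 hdet
  have h1 : Matrix.vecMul w (Γ.coefRhs k) = 0 := by
    rw [← hM, ← Matrix.vecMul_vecMul, h0, Matrix.zero_vecMul]
  have r1 : ∀ s, Γ.b s * w (Sum.inl s) + Γ.d s * w (Sum.inr s) = 0 := fun s => by
    have := congrFun h1 (Sum.inl s)
    simp [coefRhs, Matrix.vecMul, dotProduct, Fintype.sum_sum_type, Matrix.diagonal_apply] at this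
    linear_combination -this
  have r2 : ∀ s, Γ.c s * w (Sum.inl s) = Γ.b s * w (Sum.inr s) := fun s => by
    have := congrFun h1 (Sum.inr s)
    simp [coefRhs, Matrix.vecMul, dotProduct, Fintype.sum_sum_type, Matrix.diagonal_apply] at this
    have hu := (hreg.2 s).1
    field_simp at this
    linear_combination -this
  have r3 : ∀ s, w (Sum.inl s) = 0 := fun s => by
    have := congrFun h0 (Sum.inr s)
    simp [coefMatrix, Matrix.vecMul, dotProduct, Fintype.sum_sum_type,
      Matrix.diagonal_apply] at this
    have e : w (Sum.inl s) * Γ.uL k s 0 = 0 := by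
      linear_combination -this + Γ.uL' k s * r2 s
    exact (mul_eq_zero.1 e).resolve_right (hreg.2 s).1
  have r4 : ∀ s, w (Sum.inr s) = 0 := fun n => by
    have := congrFun h0 (Sum.inl n)
    simp only [coefMatrix, Matrix.vecMul, dotProduct, Fintype.sum_sum_type,
      Matrix.fromBlocks_apply₁₁, Matrix.fromBlocks_apply₂₁, Matrix.of_apply, mul_add, mul_ite,
      mul_one, mul_zero, Finset.sum_add_distrib, Finset.sum_ite_eq', Finset.mem_univ, if_true,
      ← add_assoc, Pi.zero_apply] at this
    rw [← Finset.sum_add_distrib, Finset.sum_eq_zero, zero_add] at this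
    · exact this
    · intro s _
      linear_combination (Complex.I / (2 * k) * Γ.epsPow k s n) * r1 s
  refine hw (funext fun i => ?_)
  rcases i with s | s
  · exact r3 s
  · exact r4 s

/-- The system holds for nearby k' ≠ k and passes to the limit, so the limits of the coefficients
would solve it at k; but it is unsolvable where the determinant vanishes. -/
theorem combDet_ne_zero_of_tendsto {Γ : CombGraph N} (hN : 1 ≤ N) {k : ℂ} (hreg : Γ.IsRegular k)
    (h : ∀ m n, ∃ c, Tendsto (fun k' => Γ.kreinCoef k' m n) (𝓝[≠] k) (𝓝 c)) :
    Γ.combDet k ≠ 0 := by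
  intro hD
  choose M hM using h
  refine Γ.coefMatrix_mul_ne_coefRhs hreg ((Γ.coefMatrix_det_eq_zero_iff hreg).2 hD)
    (Matrix.of M) ?_
  ext i j
  have t1 : Tendsto (fun k' => (Γ.coefMatrix k' * Γ.kreinCoef k') i j) (𝓝[≠] k)
      (𝓝 ((Γ.coefMatrix k * Matrix.of M) i j)) := by
    simp only [Matrix.mul_apply, Matrix.of_apply]
    exact tendsto_finsetSum _ fun l _ =>
      ((Γ.coefMatrix_continuousAt hreg.1 i l).tendsto.mono_left nhdsWithin_le_nhds).mul (hM l j)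
  have t2 : Tendsto (fun k' => Γ.coefRhs k' i j) (𝓝[≠] k) (𝓝 (Γ.coefRhs k i j)) :=
    (Γ.coefRhs_continuousAt hreg i j).tendsto.mono_left nhdsWithin_le_nhds
  refine tendsto_nhds_unique (t1.congr' ?_) t2
  filter_upwards [Γ.eventually_coefMatrix_det_ne_zero hN k] with k' hk'
  rw [(Γ.coefMatrix_mul_eq_iff hk' _).2 rfl]

theorem exists_kreinCoef_pole_iff {Γ : CombGraph N} (hN : 1 ≤ N) {k : ℂ} (hreg : Γ.IsRegular k) :
    (∃ m n, HasPoleAt (fun k' => Γ.kreinCoef k' m n) k) ↔ Γ.combDet k = 0 := by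
  constructor
  · rintro ⟨m, n, h⟩
    by_contra hD
    exact (not_hasPoleAt_iff (Γ.kreinCoef_meromorphic m n k)).2
      (ContinuousAt.exists_tendsto_punctured (Γ.kreinCoef_continuousAt hreg hD m n)) h
  · intro hD
    by_contra h
    push Not at h
    exact combDet_ne_zero_of_tendsto hN hreg
      (fun m n => (not_hasPoleAt_iff (Γ.kreinCoef_meromorphic m n k)).1 (h m n)) hD

/-! ### The continued resolvent kernel -/

theorem lineKernel_meromorphic (x y : ℝ) : Meromorphic fun k => lineKernel k x y := fun k => by
  unfold lineKernel
  exact ((MeromorphicAt.const _ _).div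
    (meromorphic_of_differentiable (f := fun k => 2 * k) (by fun_prop) k)).mul
    (meromorphic_of_differentiable (by fun_prop) k)

theorem lineKernel_continuousAt {k : ℂ} (hk : k ≠ 0) (x y : ℝ) :
    ContinuousAt (fun k => lineKernel k x y) k := by
  unfold lineKernel
  exact (continuousAt_const.div (by fun_prop) (by simpa using hk)).mul (by fun_prop)

theorem toothKernel_eq' (Γ : CombGraph N) (s : Fin N) (k : ℂ) (x y : ℝ) :
    toothKernel (Γ.V s) (Γ.L s) k x y =
      (Γ.uL k s 0)⁻¹ * (Γ.u0 k s (min x y) * Γ.uL k s (max x y)) :=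
  toothKernel_eq (Γ.L_pos s) (Γ.V_int s) k x y

theorem freeKernel_meromorphic (Γ : CombGraph N) {i j : Option (Fin N)} {x y : ℝ}
    (hx : x ∈ Γ.edge i) (hy : y ∈ Γ.edge j) : Meromorphic fun k => Γ.freeKernel k i j x y := by
  intro k
  rcases i with _ | s <;> rcases j with _ | n
  · exact lineKernel_meromorphic x y k
  · exact MeromorphicAt.const _ _
  · exact MeromorphicAt.const _ _
  · by_cases h : s = n
    · subst h
      simp only [freeKernel, if_true, toothKernel_eq']
      have h0 := left_mem_Icc.2 (Γ.L_pos s).le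
      have hmin : min x y ∈ Icc 0 (Γ.L s) := ⟨le_min hx.1 hy.1, (min_le_left _ _).trans hx.2⟩
      have hmax : max x y ∈ Icc 0 (Γ.L s) := ⟨hx.1.trans (le_max_left _ _), max_le hx.2 hy.2⟩
      exact (meromorphic_of_differentiable (Γ.differentiable_uL s h0) k).inv.mul
        ((meromorphic_of_differentiable (Γ.differentiable_u0 s hmin) k).mul
          (meromorphic_of_differentiable (Γ.differentiable_uL s hmax) k))
    · simp only [freeKernel, if_neg h]
      exact MeromorphicAt.const _ _

theorem freeKernel_continuousAt (Γ : CombGraph N) {k : ℂ} (hreg : Γ.IsRegular k)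
    {i j : Option (Fin N)} {x y : ℝ} (hx : x ∈ Γ.edge i) (hy : y ∈ Γ.edge j) :
    ContinuousAt (fun k => Γ.freeKernel k i j x y) k := by
  rcases i with _ | s <;> rcases j with _ | n
  · exact lineKernel_continuousAt hreg.1 x y
  · exact continuousAt_const
  · exact continuousAt_const
  · by_cases h : s = n
    · subst h
      simp only [freeKernel, if_true, toothKernel_eq']
      have h0 := left_mem_Icc.2 (Γ.L_pos s).le
      have hmin : min x y ∈ Icc 0 (Γ.L s) := ⟨le_min hx.1 hy.1, (min_le_left _ _).trans hx.2⟩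
      have hmax : max x y ∈ Icc 0 (Γ.L s) := ⟨hx.1.trans (le_max_left _ _), max_le hx.2 hy.2⟩
      exact ((Γ.differentiable_uL s h0).continuous.continuousAt.inv₀ (hreg.2 s).1).mul
        ((Γ.differentiable_u0 s hmin).continuous.continuousAt.mul
          (Γ.differentiable_uL s hmax).continuous.continuousAt)
    · simp only [freeKernel, if_neg h]
      exact continuousAt_const

theorem defVector_meromorphic (Γ : CombGraph N) (m : Fin N ⊕ Fin N) {i : Option (Fin N)} {x : ℝ}
    (hx : x ∈ Γ.edge i) : Meromorphic fun k => Γ.defVector k m i x := by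
  intro k
  rcases m with n | n <;> rcases i with _ | s
  · exact lineKernel_meromorphic _ _ k
  · exact MeromorphicAt.const _ _
  · exact MeromorphicAt.const _ _
  · by_cases h : s = n
    · subst h
      simp only [defVector, if_true]
      exact meromorphic_of_differentiable (Γ.differentiable_uL s hx) k
    · simp only [defVector, if_neg h]
      exact MeromorphicAt.const _ _

theorem defVector_continuousAt (Γ : CombGraph N) {k : ℂ} (hk : k ≠ 0) (m : Fin N ⊕ Fin N)
    {i : Option (Fin N)} {x : ℝ} (hx : x ∈ Γ.edge i) :
    ContinuousAt (fun k => Γ.defVector k m i x) k := by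
  rcases m with n | n <;> rcases i with _ | s
  · exact lineKernel_continuousAt hk _ _
  · exact continuousAt_const
  · exact continuousAt_const
  · by_cases h : s = n
    · subst h
      simp only [defVector, if_true]
      exact (Γ.differentiable_uL s hx).continuous.continuousAt
    · simp only [defVector, if_neg h]
      exact continuousAt_const

theorem kreinKernel_meromorphic (Γ : CombGraph N) {i j : Option (Fin N)} {x y : ℝ}
    (hx : x ∈ Γ.edge i) (hy : y ∈ Γ.edge j) : Meromorphic fun k => Γ.kreinKernel k i j x y :=
  fun k => (Γ.freeKernel_meromorphic hx hy k).add
    (MeromorphicAt.fun_sum fun m _ => MeromorphicAt.fun_sum fun n _ =>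
      ((Γ.kreinCoef_meromorphic m n k).mul (Γ.defVector_meromorphic m hx k)).mul
        (Γ.defVector_meromorphic n hy k))

theorem kreinKernel_continuousAt (Γ : CombGraph N) {k : ℂ} (hreg : Γ.IsRegular k)
    (hD : Γ.combDet k ≠ 0) {i j : Option (Fin N)} {x y : ℝ}
    (hx : x ∈ Γ.edge i) (hy : y ∈ Γ.edge j) : ContinuousAt (fun k => Γ.kreinKernel k i j x y) k :=
  (Γ.freeKernel_continuousAt hreg hx hy).add
    (tendsto_finsetSum _ fun m _ => tendsto_finsetSum _ fun n _ =>
      ((Γ.kreinCoef_continuousAt hreg hD m n).mul (Γ.defVector_continuousAt hreg.1 m hx)).mul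
        (Γ.defVector_continuousAt hreg.1 n hy))

/-- The function h ↦ sin(kh) has nonzero derivative k at 0. The bound h ≤ ℓ keeps the other
junctions out of the interior of the stencil around a given one. -/
theorem exists_sin_ne_zero {k : ℂ} (hk : k ≠ 0) {ℓ : ℝ} (hℓ : 0 < ℓ) :
    ∃ h : ℝ, 0 < h ∧ h ≤ ℓ ∧ Complex.sin (k * h) ≠ 0 := by
  have h1 : HasDerivAt (fun z : ℂ => Complex.sin (k * z)) k ((0 : ℝ) : ℂ) := by
    have := ((hasDerivAt_id ((0 : ℝ) : ℂ)).const_mul k).csin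
    simpa using this
  have h2 := h1.comp_ofReal.eventually_ne (c := 0) hk
  have h3 : ∀ᶠ h : ℝ in 𝓝[>] 0, Complex.sin (k * h) ≠ 0 :=
    h2.filter_mono (nhdsWithin_mono _ fun x hx => ne_of_gt hx)
  obtain ⟨h, h4, h5⟩ := (h3.and (Ioc_mem_nhdsGT hℓ)).exists
  exact ⟨h, h5.1, h5.2, h4⟩

/-- Both exponentials e^(±ikx) are annihilated by this difference operator, and on a stencil not
crossing c the kernel is a multiple of one of them. -/
theorem lineKernel_second_difference (k : ℂ) {c x h : ℝ} (hh : 0 ≤ h)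
    (hx : x + h ≤ c ∨ c ≤ x - h) : lineKernel k (x + h) c + lineKernel k (x - h) c -
      2 * Complex.cos (k * h) * lineKernel k x c = 0 := by
  have hc : 2 * Complex.cos (k * h) =
      Complex.exp (Complex.I * k * h) + Complex.exp (-(Complex.I * k * h)) := by
    rw [Complex.two_cos]
    congr 2 <;> ring
  rcases hx with hx | hx
  · rw [lineKernel_of_ge hx, lineKernel_of_ge (by linarith), lineKernel_of_ge (by linarith), hc]
    have e1 : Complex.exp (-(Complex.I * k) * (((x + h : ℝ) : ℂ) - c)) =
        Complex.exp (-(Complex.I * k) * ((x : ℂ) - c)) * Complex.exp (-(Complex.I * k * h)) := by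
      rw [← Complex.exp_add]
      congr 1
      push_cast
      ring
    have e2 : Complex.exp (-(Complex.I * k) * (((x - h : ℝ) : ℂ) - c)) =
        Complex.exp (-(Complex.I * k) * ((x : ℂ) - c)) * Complex.exp (Complex.I * k * h) := by
      rw [← Complex.exp_add]
      congr 1
      push_cast
      ring
    rw [e1, e2]
    ring
  · rw [lineKernel_of_le hx, lineKernel_of_le (by linarith), lineKernel_of_le (by linarith), hc]
    have e1 : Complex.exp (Complex.I * k * (((x + h : ℝ) : ℂ) - c)) =
        Complex.exp (Complex.I * k * ((x : ℂ) - c)) * Complex.exp (Complex.I * k * h) := by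
      rw [← Complex.exp_add]
      congr 1
      push_cast
      ring
    have e2 : Complex.exp (Complex.I * k * (((x - h : ℝ) : ℂ) - c)) =
        Complex.exp (Complex.I * k * ((x : ℂ) - c)) * Complex.exp (-(Complex.I * k * h)) := by
      rw [← Complex.exp_add]
      congr 1
      push_cast
      ring
    rw [e1, e2]
    ring

theorem lineKernel_second_difference_self {k : ℂ} (c : ℝ) {h : ℝ} (hh : 0 ≤ h) :
    lineKernel k (c + h) c + lineKernel k (c - h) c - 2 * Complex.cos (k * h) * lineKernel k c c =
      -Complex.sin (k * h) / k := by
  have hc : 2 * Complex.cos (k * h) =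
      Complex.exp (Complex.I * k * h) + Complex.exp (-(Complex.I * k * h)) := by
    rw [Complex.two_cos]
    congr 2 <;> ring
  have hs : 2 * Complex.sin (k * h) =
      (Complex.exp (-(Complex.I * k * h)) - Complex.exp (Complex.I * k * h)) * Complex.I := by
    rw [Complex.two_sin]
    congr 3 <;> ring
  rw [lineKernel_of_le (by linarith), lineKernel_of_ge (by linarith), lineKernel_of_le le_rfl, hc]
  have e1 : Complex.exp (Complex.I * k * (((c + h : ℝ) : ℂ) - c)) =
      Complex.exp (Complex.I * k * h) := by
    congr 1
    push_cast
    ring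
  have e2 : Complex.exp (-(Complex.I * k) * (((c - h : ℝ) : ℂ) - c)) =
      Complex.exp (Complex.I * k * h) := by
    congr 1
    push_cast
    ring
  rw [e1, e2, sub_self, mul_zero, Complex.exp_zero]
  have : -Complex.sin (k * h) / k = -(2 * Complex.sin (k * h)) / (2 * k) := by
    rw [← mul_neg, mul_div_mul_left _ _ two_ne_zero]
  rw [this, hs]
  ring

/-- The deficiency vectors are separated by finite combinations of point evaluations. -/
theorem exists_dual_functional (Γ : CombGraph N) {k₀ : ℂ} (hreg : Γ.IsRegular k₀)
    (m : Fin N ⊕ Fin N) : ∃ (i : Option (Fin N)) (x : Fin 3 → ℝ) (a : Fin 3 → ℂ → ℂ) (c : ℂ → ℂ),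
      (∀ r, x r ∈ Γ.edge i) ∧ (∀ r, ContinuousAt (a r) k₀) ∧ ContinuousAt c k₀ ∧ c k₀ ≠ 0 ∧
      ∀ k m', ∑ r, a r k * Γ.defVector k m' i (x r) = if m' = m then c k else 0 := by
  rcases m with n | n
  -- The second difference around x_n kills every kernel centred elsewhere and gives -sin(kh)/k on
  -- the one centred at x_n. The step h is fixed from k₀, while the weights vary continuously with
  -- k.
  · obtain ⟨h, h0, hℓ, hs⟩ := exists_sin_ne_zero hreg.1 Γ.ℓ_pos
    refine ⟨none, ![Γ.node n + h, Γ.node n - h, Γ.node n],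
      ![fun _ => 1, fun _ => 1, fun k => -(2 * Complex.cos (k * h))],
      fun k => -Complex.sin (k * h) / k, fun r => mem_univ _, fun r => ?_, ?_, ?_, fun k m' => ?_⟩
    · fin_cases r
      · exact continuousAt_const
      · exact continuousAt_const
      · change ContinuousAt (fun k : ℂ => -(2 * Complex.cos (k * h))) k₀
        fun_prop
    · exact ContinuousAt.div (by fun_prop) continuousAt_id hreg.1
    · exact div_ne_zero (neg_ne_zero.2 hs) hreg.1
    · rw [Fin.sum_univ_three]
      rcases m' with l | l
      · simp only [defVector, Matrix.cons_val_zero, Matrix.cons_val_one, Matrix.cons_val]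
        by_cases hl : l = n
        · subst hl
          rw [if_pos rfl, ← lineKernel_second_difference_self (Γ.node l) h0.le]
          ring
        · rw [if_neg (by simpa using hl), ← lineKernel_second_difference k (c := Γ.node l)
            (x := Γ.node n) h0.le]
          · ring
          · rcases lt_or_gt_of_ne hl with h1 | h1
            · right
              linarith [Γ.node_add_le h1]
            · left
              linarith [Γ.node_add_le h1]
      · simp [defVector]
  -- On a tooth one evaluation at the junction suffices, as u_L(0) ≠ 0 at regular momenta; the other
  -- two weights are zero.
  · have hz := left_mem_Icc.2 (Γ.L_pos n).le
    refine ⟨some n, fun _ => 0, ![fun _ => 1, fun _ => 0, fun _ => 0], fun k => Γ.uL k n 0,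
      fun r => hz, fun r => ?_, (Γ.differentiable_uL n hz).continuous.continuousAt, (hreg.2 n).1,
      fun k m' => ?_⟩
    · fin_cases r <;> exact continuousAt_const
    · rw [Fin.sum_univ_three]
      rcases m' with l | l
      · simp [defVector]
      · by_cases hl : l = n
        · subst hl
          simp [defVector]
        · simp [defVector, hl, Ne.symm hl]

/-- If no entry of the kernel has a pole, subtracting the regular free kernel and applying dual
functionals in both variables isolates each λ_{mn} times a nonvanishing factor. All coefficients
then have limits, which excludes D_N = 0. -/
theorem resolventPole_iff {Γ : CombGraph N} (hN : 1 ≤ N) {k : ℂ} (hreg : Γ.IsRegular k) :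
    Γ.ResolventPole k ↔ Γ.combDet k = 0 := by
  constructor
  · rintro ⟨i, j, x, hx, y, hy, h⟩
    by_contra hD
    exact (not_hasPoleAt_iff (Γ.kreinKernel_meromorphic hx hy k)).2
      (ContinuousAt.exists_tendsto_punctured (Γ.kreinKernel_continuousAt hreg hD hx hy)) h
  · intro hD
    by_contra hno
    have hlim : ∀ i j x y, x ∈ Γ.edge i → y ∈ Γ.edge j →
        ∃ c, Tendsto (fun k' => Γ.kreinKernel k' i j x y - Γ.freeKernel k' i j x y)
          (𝓝[≠] k) (𝓝 c) := fun i j x y hx hy => by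
      obtain ⟨c, hc⟩ := (not_hasPoleAt_iff (Γ.kreinKernel_meromorphic hx hy k)).1
        fun h => hno ⟨i, j, x, hx, y, hy, h⟩
      obtain ⟨c', hc'⟩ := ContinuousAt.exists_tendsto_punctured
        (Γ.freeKernel_continuousAt hreg hx hy)
      exact ⟨_, hc.sub hc'⟩
    refine combDet_ne_zero_of_tendsto hN hreg (fun m n => ?_) hD
    obtain ⟨i, x, a, c, hx, ha, hc, hc0, hF⟩ := Γ.exists_dual_functional hreg m
    obtain ⟨j, y, a', c', hy, ha', hc', hc0', hF'⟩ := Γ.exists_dual_functional hreg n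
    choose E hE using fun r r' => hlim i j (x r) (y r') (hx r) (hy r')
    have t1 : Tendsto (fun k' => ∑ r, ∑ r', a r k' * a' r' k' *
        (Γ.kreinKernel k' i j (x r) (y r') - Γ.freeKernel k' i j (x r) (y r'))) (𝓝[≠] k)
        (𝓝 (∑ r, ∑ r', a r k * a' r' k * E r r')) :=
      tendsto_finsetSum _ fun r _ => tendsto_finsetSum _ fun r' _ =>
        (((ha r).mul (ha' r')).tendsto.mono_left nhdsWithin_le_nhds).mul (hE r r')
    have e : ∀ k', ∑ r, ∑ r', a r k' * a' r' k' *
        (Γ.kreinKernel k' i j (x r) (y r') - Γ.freeKernel k' i j (x r) (y r')) =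
        Γ.kreinCoef k' m n * (c k' * c' k') := by
      intro k'
      have e1 : ∑ r, ∑ r', a r k' * a' r' k' *
        (Γ.kreinKernel k' i j (x r) (y r') - Γ.freeKernel k' i j (x r) (y r')) =
        ∑ p, ∑ q, Γ.kreinCoef k' p q * ((∑ r, a r k' * Γ.defVector k' p i (x r)) *
          ∑ r', a' r' k' * Γ.defVector k' q j (y r')) := by
        simp only [kreinKernel, add_sub_cancel_left, Finset.mul_sum, Finset.sum_mul]
        rw [Finset.sum_congr rfl fun r _ => Finset.sum_comm]
        rw [Finset.sum_comm]
        refine Finset.sum_congr rfl fun p _ => ?_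
        rw [Finset.sum_congr rfl fun r _ => Finset.sum_comm]
        rw [Finset.sum_comm]
        refine Finset.sum_congr rfl fun q _ => ?_
        rw [Finset.sum_comm]
        refine Finset.sum_congr rfl fun r' _ => Finset.sum_congr rfl fun r _ => ?_
        ring
      rw [e1]
      simp only [hF, hF']
      rw [Finset.sum_eq_single m, Finset.sum_eq_single n]
      · simp
      · intro q _ hq
        simp [hq]
      · simp
      · intro p _ hp
        simp [hp]
      · simp
    have t2 := t1.div ((hc.mul hc').tendsto.mono_left nhdsWithin_le_nhds) (mul_ne_zero hc0 hc0')
    refine ⟨_, t2.congr' ?_⟩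
    filter_upwards [nhdsWithin_le_nhds ((hc.mul hc').eventually_ne (mul_ne_zero hc0 hc0'))]
      with k' hk'
    simp only [Pi.div_apply, e]
    exact mul_div_cancel_right₀ _ hk'

/-! ### The determinant of a periodic comb -/

/-- The Toeplitz matrix `c e^{|s-n|} + δ`. -/
def expToeplitz (c e : ℂ) (n : ℕ) : Matrix (Fin n) (Fin n) ℂ :=
  Matrix.of fun s m => c * e ^ (((s : ℕ) : ℤ) - ((m : ℕ) : ℤ)).natAbs + if s = m then 1 else 0

theorem expToeplitz_succ_succ (c e : ℂ) (n : ℕ) (s m : Fin n) :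
    expToeplitz c e (n + 1) s.succ m.succ = expToeplitz c e n s m := by
  simp only [expToeplitz, Matrix.of_apply, Fin.val_succ, Fin.succ_inj]
  congr 4
  push_cast
  ring

theorem expToeplitz_succ_zero (c e : ℂ) (n : ℕ) (s : Fin n) :
    expToeplitz c e (n + 1) s.succ 0 = c * e ^ ((s : ℕ) + 1) := by
  simp only [expToeplitz, Matrix.of_apply, Fin.val_succ, Fin.succ_ne_zero, if_false, add_zero,
    Fin.val_zero]
  congr 2

theorem expToeplitz_zero_succ (c e : ℂ) (n : ℕ) (s : Fin n) :
    expToeplitz c e (n + 1) 0 s.succ = c * e ^ ((s : ℕ) + 1) := by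
  simp only [expToeplitz, Matrix.of_apply, Fin.val_succ, (Fin.succ_ne_zero _).symm, if_false,
    add_zero, Fin.val_zero]
  congr 2

theorem expToeplitz_zero_zero (c e : ℂ) (n : ℕ) : expToeplitz c e (n + 1) 0 0 = c + 1 := by
  simp [expToeplitz]

theorem det_expToeplitz_updateCol (c e : ℂ) (n : ℕ) :
    ((expToeplitz c e (n + 1)).updateCol 0 (Pi.single 0 1)).det = (expToeplitz c e n).det := by
  rw [Matrix.det_succ_column_zero, Fin.sum_univ_succ, Finset.sum_eq_zero, add_zero]
  · simp only [Fin.val_zero, pow_zero, one_mul, Matrix.updateCol_self, Pi.single_eq_same]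
    congr 1
    ext s m
    rw [Matrix.submatrix_apply, Fin.zero_succAbove, Matrix.updateCol_ne (Fin.succ_ne_zero _),
      expToeplitz_succ_succ]
  · intro i _
    simp

/-- Subtracting e times the second row from the first leaves only the entries 1 + c(1 - e²) and -e,
because the powers along the rows are geometric. In the minor of the second entry the first column
is e times the column of the smaller Toeplitz matrix minus a unit vector, which yields e times the
difference of two smaller determinants. -/
theorem det_expToeplitz_add_two (c e : ℂ) (n : ℕ) :
    (expToeplitz c e (n + 2)).det = (1 + e ^ 2 + c * (1 - e ^ 2)) * (expToeplitz c e (n + 1)).det -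
      e ^ 2 * (expToeplitz c e n).det := by
  set A := expToeplitz c e (n + 2) with hA
  rw [← Matrix.det_updateRow_add_smul_self A (i := 0) (j := 1) (by simp) (-e),
    Matrix.det_succ_row_zero, Fin.sum_univ_succ, Fin.sum_univ_succ, Finset.sum_eq_zero]
  · have h1 : (A.updateRow 0 (A 0 + -e • A 1)).submatrix Fin.succ (Fin.succAbove 0) =
        expToeplitz c e (n + 1) := by
      ext s m
      rw [Matrix.submatrix_apply, Fin.zero_succAbove, Matrix.updateRow_ne (Fin.succ_ne_zero _),
        hA, expToeplitz_succ_succ]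
    have h2 : (A.updateRow 0 (A 0 + -e • A 1)).submatrix Fin.succ
        (Fin.succAbove (Fin.succ 0)) = (expToeplitz c e (n + 1)).updateCol 0
          (e • ((fun i => expToeplitz c e (n + 1) i 0) + (-1 : ℂ) • Pi.single 0 1)) := by
      ext s m
      rw [Matrix.submatrix_apply, Matrix.updateRow_ne (Fin.succ_ne_zero _)]
      refine Fin.cases ?_ (fun m => ?_) m
      · rw [Fin.succ_succAbove_zero, hA, expToeplitz_succ_zero, Matrix.updateCol_self]
        refine Fin.cases ?_ (fun s => ?_) s
        · simp [expToeplitz_zero_zero]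
          ring
        · simp only [Pi.smul_apply, Pi.add_apply, expToeplitz_succ_zero, smul_eq_mul,
            Pi.single_eq_of_ne (Fin.succ_ne_zero s), Fin.val_succ]
          ring
      · rw [Fin.succ_succAbove_succ, Fin.zero_succAbove, hA, expToeplitz_succ_succ,
          Matrix.updateCol_ne (Fin.succ_ne_zero _)]
    rw [h1, h2, Matrix.det_updateCol_smul, Matrix.det_updateCol_add, Matrix.updateCol_eq_self,
      Matrix.det_updateCol_smul, det_expToeplitz_updateCol]
    have e0 : (A 0 + -e • A 1) 0 = 1 + c * (1 - e ^ 2) := by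
      have : A 1 0 = c * e := by
        have := expToeplitz_succ_zero c e (n + 1) 0
        simpa using this
      simp only [Pi.add_apply, Pi.smul_apply, smul_eq_mul, this]
      rw [hA, expToeplitz_zero_zero]
      ring
    have e1 : (A 0 + -e • A 1) (Fin.succ 0) = -e := by
      have h11 : A 1 (Fin.succ 0) = c + 1 := by
        have := expToeplitz_succ_succ c e (n + 1) 0 0
        rw [expToeplitz_zero_zero] at this
        exact this
      have h01 : A 0 (Fin.succ 0) = c * e := by
        have := expToeplitz_zero_succ c e (n + 1) 0
        simpa using this
      simp only [Pi.add_apply, Pi.smul_apply, smul_eq_mul, h11, h01]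
      ring
    rw [Matrix.updateRow_self, e0, e1]
    simp only [Fin.val_zero, Fin.val_succ, pow_zero, zero_add, pow_one]
    ring
  · intro i _
    have h0 : A 0 i.succ.succ = c * e ^ ((i : ℕ) + 2) := expToeplitz_zero_succ c e (n + 1) i.succ
    have h1 : A 1 i.succ.succ = c * e ^ ((i : ℕ) + 1) := by
      have := expToeplitz_succ_succ c e (n + 1) 0 i.succ
      rw [expToeplitz_zero_succ] at this
      exact this
    rw [Matrix.updateRow_self]
    simp only [Pi.add_apply, Pi.smul_apply, smul_eq_mul, h0, h1]
    ring

theorem chebyshev_U_eval_add_two (ζ : ℂ) (n : ℤ) : (Polynomial.Chebyshev.U ℂ (n + 2)).eval ζ =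
    2 * ζ * (Polynomial.Chebyshev.U ℂ (n + 1)).eval ζ - (Polynomial.Chebyshev.U ℂ n).eval ζ := by
  rw [Polynomial.Chebyshev.U_add_two]
  simp

/-- By `hζ` the coefficient in the Toeplitz recurrence is 2eζ, so apart from powers of e it is the
Chebyshev recurrence; two initial values remain to be compared. -/
theorem det_expToeplitz (β e ζ : ℂ) (hζ : 2 * e * ζ = 1 + e ^ 2 + Complex.I * β * (1 - e ^ 2))
    (n : ℕ) : (expToeplitz (Complex.I * β) e (n + 1)).det =
      -e ^ n * chebDenominator (n + 1) e β ζ := by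
  have hU : ∀ m : ℕ, chebDenominator (m + 2 + 1) e β ζ =
      2 * ζ * chebDenominator (m + 1 + 1) e β ζ - chebDenominator (m + 1) e β ζ := by
    intro m
    have h1 := chebyshev_U_eval_add_two ζ ((m : ℤ) - 1)
    have h2 := chebyshev_U_eval_add_two ζ (m : ℤ)
    have a1 : (((m + 2 + 1 : ℕ) : ℤ) - 2) = (m : ℤ) - 1 + 2 := by push_cast; ring
    have a2 : (((m + 2 + 1 : ℕ) : ℤ) - 1) = (m : ℤ) + 2 := by push_cast; ring
    have a3 : (((m + 1 + 1 : ℕ) : ℤ) - 2) = (m : ℤ) - 1 + 1 := by push_cast; ring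
    have a4 : (((m + 1 + 1 : ℕ) : ℤ) - 1) = (m : ℤ) + 1 := by push_cast; ring
    have a5 : (((m + 1 : ℕ) : ℤ) - 2) = (m : ℤ) - 1 := by push_cast; ring
    have a6 : (((m + 1 : ℕ) : ℤ) - 1) = (m : ℤ) := by push_cast; ring
    rw [chebDenominator, chebDenominator, chebDenominator, a1, a2, a3, a4, a5, a6, h1, h2]
    ring
  have h1 : (expToeplitz (Complex.I * β) e 1).det = 1 + Complex.I * β := by
    rw [Matrix.det_fin_one, expToeplitz_zero_zero]
    ring
  induction n using Nat.twoStepInduction with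
  | zero =>
    rw [h1]
    simp [chebDenominator]
  | one =>
    rw [det_expToeplitz_add_two, h1, ← hζ]
    simp [chebDenominator]
    ring
  | more n ih1 ih2 =>
    rw [det_expToeplitz_add_two, ih1, ih2, ← hζ, hU]
    ring

theorem two_mul_exp_mul_zeta (k β : ℂ) (ℓ : ℝ) :
    2 * Complex.exp (Complex.I * k * ℓ) * (Complex.cos (k * ℓ) + β * Complex.sin (k * ℓ)) =
      1 + Complex.exp (Complex.I * k * ℓ) ^ 2 +
        Complex.I * β * (1 - Complex.exp (Complex.I * k * ℓ) ^ 2) := by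
  have hc := Complex.two_cos (k * ℓ)
  have hs := Complex.two_sin (k * ℓ)
  have e1 : k * ℓ * Complex.I = Complex.I * k * ℓ := by ring
  have e2 : -(k * ℓ) * Complex.I = -(Complex.I * k * ℓ) := by ring
  rw [e1, e2] at hc hs
  have h1 : Complex.exp (Complex.I * k * ℓ) * Complex.exp (-(Complex.I * k * ℓ)) = 1 := by
    rw [← Complex.exp_add]
    simp
  linear_combination Complex.exp (Complex.I * k * ℓ) * hc +
    β * Complex.exp (Complex.I * k * ℓ) * hs + (1 + Complex.I * β) * h1

theorem combDet_eq_of_beta_const (Γ : CombGraph N) (hN : 1 ≤ N) {k β : ℂ}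
    (hβ : ∀ s, Γ.beta k s = β) : Γ.combDet k = -Γ.eps k ^ (N - 1) *
      chebDenominator N (Γ.eps k) β (Complex.cos (k * Γ.ℓ) + β * Complex.sin (k * Γ.ℓ)) := by
  obtain ⟨n, rfl⟩ : ∃ n, N = n + 1 := ⟨N - 1, by omega⟩
  have : Γ.combMatrix k = expToeplitz (Complex.I * β) (Γ.eps k) (n + 1) := by
    ext s m
    simp only [combMatrix, expToeplitz, Matrix.of_apply, hβ, epsPow]
  rw [combDet_eq, this, det_expToeplitz β (Γ.eps k) _ (two_mul_exp_mul_zeta k β Γ.ℓ)]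
  rfl

/-! ### Scattering -/

/-- The value `U_n(ζ)` of the Chebyshev polynomial of the second kind. -/
def chebU (ζ : ℂ) (n : ℤ) : ℂ := (Polynomial.Chebyshev.U ℂ n).eval ζ

/-- The quadratic form is invariant under the Chebyshev recurrence and is evaluated at U_{-1} = 0,
U_{-2} = -1. -/
theorem chebU_quadratic (ζ : ℂ) (n : ℕ) :
    chebU ζ ((n : ℤ) - 1) ^ 2 + chebU ζ ((n : ℤ) - 2) ^ 2 -
      2 * ζ * chebU ζ ((n : ℤ) - 1) * chebU ζ ((n : ℤ) - 2) = 1 := by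
  induction n with
  | zero => simp [chebU]
  | succ n ih =>
    have h := chebyshev_U_eval_add_two ζ ((n : ℤ) - 2)
    have a1 : (((n + 1 : ℕ) : ℤ) - 1) = (n : ℤ) - 2 + 2 := by push_cast; ring
    have a2 : (((n + 1 : ℕ) : ℤ) - 2) = (n : ℤ) - 1 := by push_cast; ring
    have a3 : (n : ℤ) - 2 + 1 = (n : ℤ) - 1 := by ring
    rw [a3] at h
    rw [a1, a2]
    simp only [chebU] at ih ⊢
    rw [h]
    linear_combination ih

/-- The iterates of the transfer matrix of one cell. -/
theorem transfer_iterate {β e ζ : ℂ} (he : e ≠ 0)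
    (hζ : 2 * e * ζ = 1 + e ^ 2 + Complex.I * β * (1 - e ^ 2)) {p q : ℕ → ℂ} {N : ℕ}
    (hp : ∀ s < N, p (s + 1) = e * (p s - Complex.I * β * (p s + q s)))
    (hq : ∀ s < N, e * q (s + 1) = q s + Complex.I * β * (p s + q s)) :
    ∀ n ≤ N, p n = chebU ζ ((n : ℤ) - 1) * (e * (p 0 - Complex.I * β * (p 0 + q 0))) -
        chebU ζ ((n : ℤ) - 2) * p 0 ∧
      e * q n = chebU ζ ((n : ℤ) - 1) * (q 0 + Complex.I * β * (p 0 + q 0)) -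
        e * chebU ζ ((n : ℤ) - 2) * q 0 := by
  intro n
  induction n with
  | zero => simp [chebU]
  | succ n ih =>
    intro hn
    obtain ⟨h1, h2⟩ := ih (by omega)
    -- The one-cell matrix M has determinant 1 and, by `hζ`, trace 2ζ. Cayley–Hamilton gives Mⁿ =
    -- U_{n-1}(ζ) M - U_{n-2}(ζ), which is the claim componentwise.
    have h := chebyshev_U_eval_add_two ζ ((n : ℤ) - 2)
    have a1 : (((n + 1 : ℕ) : ℤ) - 1) = (n : ℤ) - 2 + 2 := by push_cast; ring
    have a2 : (((n + 1 : ℕ) : ℤ) - 2) = (n : ℤ) - 1 := by push_cast; ring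
    have a3 : (n : ℤ) - 2 + 1 = (n : ℤ) - 1 := by ring
    rw [a3] at h
    rw [a1, a2, hp n (by omega), hq n (by omega)]
    simp only [chebU] at h1 h2 ⊢
    rw [h]
    set u := (Polynomial.Chebyshev.U ℂ ((n : ℤ) - 1)).eval ζ
    set w := (Polynomial.Chebyshev.U ℂ ((n : ℤ) - 2)).eval ζ
    constructor
    · refine mul_left_cancel₀ he ?_
      linear_combination e ^ 2 * (1 - Complex.I * β) * h1 - e * (Complex.I * β) * h2 -
        (u * e * (p 0 - Complex.I * β * (p 0 + q 0))) * hζ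
    · refine mul_left_cancel₀ he ?_
      linear_combination (1 + Complex.I * β) * h2 + e * (Complex.I * β) * h1 -
        (u * (q 0 + Complex.I * β * (p 0 + q 0))) * hζ

/-- The scattering amplitudes of `N` cells from the junction values `v`. -/
theorem scattering_amplitudes {β e ζ : ℂ} (he : e ≠ 0)
    (hζ : 2 * e * ζ = 1 + e ^ 2 + Complex.I * β * (1 - e ^ 2)) {v : ℕ → ℂ} {A C : ℂ} {N : ℕ}
    (hv : ∀ s < N, (∑ n ∈ Finset.range N,
      Complex.I * β * e ^ ((s : ℤ) - (n : ℤ)).natAbs * v n) + v s = A * e ^ s + C * (e⁻¹) ^ s)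
    (hΔ : chebDenominator N e β ζ ≠ 0) :
    (A - Complex.I * β * ∑ n ∈ Finset.range N, (e⁻¹) ^ n * v n =
      -e ^ (1 - (N : ℤ)) / chebDenominator N e β ζ * A + e ^ (2 - 2 * (N : ℤ)) *
        (Complex.I * β * chebU ζ ((N : ℤ) - 1) / chebDenominator N e β ζ) * C) ∧
    (C - Complex.I * β * ∑ n ∈ Finset.range N, e ^ n * v n =
      Complex.I * β * chebU ζ ((N : ℤ) - 1) / chebDenominator N e β ζ * A +
        -e ^ (1 - (N : ℤ)) / chebDenominator N e β ζ * C) := by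
  -- `P s` and `Q s` are the right- and left-moving amplitudes just before junction s; thus P 0 = A,
  -- Q N = C, and the outgoing amplitudes sought are P N and Q 0 = B.
  set B := C - Complex.I * β * ∑ n ∈ Finset.range N, e ^ n * v n with hB
  set P : ℕ → ℂ := fun s => A - Complex.I * β * ∑ n ∈ Finset.range s, (e⁻¹) ^ n * v n with hP
  set Q : ℕ → ℂ := fun s => B + Complex.I * β * ∑ n ∈ Finset.range s, e ^ n * v n with hQ
  have hee : ∀ n : ℕ, e ^ n * (e⁻¹) ^ n = 1 := fun n => by
    rw [← mul_pow, mul_inv_cancel₀ he, one_pow]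
  -- Splitting the sum over junctions at s separates the powers of e and its inverse and turns the
  -- full matrix equation into a one-step recursion.
  have hvs : ∀ s < N, v s = P s * e ^ s + Q s * (e⁻¹) ^ s := by
    intro s hs
    have h1 := Finset.sum_range_add_sum_Ico
      (fun n => Complex.I * β * e ^ ((s : ℤ) - (n : ℤ)).natAbs * v n) hs.le
    have h2 := Finset.sum_range_add_sum_Ico (fun n => e ^ n * v n) hs.le
    have h3 : ∑ n ∈ Finset.range s, Complex.I * β * e ^ ((s : ℤ) - (n : ℤ)).natAbs * v n =
        Complex.I * β * e ^ s * ∑ n ∈ Finset.range s, (e⁻¹) ^ n * v n := by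
      rw [Finset.mul_sum]
      refine Finset.sum_congr rfl fun n hn => ?_
      have hn' := Finset.mem_range.1 hn
      have : e ^ s = e ^ ((s : ℤ) - (n : ℤ)).natAbs * e ^ n := by
        rw [← pow_add]
        congr 1
        omega
      rw [this]
      linear_combination -(Complex.I * β * e ^ ((s : ℤ) - (n : ℤ)).natAbs * v n) * hee n
    have h4 : ∑ n ∈ Finset.Ico s N, Complex.I * β * e ^ ((s : ℤ) - (n : ℤ)).natAbs * v n =
        Complex.I * β * (e⁻¹) ^ s * ∑ n ∈ Finset.Ico s N, e ^ n * v n := by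
      rw [Finset.mul_sum]
      refine Finset.sum_congr rfl fun n hn => ?_
      have hn' := Finset.mem_Ico.1 hn
      have : e ^ n = e ^ ((s : ℤ) - (n : ℤ)).natAbs * e ^ s := by
        rw [← pow_add]
        congr 1
        omega
      rw [this]
      linear_combination -(Complex.I * β * e ^ ((s : ℤ) - (n : ℤ)).natAbs * v n) * hee s
    have h5 := hv s hs
    rw [← h1, h3, h4] at h5
    simp only [hP, hQ, hB]
    linear_combination h5 - Complex.I * β * (e⁻¹) ^ s * h2
  have hp : ∀ s < N, P (s + 1) * e ^ (s + 1) = e * (P s * e ^ s -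
      Complex.I * β * (P s * e ^ s + Q s * (e⁻¹) ^ s)) := by
    intro s hs
    rw [← hvs s hs]
    simp only [hP, Finset.sum_range_succ]
    linear_combination -(Complex.I * β * v s * e) * hee s
  have hq : ∀ s < N, e * (Q (s + 1) * (e⁻¹) ^ (s + 1)) = Q s * (e⁻¹) ^ s +
      Complex.I * β * (P s * e ^ s + Q s * (e⁻¹) ^ s) := by
    intro s hs
    rw [← hvs s hs]
    have e1 : e * (e⁻¹) ^ (s + 1) = (e⁻¹) ^ s := by
      rw [pow_succ]
      field_simp
    simp only [hQ, Finset.sum_range_succ]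
    linear_combination (B + Complex.I * β * ((∑ n ∈ Finset.range s, e ^ n * v n) + e ^ s * v s)) *
      e1 + (Complex.I * β * v s) * hee s
  obtain ⟨t1, t2⟩ := transfer_iterate he hζ (p := fun s => P s * e ^ s)
    (q := fun s => Q s * (e⁻¹) ^ s) hp hq N le_rfl
  have hP0 : P 0 = A := by simp [hP]
  have hQ0 : Q 0 = B := by simp [hQ]
  have hQN : Q N = C := by simp [hQ, hB]
  simp only [hP0, hQ0, hQN, pow_zero, mul_one] at t1 t2
  have hquad := chebU_quadratic ζ N
  set u := chebU ζ ((N : ℤ) - 1)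
  set w := chebU ζ ((N : ℤ) - 2)
  set Δ := chebDenominator N e β ζ with hΔdef
  have hΔe : Δ = e * w - (1 + Complex.I * β) * u := rfl
  have z1 : e ^ (1 - (N : ℤ)) = e * (e⁻¹) ^ N := by
    rw [zpow_sub₀ he, zpow_one, zpow_natCast, inv_pow, div_eq_mul_inv]
  have z2 : e ^ (2 - 2 * (N : ℤ)) = e ^ 2 * ((e⁻¹) ^ N) ^ 2 := by
    rw [zpow_sub₀ he, two_mul, zpow_add₀ he, zpow_natCast, inv_pow, zpow_ofNat]
    field_simp
  rw [z1, z2]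
  change P N = _ ∧ _
  have hEη := hee N
  clear_value B P Q
  have hBΔ : B * Δ = Complex.I * β * u * A - e * (e⁻¹) ^ N * C := by
    rw [hΔe]
    linear_combination t2
  -- The coefficient of A simplifies only through the quadratic identity `hquad`.
  have hPΔ : P N * Δ = -(e * (e⁻¹) ^ N) * A + e ^ 2 * ((e⁻¹) ^ N) ^ 2 * (Complex.I * β * u) * C := by
    have h7 := hΔe
    set η := (e⁻¹) ^ N
    clear_value Δ u w η
    subst h7
    linear_combination (-P N * (e * w - (1 + Complex.I * β) * u)) * hEη +
      η * (e * w - (1 + Complex.I * β) * u) * t1 - η * u * e * (Complex.I * β) * hBΔ -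
      e * η * A * hquad - η * A * u * w * hζ
  constructor
  · refine mul_right_cancel₀ hΔ ?_
    rw [hPΔ, add_mul]
    field_simp
  · refine mul_right_cancel₀ hΔ ?_
    rw [hBΔ, add_mul]
    field_simp
    ring

theorem planeWave_coef_unique {k A C A' C' : ℂ} (hk : k ≠ 0) {x : ℝ}
    (h : EqOn (planeWave k A C) (planeWave k A' C') (Icc x (x + 1))) : A = A' ∧ C = C' := by
  have hx : x ≤ x + 1 := by linarith
  have hx' : x < x + 1 := by linarith
  have h0 := h (left_mem_Icc.2 hx)
  have h1 := ((isSol_planeWave k A' C' hx).congr h).rightDeriv hx'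
  rw [(isSol_planeWave k A C hx).rightDeriv hx'] at h1
  have hI := Complex.I_ne_zero
  have e1 : Complex.exp (Complex.I * k * x) ≠ 0 := Complex.exp_ne_zero _
  have e2 : Complex.exp (-(Complex.I * k * x)) ≠ 0 := Complex.exp_ne_zero _
  simp only [planeWave, planeWaveDeriv] at h0 h1
  have h2 : A * Complex.exp (Complex.I * k * x) - C * Complex.exp (-(Complex.I * k * x)) =
      A' * Complex.exp (Complex.I * k * x) - C' * Complex.exp (-(Complex.I * k * x)) := by
    refine mul_left_cancel₀ (mul_ne_zero hI hk) ?_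
    linear_combination h1
  constructor
  · refine mul_right_cancel₀ e1 ?_
    linear_combination (h0 + h2) / 2
  · refine mul_right_cancel₀ e2 ?_
    linear_combination (h0 - h2) / 2

theorem exp_node (Γ : CombGraph N) (k : ℂ) (s : Fin N) :
    Complex.exp (Complex.I * k * Γ.node s) = Γ.eps k ^ (s : ℕ) ∧
      Complex.exp (-(Complex.I * k * Γ.node s)) = (Γ.eps k)⁻¹ ^ (s : ℕ) := by
  have h : Complex.exp (Complex.I * k * Γ.node s) = Γ.eps k ^ (s : ℕ) := by
    rw [eps, ← Complex.exp_nat_mul, node]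
    congr 1
    push_cast
    ring
  exact ⟨h, by rw [Complex.exp_neg, h, inv_pow]⟩

theorem genEig_line_left (Γ : CombGraph N) {k : ℂ} (hk : k ≠ 0) (A C : ℂ) (v : Fin N → ℂ) {x : ℝ}
    (hx : x ≤ 0) : Γ.genEig k A C v none x = planeWave k A
      (C - ∑ n : Fin N, Complex.I * Γ.beta k n * (Γ.eps k ^ (n : ℕ) * v n)) x := by
  simp only [genEig, kerSum, planeWave]
  have : ∀ n, -(2 * k * Γ.beta k n * v n) * lineKernel k x (Γ.node n) =
      -(Complex.I * Γ.beta k n * (Γ.eps k ^ (n : ℕ) * v n)) *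
        Complex.exp (-(Complex.I * k * x)) := fun n => by
    have e : Complex.exp (-(Complex.I * k) * ((x : ℂ) - Γ.node n)) =
        Complex.exp (-(Complex.I * k * x)) * Complex.exp (Complex.I * k * Γ.node n) := by
      rw [← Complex.exp_add]
      congr 1
      ring
    rw [lineKernel_of_ge (hx.trans (Γ.node_nonneg n)), e, (Γ.exp_node k n).1]
    field_simp
  rw [Finset.sum_congr rfl fun n _ => this n, ← Finset.sum_mul, Finset.sum_neg_distrib]
  ring

theorem genEig_line_right (Γ : CombGraph N) {k : ℂ} (hk : k ≠ 0) (A C : ℂ) (v : Fin N → ℂ) {x : ℝ}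
    (hx : ((N : ℝ) - 1) * Γ.ℓ ≤ x) : Γ.genEig k A C v none x = planeWave k
      (A - ∑ n : Fin N, Complex.I * Γ.beta k n * ((Γ.eps k)⁻¹ ^ (n : ℕ) * v n)) C x := by
  simp only [genEig, kerSum, planeWave]
  have : ∀ n, -(2 * k * Γ.beta k n * v n) * lineKernel k x (Γ.node n) =
      -(Complex.I * Γ.beta k n * ((Γ.eps k)⁻¹ ^ (n : ℕ) * v n)) *
        Complex.exp (Complex.I * k * x) := fun n => by
    have e : Complex.exp (Complex.I * k * ((x : ℂ) - Γ.node n)) =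
        Complex.exp (Complex.I * k * x) * Complex.exp (-(Complex.I * k * Γ.node n)) := by
      rw [← Complex.exp_add]
      congr 1
      ring
    rw [lineKernel_of_le ((Γ.node_le_last n).trans hx), e, (Γ.exp_node k n).2]
    field_simp
  rw [Finset.sum_congr rfl fun n _ => this n, ← Finset.sum_mul, Finset.sum_neg_distrib]
  ring

/-- The S-matrix of a periodic comb in terms of `ε`, `β` and `ζ`. -/
def periodicScattering (N : ℕ) (ε β ζ : ℂ) : Matrix (Fin 2) (Fin 2) ℂ :=
  !![-ε ^ (1 - (N : ℤ)) / chebDenominator N ε β ζ,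
     ε ^ (2 - 2 * (N : ℤ)) * (Complex.I * β *
       (Polynomial.Chebyshev.U ℂ ((N : ℤ) - 1)).eval ζ / chebDenominator N ε β ζ);
     Complex.I * β * (Polynomial.Chebyshev.U ℂ ((N : ℤ) - 1)).eval ζ / chebDenominator N ε β ζ,
     -ε ^ (1 - (N : ℤ)) / chebDenominator N ε β ζ]

theorem amplitudes_eq_of_node (Γ : CombGraph N) {k β : ℂ} (hk : k ≠ 0)
    (hβ : ∀ s, Γ.beta k s = β) {A C : ℂ} {v : Fin N → ℂ}
    (hv : ∀ s, Γ.genEig k A C v none (Γ.node s) = v s)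
    (hΔ : chebDenominator N (Γ.eps k) β (Complex.cos (k * Γ.ℓ) + β * Complex.sin (k * Γ.ℓ)) ≠ 0) :
    ![A - ∑ n : Fin N, Complex.I * Γ.beta k n * ((Γ.eps k)⁻¹ ^ (n : ℕ) * v n),
      C - ∑ n : Fin N, Complex.I * Γ.beta k n * (Γ.eps k ^ (n : ℕ) * v n)] =
    (periodicScattering N (Γ.eps k) β
      (Complex.cos (k * Γ.ℓ) + β * Complex.sin (k * Γ.ℓ))).mulVec ![A, C] := by
  -- Extension by zero, so that sums over `Fin N` become sums over ranges, which can be split and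
  -- extended by one term.
  set w : ℕ → ℂ := fun n => if h : n < N then v ⟨n, h⟩ else 0 with hw
  have hwv : ∀ n : Fin N, v n = w n := fun n => by simp [hw]
  have key := scattering_amplitudes (e := Γ.eps k) (v := w) (A := A) (C := C) (N := N)
    (Complex.exp_ne_zero (Complex.I * k * Γ.ℓ)) (two_mul_exp_mul_zeta k β Γ.ℓ) ?_ hΔ
  · simp only [hβ, ← Finset.mul_sum, hwv]
    rw [Fin.sum_univ_eq_sum_range fun n => (Γ.eps k)⁻¹ ^ n * w n,
      Fin.sum_univ_eq_sum_range fun n => Γ.eps k ^ n * w n]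
    ext i
    fin_cases i
    · simpa [periodicScattering, Matrix.mulVec, dotProduct, Fin.sum_univ_two, chebU] using key.1
    · simpa [periodicScattering, Matrix.mulVec, dotProduct, Fin.sum_univ_two, chebU] using key.2
  · intro s hs
    have h1 := hv ⟨s, hs⟩
    rw [Γ.genEig_node hk, combMatrix_mulVec, planeWave, (Γ.exp_node k _).1, (Γ.exp_node k _).2] at h1
    simp only [hβ, epsPow, hwv] at h1
    rw [Fin.sum_univ_eq_sum_range fun n =>
      Complex.I * β * Γ.eps k ^ ((s : ℤ) - (n : ℤ)).natAbs * w n] at h1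
    change (∑ n ∈ Finset.range N, Complex.I * β * Γ.eps k ^ ((s : ℤ) - (n : ℤ)).natAbs * w n) +
      w s = A * Γ.eps k ^ s + C * (Γ.eps k)⁻¹ ^ s
    linear_combination -h1

/-- The incoming amplitudes are the coefficients of the plane wave part of a generalized
eigenfunction, the outgoing ones those corrected by the kernels. Conversely D_N ≠ 0 makes the
junction equations solvable for any incoming data. -/
theorem isScatteringMatrix_periodicScattering {Γ : CombGraph N} (hN : 1 ≤ N) {k β : ℂ}
    (hreg : Γ.IsRegular k) (hβ : ∀ s, Γ.beta k s = β) (hD : Γ.combDet k ≠ 0) :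
    Γ.IsScatteringMatrix k (periodicScattering N (Γ.eps k) β
      (Complex.cos (k * Γ.ℓ) + β * Complex.sin (k * Γ.ℓ))) := by
  have hk := hreg.1
  have hΔ : chebDenominator N (Γ.eps k) β
      (Complex.cos (k * Γ.ℓ) + β * Complex.sin (k * Γ.ℓ)) ≠ 0 := by
    intro h
    rw [Γ.combDet_eq_of_beta_const hN hβ, h, mul_zero] at hD
    exact hD rfl
  have hℓ := Γ.ℓ_pos
  have huniq : ∀ {ψ : Option (Fin N) → ℝ → ℂ} {A C Ap Am Bp Bm : ℂ} {v : Fin N → ℂ}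
      (_ : ∀ x, ψ none x = Γ.genEig k A C v none x) (_ : Γ.HasAsymptotics k ψ Ap Am Bp Bm),
      Ap = A ∧ Am = C ∧
      Bp = A - ∑ n : Fin N, Complex.I * Γ.beta k n * ((Γ.eps k)⁻¹ ^ (n : ℕ) * v n) ∧
      Bm = C - ∑ n : Fin N, Complex.I * Γ.beta k n * (Γ.eps k ^ (n : ℕ) * v n) := by
    intro ψ A C Ap Am Bp Bm v he h
    have hl := planeWave_coef_unique hk (x := -1) fun x hx =>
      (h.1 x (by linarith [hx.2])).symm.trans
        ((he x).trans (Γ.genEig_line_left hk A C v (by linarith [hx.2])))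
    have hr := planeWave_coef_unique hk (x := ((N : ℝ) - 1) * Γ.ℓ) fun x hx =>
      (h.2 x hx.1).symm.trans ((he x).trans (Γ.genEig_line_right hk A C v hx.1))
    exact ⟨hl.1, hr.2, hr.1, hl.2⟩
  intro Ap Am Bp Bm
  constructor
  · rintro ⟨ψ, hψ, h⟩
    obtain ⟨A, C, he⟩ := hψ.exists_eq_genEig hN hreg
    obtain ⟨rfl, rfl, rfl, rfl⟩ := huniq he h
    exact Γ.amplitudes_eq_of_node hk hβ (fun s => (he (Γ.node s)).symm) hΔ
  · intro hS
    obtain ⟨v, hv⟩ : ∃ v, (Γ.combMatrix k).mulVec v = fun s => planeWave k Ap Am (Γ.node s) := by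
      refine ⟨(Γ.combMatrix k)⁻¹.mulVec fun s => planeWave k Ap Am (Γ.node s), ?_⟩
      rw [Matrix.mulVec_mulVec, Matrix.mul_nonsing_inv (Γ.combMatrix k) (isUnit_iff_ne_zero.2 hD),
        Matrix.one_mulVec]
    have hnode : ∀ s, Γ.genEig k Ap Am v none (Γ.node s) = v s := fun s => by
      rw [Γ.genEig_node hk, hv]
      ring
    refine ⟨_, Γ.genEig_isGenEigenfunction hreg Ap Am v hnode, ?_⟩
    have h1 := (Γ.amplitudes_eq_of_node hk hβ hnode hΔ).trans hS.symm
    have e0 := congrFun h1 0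
    have e1 := congrFun h1 1
    simp only [Matrix.cons_val_zero, Matrix.cons_val_one] at e0 e1
    rw [← e0, ← e1]
    exact ⟨fun x hx => Γ.genEig_line_left hk Ap Am v hx,
      fun x hx => Γ.genEig_line_right hk Ap Am v hx⟩

theorem IsScatteringMatrix.unique {Γ : CombGraph N} {k : ℂ} {S T : Matrix (Fin 2) (Fin 2) ℂ}
    (hS : Γ.IsScatteringMatrix k S) (hT : Γ.IsScatteringMatrix k T) : S = T := by
  have h : ∀ v : Fin 2 → ℂ, S.mulVec v = T.mulVec v := fun v => by
    have ev : ∀ w : Fin 2 → ℂ, ![w 0, w 1] = w := fun w => by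
      ext i
      fin_cases i <;> rfl
    have := (hT (v 0) (v 1) (S.mulVec v 0) (S.mulVec v 1)).1
      ((hS (v 0) (v 1) (S.mulVec v 0) (S.mulVec v 1)).2 (by rw [ev, ev]))
    rwa [ev, ev] at this
  exact Matrix.ext_of_mulVec_single fun i => h _

theorem scatteringMatrix_eq {Γ : CombGraph N} (hN : 1 ≤ N) {k β : ℂ}
    (hreg : Γ.IsRegular k) (hβ : ∀ s, Γ.beta k s = β) (hD : Γ.combDet k ≠ 0) :
    Γ.IsScatteringMatrix k (Γ.scatteringMatrix k) ∧
    Γ.scatteringMatrix k = periodicScattering N (Γ.eps k) β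
      (Complex.cos (k * Γ.ℓ) + β * Complex.sin (k * Γ.ℓ)) := by
  have h := isScatteringMatrix_periodicScattering hN hreg hβ hD
  have h1 : Γ.IsScatteringMatrix k (Γ.scatteringMatrix k) :=
    Classical.epsilon_spec (p := Γ.IsScatteringMatrix k) ⟨_, h⟩
  exact ⟨h1, h1.unique h⟩

/-! ### Meromorphy and poles of the S-matrix for constant coupling -/

theorem beta_meromorphic (Γ : CombGraph N) (s : Fin N) :
    Meromorphic fun k => Γ.beta k s := by
  intro k
  have hu := meromorphic_of_differentiable
    (Γ.differentiable_uL s (left_mem_Icc.2 (Γ.L_pos s).le)) k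
  have hu' := meromorphic_of_differentiable (Γ.differentiable_uL' s) k
  have hk := meromorphic_of_differentiable (f := fun k => 2 * k) (by fun_prop) k
  exact ((MeromorphicAt.const _ _).div hk).add (((MeromorphicAt.const _ _).div hk).mul
    (hu'.div (((MeromorphicAt.const _ _).mul hu').sub hu)))

theorem beta_continuousAt (Γ : CombGraph N) {k : ℂ} (hreg : Γ.IsRegular k) (s : Fin N) :
    ContinuousAt (fun k => Γ.beta k s) k := by
  have hu := (Γ.differentiable_uL s (left_mem_Icc.2 (Γ.L_pos s).le)).continuous.continuousAt
    (x := k)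
  have hu' := (Γ.differentiable_uL' s).continuous.continuousAt (x := k)
  have hk : ContinuousAt (fun k : ℂ => 2 * k) k := by fun_prop
  have hk2 : 2 * k ≠ 0 := by simpa using hreg.1
  exact (continuousAt_const.div hk hk2).add ((continuousAt_const.div hk hk2).mul
    (hu'.div ((continuousAt_const.mul hu').sub hu) (hreg.2 s).2))

theorem _root_.MeromorphicAt.polynomial_eval {f : ℂ → ℂ} {k : ℂ} (hf : MeromorphicAt f k)
    (p : Polynomial ℂ) : MeromorphicAt (fun k => p.eval (f k)) k := by
  simp only [Polynomial.eval_eq_sum_range]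
  exact MeromorphicAt.fun_sum fun i _ => (MeromorphicAt.const _ _).mul (hf.pow i)

section Periodic

variable {ε β ζ : ℂ → ℂ} {k : ℂ}

theorem chebDenominator_meromorphicAt (N : ℕ) (hε : MeromorphicAt ε k) (hβ : MeromorphicAt β k)
    (hζ : MeromorphicAt ζ k) :
    MeromorphicAt (fun k => chebDenominator N (ε k) (β k) (ζ k)) k :=
  (hε.mul (hζ.polynomial_eval _)).sub (((MeromorphicAt.const _ _).add
    ((MeromorphicAt.const _ _).mul hβ)).mul (hζ.polynomial_eval _))

theorem chebDenominator_continuousAt (N : ℕ) (hε : ContinuousAt ε k) (hβ : ContinuousAt β k)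
    (hζ : ContinuousAt ζ k) :
    ContinuousAt (fun k => chebDenominator N (ε k) (β k) (ζ k)) k :=
  (hε.mul ((Polynomial.continuous _).continuousAt.comp hζ)).sub ((continuousAt_const.add
    (continuousAt_const.mul hβ)).mul ((Polynomial.continuous _).continuousAt.comp hζ))

theorem periodicScattering_meromorphicAt (N : ℕ) (hε : MeromorphicAt ε k) (hβ : MeromorphicAt β k)
    (hζ : MeromorphicAt ζ k) (p q : Fin 2) :
    MeromorphicAt (fun k => periodicScattering N (ε k) (β k) (ζ k) p q) k := by
  have hΔ := chebDenominator_meromorphicAt N hε hβ hζ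
  have ht := (hε.zpow (1 - (N : ℤ))).neg.div hΔ
  have hr := (((MeromorphicAt.const Complex.I k).mul hβ).mul
    (hζ.polynomial_eval (Polynomial.Chebyshev.U ℂ ((N : ℤ) - 1)))).div hΔ
  fin_cases p <;> fin_cases q
  · exact ht
  · exact (hε.zpow (2 - 2 * (N : ℤ))).mul hr
  · exact hr
  · exact ht

theorem periodicScattering_continuousAt (N : ℕ) (hε : ContinuousAt ε k) (hβ : ContinuousAt β k)
    (hζ : ContinuousAt ζ k) (hε0 : ε k ≠ 0) (hΔ0 : chebDenominator N (ε k) (β k) (ζ k) ≠ 0)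
    (p q : Fin 2) : ContinuousAt (fun k => periodicScattering N (ε k) (β k) (ζ k) p q) k := by
  have hΔ := chebDenominator_continuousAt N hε hβ hζ
  have ht := (hε.zpow₀ (1 - (N : ℤ)) (Or.inl hε0)).neg.div hΔ hΔ0
  have hr := (((continuousAt_const (y := Complex.I)).mul hβ).mul
    ((Polynomial.continuous (Polynomial.Chebyshev.U ℂ ((N : ℤ) - 1))).continuousAt.comp hζ)).div
      hΔ hΔ0
  fin_cases p <;> fin_cases q
  · exact ht
  · exact (hε.zpow₀ (2 - 2 * (N : ℤ)) (Or.inl hε0)).mul hr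
  · exact hr
  · exact ht

end Periodic

section ConstantCoupling

variable {Γ : CombGraph N} {β : ℂ → ℂ}

/-- The closed formula is established at regular k with D_N ≠ 0. These fill a punctured
neighbourhood of every point, which is enough for meromorphy and orders. -/
theorem eventually_scatteringMatrix_eq (hN : 1 ≤ N) (hβ : ∀ k s, Γ.beta k s = β k) (k₀ : ℂ) :
    ∀ᶠ k in 𝓝[≠] k₀, Γ.scatteringMatrix k = periodicScattering N (Γ.eps k) (β k)
      (Complex.cos (k * Γ.ℓ) + β k * Complex.sin (k * Γ.ℓ)) := by
  filter_upwards [Γ.eventually_combDet_ne_zero hN k₀] with k hk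
  exact (scatteringMatrix_eq hN hk.1 (hβ k) hk.2).2

theorem differentiable_eps (Γ : CombGraph N) : Differentiable ℂ Γ.eps := by
  unfold eps
  fun_prop

theorem beta_const_meromorphic (hN : 1 ≤ N) (hβ : ∀ k s, Γ.beta k s = β k) : Meromorphic β := by
  have : β = fun k => Γ.beta k ⟨0, hN⟩ := funext fun k => (hβ k _).symm
  rw [this]
  exact Γ.beta_meromorphic _

theorem beta_const_continuousAt (hN : 1 ≤ N) (hβ : ∀ k s, Γ.beta k s = β k) {k : ℂ}
    (hreg : Γ.IsRegular k) : ContinuousAt β k := by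
  have : β = fun k => Γ.beta k ⟨0, hN⟩ := funext fun k => (hβ k _).symm
  rw [this]
  exact Γ.beta_continuousAt hreg _

theorem scatteringMatrix_meromorphic (hN : 1 ≤ N) (hβ : ∀ k s, Γ.beta k s = β k) (p q : Fin 2) :
    Meromorphic fun k => Γ.scatteringMatrix k p q := by
  intro k
  have hβm := beta_const_meromorphic hN hβ k
  refine (periodicScattering_meromorphicAt N (meromorphic_of_differentiable Γ.differentiable_eps k)
    hβm ((meromorphic_of_differentiable (f := fun k => Complex.cos (k * Γ.ℓ)) (by fun_prop) k).add
      (hβm.mul (meromorphic_of_differentiable (f := fun k => Complex.sin (k * Γ.ℓ))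
        (by fun_prop) k))) p q).congr ?_
  filter_upwards [eventually_scatteringMatrix_eq hN hβ k] with k' hk'
  rw [hk']
  rfl

/-- Where Δ ≠ 0 the formula is continuous. Where Δ = 0, a finite limit of t_N would make t_N Δ tend
to 0, although it equals the nowhere vanishing -ε^(1-N) nearby. -/
theorem scatteringPole_iff (hN : 1 ≤ N) (hβ : ∀ k s, Γ.beta k s = β k) {k : ℂ}
    (hreg : Γ.IsRegular k) : Γ.ScatteringPole k ↔ Γ.combDet k = 0 := by
  have hβc := beta_const_continuousAt hN hβ hreg
  have hεc : ContinuousAt Γ.eps k := Γ.differentiable_eps.continuous.continuousAt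
  have hε0 : Γ.eps k ≠ 0 := Complex.exp_ne_zero _
  set ζ : ℂ → ℂ := fun k => Complex.cos (k * Γ.ℓ) + β k * Complex.sin (k * Γ.ℓ) with hζ
  have hζc : ContinuousAt ζ k :=
    ContinuousAt.add (by fun_prop) (hβc.mul (by fun_prop))
  have hev := eventually_scatteringMatrix_eq hN hβ k
  have hDet := Γ.combDet_eq_of_beta_const hN (hβ k)
  constructor
  · rintro ⟨p, q, h⟩
    by_contra hD
    refine (not_hasPoleAt_iff (scatteringMatrix_meromorphic hN hβ p q k)).2 ?_ h
    have hΔ : chebDenominator N (Γ.eps k) (β k) (ζ k) ≠ 0 := fun h0 => hD (by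
      rw [hDet, h0, mul_zero])
    obtain ⟨c, hc⟩ := ContinuousAt.exists_tendsto_punctured
      (periodicScattering_continuousAt N hεc hβc hζc hε0 hΔ p q)
    refine ⟨c, hc.congr' ?_⟩
    filter_upwards [hev] with k' hk'
    rw [hk']
  · intro hD
    have hΔ : chebDenominator N (Γ.eps k) (β k) (ζ k) = 0 := by
      rw [hDet] at hD
      exact (mul_eq_zero.1 hD).resolve_left (neg_ne_zero.2 (pow_ne_zero _ hε0))
    by_contra hno
    obtain ⟨c, hc⟩ := (not_hasPoleAt_iff (scatteringMatrix_meromorphic hN hβ 0 0 k)).1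
      fun h => hno ⟨0, 0, h⟩
    have hΔc := chebDenominator_continuousAt N hεc hβc hζc
    have t1 := hc.mul (hΔc.tendsto.mono_left (nhdsWithin_le_nhds (s := {k}ᶜ)))
    rw [hΔ, mul_zero] at t1
    have t2 : Tendsto (fun k' => -Γ.eps k' ^ (1 - (N : ℤ))) (𝓝[≠] k)
        (𝓝 (-Γ.eps k ^ (1 - (N : ℤ)))) :=
      (hεc.zpow₀ (1 - (N : ℤ)) (Or.inl hε0)).neg.tendsto.mono_left nhdsWithin_le_nhds
    have e : -Γ.eps k ^ (1 - (N : ℤ)) = 0 := by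
      refine tendsto_nhds_unique (t2.congr' ?_) t1
      filter_upwards [hev, Γ.eventually_combDet_ne_zero hN k] with k' hk' hD'
      have hΔ' : chebDenominator N (Γ.eps k') (β k') (ζ k') ≠ 0 := fun h0 => hD'.2 (by
        rw [Γ.combDet_eq_of_beta_const hN (hβ k'), h0, mul_zero])
      rw [hk']
      simp only [periodicScattering, Matrix.of_apply, Matrix.cons_val_zero]
      exact (div_mul_cancel₀ _ hΔ').symm
    exact neg_ne_zero.2 (zpow_ne_zero _ hε0) e

end ConstantCoupling

end CombGraph

end

theorem mainTheorem3 :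
    -- general combs
    (∀ (N : ℕ), 1 ≤ N → ∀ Γ : CombGraph N,
      -- the solutions `u_L` and `u_0` exist and are unique on the teeth
      (∀ (k : ℂ) (s : Fin N),
        CombGraph.IsOuterSolution (Γ.V s) (Γ.L s) (k ^ 2) (Γ.uL k s) ∧
        (∀ u, CombGraph.IsOuterSolution (Γ.V s) (Γ.L s) (k ^ 2) u →
          EqOn u (Γ.uL k s) (Icc 0 (Γ.L s))) ∧
        CombGraph.IsInnerSolution (Γ.V s) (Γ.L s) (k ^ 2) (Γ.u0 k s) ∧
        (∀ u, CombGraph.IsInnerSolution (Γ.V s) (Γ.L s) (k ^ 2) u →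
          EqOn u (Γ.u0 k s) (Icc 0 (Γ.L s)))) ∧
      -- all `k` with non-real energy are regular, and the exceptional `k` are isolated
      (∀ k : ℂ, (k ^ 2).im ≠ 0 → Γ.IsRegular k) ∧
      (∀ k₀ : ℂ, ∀ᶠ k in 𝓝[≠] k₀, Γ.IsRegular k) ∧
      -- the Krein formula on the physical sheet
      (∀ k : ℂ, 0 < k.im → Γ.IsRegular k → Γ.combDet k ≠ 0 →
        (∀ M, Γ.coefMatrix k * M = Γ.coefRhs k ↔ M = Γ.kreinCoef k) ∧
        (∃ R₀ : Γ.decoupled.Space →L[ℂ] Γ.decoupled.Space,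
          CombGraph.IsResolvent Γ.decoupled.hamiltonian (k ^ 2) R₀ ∧
            Γ.decoupled.HasKernel R₀ (Γ.freeKernel k)) ∧
        ∃ R : Γ.Space →L[ℂ] Γ.Space,
          CombGraph.IsResolvent Γ.hamiltonian (k ^ 2) R ∧ Γ.HasKernel R (Γ.kreinKernel k)) ∧
      (∀ k : ℂ, 0 < k.im → Γ.IsRegular k →
        (CombGraph.InResolventSet Γ.hamiltonian (k ^ 2) ↔ Γ.combDet k ≠ 0)) ∧
      (∀ k : ℂ, 0 < k.im → (k ^ 2).im ≠ 0 → Γ.combDet k ≠ 0) ∧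
      -- meromorphic continuation of the resolvent kernel to all complex momenta
      (∀ i j, ∀ x ∈ Γ.edge i, ∀ y ∈ Γ.edge j, Meromorphic fun k => Γ.kreinKernel k i j x y) ∧
      -- its singularities are the zeros of the determinant
      (∀ k : ℂ, Γ.IsRegular k →
        ((Γ.coefMatrix k).det = 0 ↔ Γ.combDet k = 0) ∧
        ((∃ m n, CombGraph.HasPoleAt (fun k' => Γ.kreinCoef k' m n) k) ↔ Γ.combDet k = 0) ∧
        (Γ.ResolventPole k ↔ Γ.combDet k = 0))) ∧
    -- periodic combs
    (∀ (N : ℕ), 1 ≤ N → ∀ (ℓ L : ℝ) (V : ℝ → ℝ) (b c d : ℝ) (hℓ : 0 < ℓ) (hL : 0 < L)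
      (hV : IntegrableOn V (Ioo 0 L) volume),
      let Γ : CombGraph N := CombGraph.periodic N ℓ L V b c d hℓ hL hV
      let β : ℂ → ℂ := fun k => CombGraph.effCoupling V L b c d k
      let ε : ℂ → ℂ := fun k => Complex.exp (Complex.I * k * ℓ)
      let ζ : ℂ → ℂ := fun k => Complex.cos (k * ℓ) + β k * Complex.sin (k * ℓ)
      let Δ : ℂ → ℂ := fun k => CombGraph.chebDenominator N (ε k) (β k) (ζ k)
      -- the closed form of the determinant
      (∀ k : ℂ, Γ.IsRegular k → Γ.combDet k = -ε k ^ (N - 1) * Δ k) ∧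
      -- the S-matrix, with amplitudes of denominator `Δ`, is meromorphic
      (∀ k : ℂ, Γ.IsRegular k → Γ.combDet k ≠ 0 →
        Γ.IsScatteringMatrix k (Γ.scatteringMatrix k) ∧
        Γ.scatteringMatrix k =
          !![-ε k ^ (1 - (N : ℤ)) / Δ k,
             ε k ^ (2 - 2 * (N : ℤ)) * (Complex.I * β k *
               (Polynomial.Chebyshev.U ℂ ((N : ℤ) - 1)).eval (ζ k) / Δ k);
             Complex.I * β k * (Polynomial.Chebyshev.U ℂ ((N : ℤ) - 1)).eval (ζ k) / Δ k,
             -ε k ^ (1 - (N : ℤ)) / Δ k]) ∧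
      (∀ p q, Meromorphic fun k => Γ.scatteringMatrix k p q) ∧
      -- the poles of the continued resolvent and of the S-matrix coincide at all regular momenta
      (∀ k : ℂ, Γ.IsRegular k →
        (Γ.combDet k = 0 ↔ Δ k = 0) ∧
        (Γ.ResolventPole k ↔ Γ.combDet k = 0) ∧
        (Γ.ScatteringPole k ↔ Γ.combDet k = 0) ∧
        (Γ.ResolventPole k ↔ Γ.ScatteringPole k))) := by
  refine ⟨fun N hN Γ => ⟨fun k s => ?_, fun k hk => Γ.isRegular_of_im_ne_zero hk,
    Γ.eventually_isRegular, fun k hk hreg hD => ⟨?_, ?_, ?_⟩,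
    fun k hk hreg => CombGraph.inResolventSet_iff hN hk hreg,
    fun k hk hk2 => CombGraph.combDet_ne_zero_of_im_ne_zero hN hk hk2,
    fun i j x hx y hy => Γ.kreinKernel_meromorphic hx hy, fun k hreg =>
      ⟨Γ.coefMatrix_det_eq_zero_iff hreg, CombGraph.exists_kreinCoef_pole_iff hN hreg,
        CombGraph.resolventPole_iff hN hreg⟩⟩, ?_⟩
  · have h := CombGraph.tooth_solutions (Γ.L_pos s) (Γ.V_int s)
    exact ⟨h.1 _, fun u hu => hu.eqOn (Γ.L_pos s) (Γ.V_int s) (h.1 _), h.2.1 _,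
      fun u hu => hu.eqOn (Γ.L_pos s) (Γ.V_int s) (h.2.1 _)⟩
  · exact Γ.coefMatrix_mul_eq_iff fun h => hD ((Γ.coefMatrix_det_eq_zero_iff hreg).1 h)
  · exact CombGraph.exists_resolvent_freeKernel hN hk hreg
  · exact CombGraph.exists_resolvent_kreinKernel hN hk hreg hD
  · intro N hN ℓ L V b c d hℓ hL hV Γ β ε ζ Δ
    -- Constancy of β_s is the only consequence of periodicity of the teeth that is used.
    have hβ : ∀ k s, Γ.beta k s = β k := fun k s => rfl
    have hdet : ∀ k, Γ.combDet k = -ε k ^ (N - 1) * Δ k := fun k =>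
      Γ.combDet_eq_of_beta_const hN (hβ k)
    refine ⟨fun k _ => hdet k, fun k hreg hD => CombGraph.scatteringMatrix_eq hN hreg (hβ k) hD,
      fun p q => CombGraph.scatteringMatrix_meromorphic hN hβ p q, fun k hreg => ⟨?_, ?_, ?_, ?_⟩⟩
    · rw [hdet k]
      simp [ε, Complex.exp_ne_zero]
    · exact CombGraph.resolventPole_iff hN hreg
    · exact CombGraph.scatteringPole_iff hN hβ hreg
    · exact (CombGraph.resolventPole_iff hN hreg).trans
        (CombGraph.scatteringPole_iff hN hβ hreg).symm
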